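/- **Setting.** Let $d\in\{2,3\}$, let $\Omega\subset\mathbb R^d$ be a bounded polygonal (polyhedral) domain lying on one side of its boundary $\Gamma=\Gamma_D\cup\Gamma_N$ (disjoint, measurable, $\operatorname{meas}(\Gamma_D)\neq0$), and let $T>0$. Put $H=L_2(\Omega)^d$, $V=\{v\in H^1(\Omega)^d: v|_{\Gamma_D}=0\}$, and let $(\cdot,\cdot)$ be the inner product of $H$. With $\mu_0,\lambda_0>0$, $\epsilon(v)=\frac12(\nabla v+(\nabla v)^T)$ and $\sigma_0(v)=2\mu_0\epsilon(v)+\lambda_0\operatorname{Tr}(\epsilon(v))I$, let $a(v,w)=\int_\Omega(2\mu_0\epsilon_{ij}(v)\epsilon_{ij}(w)+\lambda_0\epsilon_{ii}(v)\epsilon_{jj}(w))\,dx$. The kernel $\mathcal K:(0,\infty)\to\mathbb R$ is nonnegative and nonincreasing with $\int_0^\infty\mathcal K<1$. Let $f,j_1,j_2\in L_2(0,T;H)$, $g\in L_2(0,T;L_2(\Gamma_N)^d)$, $u^0,v^0,z_1^T,z_2^T\in H$. Let $$\mathcal U=H^1(0,T;V)\times H^1(0,T;H),\qquad \mathcal U^*=H^1(0,T;H)\times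 H^1(0,T;V),$$ let $\mathcal V$ be the set of right continuous $v\in L_2(0,T;H)\times L_2(0,T;V)$ and $\mathcal V^*$ the set of left continuous $v\in L_2(0,T;V)\times L_2(0,T;H)$. Define $$B(u,v)=\int_0^T\Big\{(\dot u_2,v_2)+a(u_1,v_2)-\int_0^t\mathcal K(t-s)a(u_1(s),v_2(t))\,ds+(\dot u_1,v_1)-(u_2,v_1)\Big\}dt+(u_1(0),v_1(0))+(u_2(0),v_2(0)),$$ $$L(v)=\int_0^T\{(f,v_2)+(g,v_2)_{\Gamma_N}\}\,dt+(u^0,v_1(0))+(v^0,v_2(0)),$$ $$B^*(v,z)=\int_0^T\Big\{-(v_1,\dot z_1)+a(v_1,z_2)-\int_t^T\mathcal K(s-t)a(v_1(t),z_2(s))\,ds-(v_2,\dot z_2)-(v_2,z_1)\Big\}dt+(v_1(T),z_1(T))+(v_2(T),z_2(T)),$$ $$L^*(v)=\int_0^T\{(v_1,j_1)+(v_2,j_2)\}\,dt+(v_1(T),z_1^T)+(v_2(T),z_2^T).$$ **Discretization.** Let $0=t_0<\dots<t_N=T$ and $I_n=(t_{n-1},t_n)$; let $\mathcal T_h^n$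 ($0\le n\le N$) be decompositions of $\bar\Omega$ into finitely many closed simplices with disjoint interiors (hanging nodes allowed), and let $\bar{\mathcal T}_h^n$ ($1\le n\le N$) be such a decomposition that refines both $\mathcal T_h^{n-1}$ and $\mathcal T_h^n$. Let $V_h^n,\bar V_h^n\subset V$ be the spaces of continuous piecewise linear functions on $\mathcal T_h^n,\bar{\mathcal T}_h^n$ that lie in $V$. $\mathcal U_{hk}$ consists of the pairs $U=(U_1,U_2)$ that are continuous on $\bar\Omega\times[0,T]$, linear in $t$ on each $I_n$, with $U(\cdot,t_n)\in(V_h^n)^2$ and $U(\cdot,t)\in(\bar V_h^n)^2$ for $t\in I_n$; $\mathcal V_{hk}$ consists of the pairs that are constant in $t$ on each $[t_{n-1},t_n)$ with value in $(V_h^n)^2$. **Theorem.** Let $u\in\mathcal U$ satisfy $B(u,v)=L(v)$ for all $v\in\mathcal V$, let $U\in\mathcal U_{hk}$ satisfy $B(U,W)=L(W)$ for all $W\in\mathcal V_{hk}$, and let $z\in\mathcal U^*$ satisfy $B^*(v,z)=L^*(v)$ for all $v\in\mathcal V^*$. Let $z_{hk}\in\mathcal V_{hk}$ be arbitrary, $E_{hk}z=z-z_{hk}$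 and $e=U-u$. Then $$L^*(e)=\sum_{K\in\mathcal T_h^0}\Theta_{0,K}+\sum_{n=1}^N\sum_{K\in\bar{\mathcal T}_h^n}\sum_{i=1}^4\Theta_{i,K}^n+\sum_{n=1}^N\sum_{j=1}^n\sum_{K\in\bar{\mathcal T}_h^j}\Theta_{5,K}^{n,j},\tag{1}$$ $$L^*(e)=\sum_{K\in\mathcal T_h^0}\Theta_{0,K}+\sum_{n=1}^N\sum_{K\in\bar{\mathcal T}_h^n}\sum_{i=1}^5\Theta_{i,K}^n,\tag{2}$$ $$L^*(e)=\sum_{K\in\mathcal T_h^0}\Theta_{0,K}+\sum_{n=1}^N\sum_{K\in\bar{\mathcal T}_h^n}\sum_{i=1}^4\Theta_{i,K}^n+\sum_{n=1}^N\sum_{j=n}^N\sum_{K\in\bar{\mathcal T}_h^n}\hat\Theta_{5,K}^{n,j};\tag{3}$$ moreover, if $\bar{\mathcal T}_h^j$ refines $\bar{\mathcal T}_h^n$ whenever $n\le j$, then (3) also holds with the innermost sum of the last term taken over $K\in\bar{\mathcal T}_h^j$. Here, with $(\cdot,\cdot)_{K^n}=\int_{I_n}(\cdot,\cdot)_K\,dt$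 and $(\cdot,\cdot)_{\partial K^n}=\int_{I_n}(\cdot,\cdot)_{\partial K}\,dt$, $$\Theta_{0,K}=(U_1(0)-u^0,E_{hk}z_1(0))_K+(U_2(0)-v^0,E_{hk}z_2(0))_K,$$ $$\Theta_{1,K}^n=(\dot U_1-U_2,E_{hk}z_1)_{K^n},\quad\Theta_{2,K}^n=(\dot U_2-f,E_{hk}z_2)_{K^n},\quad\Theta_{3,K}^n=(g_d-g,E_{hk}z_2)_{\partial K^n},\quad\Theta_{4,K}^n=(r_d,E_{hk}z_2)_{\partial K^n},$$ $$\Theta_{5,K}^{n,j}=-\int_{I_n}\Big(\int_{t_{j-1}}^{t_j\wedge t}\mathcal K(t-s)r_d(s)\,ds,\,E_{hk}z_2(t)\Big)_{\partial K}dt,$$ $$\Theta_{5,K}^n=-\Big(r_d,\int_t^T\mathcal K(s-t)E_{hk}z_2(s)\,ds\Big)_{\partial K^n},\qquad\hat\Theta_{5,K}^{n,j}=-\int_{I_n}\Big(r_d(t),\int_{t_{j-1}\vee t}^{t_j}\mathcal K(s-t)E_{hk}z_2(s)\,ds\Big)_{\partial K}dt,$$ where $g$ is extended by $0$ off $\Gamma_N$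 and, for $n$ the outward unit normal of the cell $K$, $r_d=-\frac12[\sigma_0(U_1)\cdot n]$ on $\partial K\cap\Omega$ (the jump $[\,\cdot\,]$ being the value from the neighbouring cell minus the value from $K$) and $r_d=0$ on $\partial K\cap\partial\Omega$; $g_d(t)=\sigma_0(U_1(t))\cdot n-\int_0^t\mathcal K(t-s)\sigma_0(U_1(s))\cdot n\,ds$ on $\partial K\cap\Gamma_N$ and $g_d=0$ elsewhere on $\partial K$. -/

import Mathlib

open MeasureTheory Set Filter Topology
open scoped ContDiff

noncomputable section

namespace Visco

/-- Points and vectors of `d`-dimensional Euclidean space. -/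
abbrev Vec (d : ℕ) := EuclideanSpace ℝ (Fin d)

/-- Linear maps of `ℝ^d`, the values of gradients of vector fields. -/
abbrev Mat (d : ℕ) := Vec d →L[ℝ] Vec d

/-- The `(d - 1)`-dimensional surface measure: Hausdorff measure normalized so that it agrees with
Lebesgue measure on hyperplanes. -/
def surf (d : ℕ) : Measure (Vec d) := Measure.euclideanHausdorffMeasure (d - 1)

/-! ### Simplices, triangulations, polygonal domains -/

/-- `K` is a closed nondegenerate `d`-simplex. -/
def IsSimplex {d : ℕ} (K : Set (Vec d)) : Prop :=
  ∃ p : Fin (d + 1) → Vec d, AffineIndependent ℝ p ∧ K = convexHull ℝ (range p)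

/-- `M` is a decomposition of the closure of `Ω` into finitely many closed simplices with pairwise
disjoint interiors. Hanging nodes are allowed. -/
structure IsTriangulation {d : ℕ} (Ω : Set (Vec d)) (M : Finset (Set (Vec d))) : Prop where
  simplex : ∀ K ∈ M, IsSimplex K
  cover : ⋃ K ∈ M, K = closure Ω
  disjoint : ∀ K ∈ M, ∀ L ∈ M, K ≠ L → Disjoint (interior K) (interior L)

/-- Every cell of `M` lies in a cell of `M₀`. -/
def Refines {d : ℕ} (M M₀ : Finset (Set (Vec d))) : Prop :=
  ∀ K ∈ M, ∃ L ∈ M₀, K ⊆ L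

/-- Bounded polygonal (polyhedral) domains. The condition `interior (closure Ω) = Ω` says that the
domain lies on one side of its boundary (there are no slits). -/
structure IsPolygonalDomain {d : ℕ} (Ω : Set (Vec d)) : Prop where
  isOpen : IsOpen Ω
  connected : IsConnected Ω
  bounded : Bornology.IsBounded Ω
  one_sided : interior (closure Ω) = Ω
  polygonal : ∃ M : Finset (Set (Vec d)), IsTriangulation Ω M

/-- `ν` is a unit outward normal at `x` of the convex set `K`. -/
def IsOutwardNormal {d : ℕ} (K : Set (Vec d)) (x ν : Vec d) : Prop :=
  ‖ν‖ = 1 ∧ ∀ y ∈ K, inner ℝ ν (y - x) ≤ 0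

open Classical in
/-- The unit outward normal of the simplex `K` at a boundary point. It is unique off the
lower-dimensional faces, hence almost everywhere on the boundary; it is set to `0` where it is not
unique. -/
def outwardNormal {d : ℕ} (K : Set (Vec d)) (x : Vec d) : Vec d :=
  if h : ∃! ν, IsOutwardNormal K x ν then h.choose else 0

/-! ### Function spaces on `Ω` -/

/-- `H = L²(Ω)^d`. -/
abbrev HSpace {d : ℕ} (Ω : Set (Vec d)) := Lp (Vec d) 2 (volume.restrict Ω)

/-- `L²(Ω)^{d × d}`. -/
abbrev GSpace {d : ℕ} (Ω : Set (Vec d)) := Lp (Mat d) 2 (volume.restrict Ω)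

/-- Pairs (field, gradient). An element of `H¹(Ω)^d` is represented by the pair `(v, ∇v)`, so that
the topology induced by the product is that of `H¹`. -/
abbrev Pair {d : ℕ} (Ω : Set (Vec d)) := HSpace Ω × GSpace Ω

/-- `p = (v, ∇v)` where `∇v` is the weak gradient of `v`, that is `v ∈ H¹(Ω)^d`. -/
def IsH1 {d : ℕ} (Ω : Set (Vec d)) (p : Pair Ω) : Prop :=
  ∀ φ : Vec d → ℝ, ContDiff ℝ ∞ φ → HasCompactSupport φ → tsupport φ ⊆ Ω → ∀ y : Vec d,
    ∫ x in Ω, (fderiv ℝ φ x y) • p.1 x = - ∫ x in Ω, φ x • p.2 x y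

/-- `γ ∈ L²(S)` is the trace of `p` on the surface `S ⊆ closure Ω`: there are smooth fields that
converge to `p` in `H¹(Ω)` and whose restrictions to `S` converge to `γ` in `L²(S)`. -/
def IsTrace {d : ℕ} (Ω S : Set (Vec d)) (p : Pair Ω) (γ : Vec d → Vec d) : Prop :=
  MemLp γ 2 ((surf d).restrict S) ∧
  ∃ φ : ℕ → Vec d → Vec d, (∀ m, ContDiff ℝ ∞ (φ m)) ∧
    Tendsto (fun m => eLpNorm (fun x => φ m x - p.1 x) 2 (volume.restrict Ω)) atTop (𝓝 0) ∧
    Tendsto (fun m => eLpNorm (fun x => fderiv ℝ (φ m) x - p.2 x) 2 (volume.restrict Ω))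
      atTop (𝓝 0) ∧
    Tendsto (fun m => eLpNorm (fun x => φ m x - γ x) 2 ((surf d).restrict S)) atTop (𝓝 0)

open Classical in
/-- The trace of `p` on `S` (unique up to null sets). -/
def trace {d : ℕ} (Ω S : Set (Vec d)) (p : Pair Ω) : Vec d → Vec d :=
  if h : ∃ γ, IsTrace Ω S p γ then h.choose else 0

/-- `V = {v ∈ H¹(Ω)^d : v = 0 on Γ_D}`. -/
def VSpace {d : ℕ} (Ω ΓD : Set (Vec d)) : Set (Pair Ω) :=
  {p | IsH1 Ω p ∧ IsTrace Ω ΓD p 0}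

open Classical in
/-- The pair `(w, ∇w)` of a piecewise smooth continuous field `w` given pointwise. -/
def toPair {d : ℕ} (Ω : Set (Vec d)) (w : Vec d → Vec d) : Pair Ω :=
  (if h : MemLp w 2 (volume.restrict Ω) then h.toLp w else 0,
   if h : MemLp (fderiv ℝ w) 2 (volume.restrict Ω) then h.toLp (fderiv ℝ w) else 0)

/-! ### Elasticity -/

/-- Strain `ε = (∇u + (∇u)ᵀ) / 2` for `∇u = A`. -/
def strain {d : ℕ} (A : Mat d) : Matrix (Fin d) (Fin d) ℝ :=
  fun i j => (A (EuclideanSpace.single j 1) i + A (EuclideanSpace.single i 1) j) / 2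

/-- The normal stress `σ₀ ν` with `σ₀ = 2 μ₀ ε + λ₀ Tr(ε) I`, for the gradient `A`. -/
def normalStress {d : ℕ} (μ₀ lam₀ : ℝ) (A : Mat d) (ν : Vec d) : Vec d :=
  WithLp.toLp 2 (Matrix.mulVec
    ((2 * μ₀) • strain A + (lam₀ * (strain A).trace) • (1 : Matrix (Fin d) (Fin d) ℝ)) ν.ofLp)

/-- The bilinear form `a(v, w)`. -/
def aForm {d : ℕ} {Ω : Set (Vec d)} (μ₀ lam₀ : ℝ) (v w : Pair Ω) : ℝ :=
  ∫ x in Ω, (2 * μ₀ * (∑ i, ∑ j, strain (v.2 x) i j * strain (w.2 x) i j)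
    + lam₀ * ((strain (v.2 x)).trace * (strain (w.2 x)).trace))

/-! ### Data of the problem -/

/-- The data of the initial-boundary value problem and of its dual problem. -/
structure Data (d : ℕ) where
  Ω : Set (Vec d)
  ΓD : Set (Vec d)
  T : ℝ
  μ₀ : ℝ
  lam₀ : ℝ
  /-- The memory kernel. -/
  ker : ℝ → ℝ
  f : ℝ → HSpace Ω
  g : ℝ → Lp (Vec d) 2 ((surf d).restrict (frontier Ω \ ΓD))
  u₀ : HSpace Ω
  v₀ : HSpace Ω
  /-- Loads and final values of the dual problem, which define the goal functional. -/
  j₁ : ℝ → HSpace Ω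
  j₂ : ℝ → HSpace Ω
  zT₁ : HSpace Ω
  zT₂ : HSpace Ω
  domain : IsPolygonalDomain Ω
  ΓD_subset : ΓD ⊆ frontier Ω
  ΓD_measurable : MeasurableSet ΓD
  ΓD_pos : surf d ΓD ≠ 0
  T_pos : 0 < T
  μ₀_pos : 0 < μ₀
  lam₀_pos : 0 < lam₀
  ker_nonneg : ∀ t, 0 < t → 0 ≤ ker t
  ker_anti : AntitoneOn ker (Ioi 0)
  ker_integrable : IntegrableOn ker (Ioi 0)
  ker_lt_one : ∫ t in Ioi (0 : ℝ), ker t < 1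
  f_mem : MemLp f 2 (volume.restrict (Ioc 0 T))
  g_mem : MemLp g 2 (volume.restrict (Ioc 0 T))
  j₁_mem : MemLp j₁ 2 (volume.restrict (Ioc 0 T))
  j₂_mem : MemLp j₂ 2 (volume.restrict (Ioc 0 T))

namespace Data

variable {d : ℕ} (D : Data d)

/-- The Neumann part of the boundary. -/
def ΓN : Set (Vec d) := frontier D.Ω \ D.ΓD

/-- The space `V`. -/
def V : Set (Pair D.Ω) := VSpace D.Ω D.ΓD

/-- The form `a`. -/
def a (v w : Pair D.Ω) : ℝ := aForm D.μ₀ D.lam₀ v w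

/-- `(g(t), v)_{Γ_N}`. -/
def gPair (t : ℝ) (v : Pair D.Ω) : ℝ :=
  ∫ x in D.ΓN, inner ℝ (D.g t x) (trace D.Ω D.ΓN v x) ∂(surf d)

end Data

/-- `u ∈ H¹(0,T;X)` with values in `S ⊆ X`, for the continuous representative `u`. -/
def MemH1Time {X : Type*} [NormedAddCommGroup X] [NormedSpace ℝ X] (T : ℝ) (S : Set X)
    (u : ℝ → X) : Prop :=
  (∀ t ∈ Icc 0 T, u t ∈ S) ∧
  ∃ w : ℝ → X, MemLp w 2 (volume.restrict (Ioc 0 T)) ∧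
    ∀ t ∈ Icc 0 T, u t = u 0 + ∫ s in (0 : ℝ)..t, w s

namespace Data

variable {d : ℕ} (D : Data d)

/-- `𝒰 = H¹(0,T;V) × H¹(0,T;H)`. -/
def MemU (u₁ : ℝ → Pair D.Ω) (u₂ : ℝ → HSpace D.Ω) : Prop :=
  MemH1Time D.T D.V u₁ ∧ MemH1Time D.T univ u₂

/-- `𝒰* = H¹(0,T;H) × H¹(0,T;V)`. -/
def MemUStar (z₁ : ℝ → HSpace D.Ω) (z₂ : ℝ → Pair D.Ω) : Prop :=
  MemH1Time D.T univ z₁ ∧ MemH1Time D.T D.V z₂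

/-- `𝒱`: right continuous elements of `L²(0,T;H) × L²(0,T;V)`. -/
structure MemV (v₁ : ℝ → HSpace D.Ω) (v₂ : ℝ → Pair D.Ω) : Prop where
  memLp₁ : MemLp v₁ 2 (volume.restrict (Ioc 0 D.T))
  memLp₂ : MemLp v₂ 2 (volume.restrict (Ioc 0 D.T))
  mem₂ : ∀ t ∈ Ico 0 D.T, v₂ t ∈ D.V
  right₁ : ∀ t ∈ Ico 0 D.T, ContinuousWithinAt v₁ (Ici t) t
  right₂ : ∀ t ∈ Ico 0 D.T, ContinuousWithinAt v₂ (Ici t) t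

/-- `𝒱*`: left continuous elements of `L²(0,T;V) × L²(0,T;H)`. -/
structure MemVStar (v₁ : ℝ → Pair D.Ω) (v₂ : ℝ → HSpace D.Ω) : Prop where
  memLp₁ : MemLp v₁ 2 (volume.restrict (Ioc 0 D.T))
  memLp₂ : MemLp v₂ 2 (volume.restrict (Ioc 0 D.T))
  mem₁ : ∀ t ∈ Ioc 0 D.T, v₁ t ∈ D.V
  left₁ : ∀ t ∈ Ioc 0 D.T, ContinuousWithinAt v₁ (Iic t) t
  left₂ : ∀ t ∈ Ioc 0 D.T, ContinuousWithinAt v₂ (Iic t) t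

/-- The bilinear form `B(u, v)`. -/
def B (u₁ : ℝ → Pair D.Ω) (u₂ : ℝ → HSpace D.Ω)
    (v₁ : ℝ → HSpace D.Ω) (v₂ : ℝ → Pair D.Ω) : ℝ :=
  (∫ t in (0 : ℝ)..D.T,
    (inner ℝ (deriv u₂ t) (v₂ t).1 + D.a (u₁ t) (v₂ t)
      - (∫ s in (0 : ℝ)..t, D.ker (t - s) * D.a (u₁ s) (v₂ t))
      + inner ℝ (deriv u₁ t).1 (v₁ t) - inner ℝ (u₂ t) (v₁ t)))
  + inner ℝ (u₁ 0).1 (v₁ 0) + inner ℝ (u₂ 0) (v₂ 0).1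

/-- The linear form `L(v)`. -/
def L (v₁ : ℝ → HSpace D.Ω) (v₂ : ℝ → Pair D.Ω) : ℝ :=
  (∫ t in (0 : ℝ)..D.T, (inner ℝ (D.f t) (v₂ t).1 + D.gPair t (v₂ t)))
  + inner ℝ D.u₀ (v₁ 0) + inner ℝ D.v₀ (v₂ 0).1

/-- The dual bilinear form `B*(v, z)`. -/
def BStar (v₁ : ℝ → Pair D.Ω) (v₂ : ℝ → HSpace D.Ω)
    (z₁ : ℝ → HSpace D.Ω) (z₂ : ℝ → Pair D.Ω) : ℝ :=
  (∫ t in (0 : ℝ)..D.T,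
    (- inner ℝ (v₁ t).1 (deriv z₁ t) + D.a (v₁ t) (z₂ t)
      - (∫ s in t..D.T, D.ker (s - t) * D.a (v₁ t) (z₂ s))
      - inner ℝ (v₂ t) (deriv z₂ t).1 - inner ℝ (v₂ t) (z₁ t)))
  + inner ℝ (v₁ D.T).1 (z₁ D.T) + inner ℝ (v₂ D.T) (z₂ D.T).1

/-- The goal functional `L*(v)`. -/
def LStar (v₁ : ℝ → Pair D.Ω) (v₂ : ℝ → HSpace D.Ω) : ℝ :=
  (∫ t in (0 : ℝ)..D.T, (inner ℝ (v₁ t).1 (D.j₁ t) + inner ℝ (v₂ t) (D.j₂ t)))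
  + inner ℝ (v₁ D.T).1 D.zT₁ + inner ℝ (v₂ D.T) D.zT₂

/-- `u = (u₁, u₂)` solves the weak velocity-displacement problem. -/
def IsWeakSolution (u₁ : ℝ → Pair D.Ω) (u₂ : ℝ → HSpace D.Ω) : Prop :=
  D.MemU u₁ u₂ ∧ ∀ v₁ v₂, D.MemV v₁ v₂ → D.B u₁ u₂ v₁ v₂ = D.L v₁ v₂

/-- `z = (z₁, z₂)` solves the weak dual problem. -/
def IsDualSolution (z₁ : ℝ → HSpace D.Ω) (z₂ : ℝ → Pair D.Ω) : Prop :=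
  D.MemUStar z₁ z₂ ∧ ∀ v₁ v₂, D.MemVStar v₁ v₂ → D.BStar v₁ v₂ z₁ z₂ = D.LStar v₁ v₂

end Data

/-! ### The space-time mesh and the finite element spaces -/

/-- Time levels `0 = t_0 < ... < t_N = T`, a triangulation `mesh n` for every level `0 ≤ n ≤ N`, and
for every time interval `I_n = (t_{n-1}, t_n)`, `1 ≤ n ≤ N`, a common refinement `bar n` of the
triangulations at the two adjacent levels. -/
structure Mesh {d : ℕ} (D : Data d) where
  N : ℕ
  τ : ℕ → ℝ
  mesh : ℕ → Finset (Set (Vec d))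
  bar : ℕ → Finset (Set (Vec d))
  τ_zero : τ 0 = 0
  τ_last : τ N = D.T
  τ_lt : ∀ n ∈ Finset.Icc 1 N, τ (n - 1) < τ n
  mesh_tri : ∀ n ≤ N, IsTriangulation D.Ω (mesh n)
  bar_tri : ∀ n ∈ Finset.Icc 1 N, IsTriangulation D.Ω (bar n)
  bar_left : ∀ n ∈ Finset.Icc 1 N, Refines (bar n) (mesh (n - 1))
  bar_right : ∀ n ∈ Finset.Icc 1 N, Refines (bar n) (mesh n)

/-- The finite element space over `M`: the continuous piecewise linear fields that belong
to `V`. -/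
structure MemFE {d : ℕ} (D : Data d) (M : Finset (Set (Vec d))) (w : Vec d → Vec d) : Prop where
  continuousOn : ContinuousOn w (closure D.Ω)
  affine : ∀ K ∈ M, ∃ A : Vec d →ᵃ[ℝ] Vec d, EqOn w A K
  mem : toPair D.Ω w ∈ D.V

namespace Mesh

variable {d : ℕ} {D : Data d} (𝒯 : Mesh D)

/-- One component of the trial space: continuous on `closure Ω × [0,T]`, linear in time on every
interval, in `V_h^n` at `t_n` and in the space over the common refinement in between. -/
structure MemTrial (U : ℝ → Vec d → Vec d) : Prop where
  continuousOn : ContinuousOn (fun q : ℝ × Vec d => U q.1 q.2) (Icc 0 D.T ×ˢ closure D.Ω)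
  linear : ∀ n ∈ Finset.Icc 1 𝒯.N, ∀ x ∈ closure D.Ω, ∃ b c : Vec d,
    ∀ t ∈ Icc (𝒯.τ (n - 1)) (𝒯.τ n), U t x = b + t • c
  node : ∀ n ≤ 𝒯.N, MemFE D (𝒯.mesh n) (U (𝒯.τ n))
  slab : ∀ n ∈ Finset.Icc 1 𝒯.N, ∀ t ∈ Ioo (𝒯.τ (n - 1)) (𝒯.τ n), MemFE D (𝒯.bar n) (U t)

/-- One component of the test space: constant in time on every interval (and right continuous),
with values in `V_h^n`. -/
def MemTest (W : ℝ → Vec d → Vec d) : Prop :=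
  ∀ n ∈ Finset.Icc 1 𝒯.N, ∃ χ : Vec d → Vec d, MemFE D (𝒯.mesh n) χ ∧
    ∀ t ∈ Ico (𝒯.τ (n - 1)) (𝒯.τ n), W t = χ

end Mesh

/-- A field given pointwise at every time, as an `H¹`-valued function of time. -/
def emb {d : ℕ} (D : Data d) (W : ℝ → Vec d → Vec d) (t : ℝ) : Pair D.Ω := toPair D.Ω (W t)

/-- The same as an `L²`-valued function of time. -/
def embH {d : ℕ} (D : Data d) (W : ℝ → Vec d → Vec d) (t : ℝ) : HSpace D.Ω := (toPair D.Ω (W t)).1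

/-- `U = (U₁, U₂)` is the cG(1)cG(1) approximation. -/
def Mesh.IsCG {d : ℕ} {D : Data d} (𝒯 : Mesh D) (U₁ U₂ : ℝ → Vec d → Vec d) : Prop :=
  𝒯.MemTrial U₁ ∧ 𝒯.MemTrial U₂ ∧
  ∀ W₁ W₂, 𝒯.MemTest W₁ → 𝒯.MemTest W₂ →
    D.B (emb D U₁) (embH D U₂) (embH D W₁) (emb D W₂) = D.L (embH D W₁) (emb D W₂)

/-! ### Residuals -/

namespace Data

variable {d : ℕ} (D : Data d)

open Classical in
/-- The jump `[σ₀(w) n]` at `x ∈ ∂K` across the boundary of the cell `K` of `M`, with `n` the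
outward normal of `K`: value from the neighbouring cell minus value from `K`. At almost every point
of `∂K ∩ Ω` there is exactly one neighbouring cell. -/
def jump (M : Finset (Set (Vec d))) (w : Vec d → Vec d) (K : Set (Vec d)) (x : Vec d) : Vec d :=
  ∑ L ∈ M with L ≠ K ∧ x ∈ L,
    (normalStress D.μ₀ D.lam₀ (fderivWithin ℝ w L x) (outwardNormal K x)
      - normalStress D.μ₀ D.lam₀ (fderivWithin ℝ w K x) (outwardNormal K x))

open Classical in
/-- The jump residual `r_d` on `∂K`. -/
def rd (M : Finset (Set (Vec d))) (w : Vec d → Vec d) (K : Set (Vec d)) (x : Vec d) : Vec d :=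
  if x ∈ D.Ω then (-(1 / 2) : ℝ) • D.jump M w K x else 0

open Classical in
/-- The contribution `g_d` of the Neumann condition on `∂K`. On `∂Ω` the gradient of the piecewise
linear field is the one-sided one, from within the domain. -/
def gd (U₁ : ℝ → Vec d → Vec d) (K : Set (Vec d)) (t : ℝ) (x : Vec d) : Vec d :=
  if x ∈ D.ΓN then
    normalStress D.μ₀ D.lam₀ (fderivWithin ℝ (U₁ t) (closure D.Ω) x) (outwardNormal K x)
      - ∫ s in (0 : ℝ)..t, D.ker (t - s) •
          normalStress D.μ₀ D.lam₀ (fderivWithin ℝ (U₁ s) (closure D.Ω) x) (outwardNormal K x)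
  else 0

/-- `(v, w)_K` for `v, w ∈ L²(Ω)^d`. -/
def cellPair (K : Set (Vec d)) (v w : HSpace D.Ω) : ℝ := ∫ x in K, inner ℝ (v x) (w x)

/-- `(r, w)_{∂K}`, with the trace of `w` on `∂K`. -/
def bdryPair (K : Set (Vec d)) (r : Vec d → Vec d) (w : Pair D.Ω) : ℝ :=
  ∫ x in frontier K, inner ℝ (r x) (trace D.Ω (frontier K) w x) ∂(surf d)

/-- `Θ_{0,K}`, with `e₁ = E_hk z₁`, `e₂ = E_hk z₂` here and below. -/
def Θ0 (U₁ U₂ : ℝ → Vec d → Vec d) (e₁ : ℝ → HSpace D.Ω) (e₂ : ℝ → Pair D.Ω)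
    (K : Set (Vec d)) : ℝ :=
  D.cellPair K (embH D U₁ 0 - D.u₀) (e₁ 0) + D.cellPair K (embH D U₂ 0 - D.v₀) (e₂ 0).1

end Data

namespace Mesh

variable {d : ℕ} {D : Data d} (𝒯 : Mesh D)

/-- `Θ_{1,K}^n`. -/
def Θ1 (U₁ U₂ : ℝ → Vec d → Vec d) (e₁ : ℝ → HSpace D.Ω) (n : ℕ) (K : Set (Vec d)) : ℝ :=
  ∫ t in (𝒯.τ (n - 1))..(𝒯.τ n), D.cellPair K (deriv (embH D U₁) t - embH D U₂ t) (e₁ t)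

/-- `Θ_{2,K}^n`. -/
def Θ2 (U₂ : ℝ → Vec d → Vec d) (e₂ : ℝ → Pair D.Ω) (n : ℕ) (K : Set (Vec d)) : ℝ :=
  ∫ t in (𝒯.τ (n - 1))..(𝒯.τ n), D.cellPair K (deriv (embH D U₂) t - D.f t) (e₂ t).1

/-- `Θ_{3,K}^n`, with `g` extended by zero off `Γ_N`. -/
def Θ3 (U₁ : ℝ → Vec d → Vec d) (e₂ : ℝ → Pair D.Ω) (n : ℕ) (K : Set (Vec d)) : ℝ :=
  ∫ t in (𝒯.τ (n - 1))..(𝒯.τ n),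
    D.bdryPair K (fun x => D.gd U₁ K t x - D.ΓN.indicator (D.g t) x) (e₂ t)

/-- `Θ_{4,K}^n`. -/
def Θ4 (U₁ : ℝ → Vec d → Vec d) (e₂ : ℝ → Pair D.Ω) (n : ℕ) (K : Set (Vec d)) : ℝ :=
  ∫ t in (𝒯.τ (n - 1))..(𝒯.τ n), D.bdryPair K (D.rd (𝒯.bar n) (U₁ t) K) (e₂ t)

/-- The memory term with the partial convolution `(𝒦 * r_d)^j` of the jump residual, for a cell `K`
of `bar j` and `t ∈ I_n`, `j ≤ n`. -/
def Θ5Res (U₁ : ℝ → Vec d → Vec d) (e₂ : ℝ → Pair D.Ω) (n j : ℕ) (K : Set (Vec d)) : ℝ :=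
  - ∫ t in (𝒯.τ (n - 1))..(𝒯.τ n),
    D.bdryPair K
      (fun x => ∫ s in (𝒯.τ (j - 1))..(min (𝒯.τ j) t),
        D.ker (t - s) • D.rd (𝒯.bar j) (U₁ s) K x) (e₂ t)

/-- The memory term with the convolution applied to `E_hk z₂`, on the space-time cell `K × I_n`. -/
def Θ5Cell (U₁ : ℝ → Vec d → Vec d) (e₂ : ℝ → Pair D.Ω) (n : ℕ) (K : Set (Vec d)) : ℝ :=
  - ∫ t in (𝒯.τ (n - 1))..(𝒯.τ n),
    D.bdryPair K (D.rd (𝒯.bar n) (U₁ t) K) (∫ s in t..D.T, D.ker (s - t) • e₂ s)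

/-- The memory term with the partial convolution over `I_j`, `n ≤ j`, of `E_hk z₂`, for a cell `K`
of the triangulation `M`. -/
def Θ5Dual (M : Finset (Set (Vec d))) (U₁ : ℝ → Vec d → Vec d) (e₂ : ℝ → Pair D.Ω) (n j : ℕ)
    (K : Set (Vec d)) : ℝ :=
  - ∫ t in (𝒯.τ (n - 1))..(𝒯.τ n),
    D.bdryPair K (D.rd M (U₁ t) K)
      (∫ s in (max (𝒯.τ (j - 1)) t)..(𝒯.τ j), D.ker (s - t) • e₂ s)

/-- `∑_{i=1}^4 Θ_{i,K}^n`. -/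
def Θ1to4 (U₁ U₂ : ℝ → Vec d → Vec d) (e₁ : ℝ → HSpace D.Ω) (e₂ : ℝ → Pair D.Ω) (n : ℕ)
    (K : Set (Vec d)) : ℝ :=
  𝒯.Θ1 U₁ U₂ e₁ n K + 𝒯.Θ2 U₂ e₂ n K + 𝒯.Θ3 U₁ e₂ n K + 𝒯.Θ4 U₁ e₂ n K

end Mesh

end Visco

end

open MeasureTheory Set Filter Topology
open scoped ContDiff

noncomputable section

namespace Visco

/-! The identity is Galerkin orthogonality followed by elementwise integration by parts. The error
`e = U - u` is itself an admissible test pair for the dual problem, so `L*(e) = B*(e, z)`.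
Integration by parts in time and the adjointness of forward and backward convolution give `B*(e, z)
= B(e, z)`. The weak problem tested with `z` and the discrete problem tested with `z_hk` then yield
`L*(e) = B(U, z - z_hk) - L(z - z_hk)`, the residual of `U` weighted by `E_hk z`
(`Mesh.LStar_error`).

To localize the residual, note that on every cell the stress of `U₁(t)` is constant in space. The
divergence theorem on a simplex turns `a(U₁, q)` into normal stresses on the cell boundaries. At an
interior face the two normals are opposite, so the fluxes combine to a jump, half of which is
assigned to either side; on `Γ_D` the trace of `q` vanishes; on `Γ_N` the boundary stress remains
(`IsPL.a_eq`). Hence `a(U₁(t), ·)` is a jump functional, `Mesh.jumpForm`, plus a pairing on `Γ_N`.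
The latter, with its memory and with `g`, gives `Θ3`; the jump functional gives `Θ4`; its
convolution with the kernel is the memory term (`Mesh.residual_eq`).

The representations are different ways to distribute this single memory number over cells and slabs:
convolve the residual (`Mesh.sum_Θ5Res`), convolve the weight instead (`Mesh.sum_Θ5Cell`), or split
the convolved weight over the slabs (`Mesh.sum_Θ5Dual`). Since `Mesh.jumpForm` does not see the
triangulation, any mesh on which `U` is piecewise linear may be used in the last form.

Two devices make this rigorous. A trace inequality for simplices, extended by density and orthogonal
projection, gives one continuous trace operator on the union of all cell boundaries, which computes
every trace in the statement. And `U`, being piecewise linear in time, is at all times a combination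
of finitely many nodal fields, so exceptional null sets in space can be chosen independently of time
and time integrals of residuals reduce to finite sums. -/

/-- The hyperplane through `p` with normal `g`. -/
def hyperplane {d : ℕ} (g p : Vec d) : Set (Vec d) := {x | inner ℝ g (x - p) = 0}

/-! ### Surface measure on hyperplanes and oblique slicing of Lebesgue measure. -/

section Hyperplane

variable {d : ℕ} {g : Vec d} (p : Vec d)

lemma isClosed_hyperplane : IsClosed (hyperplane g p) :=
  isClosed_eq (by fun_prop) continuous_const

lemma isometry_add_orthogonal : Isometry fun y : (ℝ ∙ g)ᗮ => p + (y : Vec d) :=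
  (IsometryEquiv.addLeft p).isometry.comp isometry_subtype_coe

lemma range_add_orthogonal : range (fun y : (ℝ ∙ g)ᗮ => p + (y : Vec d)) = hyperplane g p := by
  ext x
  simp only [mem_range, hyperplane, mem_ofPred_eq]
  constructor
  · rintro ⟨y, rfl⟩
    simpa using Submodule.mem_orthogonal_singleton_iff_inner_right.1 y.2
  · intro h
    exact ⟨⟨x - p, Submodule.mem_orthogonal_singleton_iff_inner_right.2 h⟩, by simp⟩

lemma finrank_orthogonal_singleton (hg : g ≠ 0) : Module.finrank ℝ (ℝ ∙ g)ᗮ = d - 1 := by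
  have h := Submodule.finrank_add_finrank_orthogonal (ℝ ∙ g)
  rw [finrank_span_singleton hg, finrank_euclideanSpace_fin] at h
  omega

/-- The surface measure on a hyperplane is the Lebesgue measure of its direction. -/
lemma map_volume_orthogonal (hg : g ≠ 0) :
    (volume : Measure (ℝ ∙ g)ᗮ).map (fun y : (ℝ ∙ g)ᗮ => p + (y : Vec d))
      = (surf d).restrict (hyperplane g p) := by
  rw [surf, ← range_add_orthogonal, ← (isometry_add_orthogonal p).map_euclideanHausdorffMeasure,
    ← finrank_orthogonal_singleton hg, InnerProductSpace.euclideanHausdorffMeasure_eq_volume]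

/-- The surface measure is not σ-finite on the whole space; Fubini is available only after
restriction to a hyperplane, where it is a Lebesgue measure. -/
lemma sigmaFinite_surf_hyperplane (hg : g ≠ 0) :
    SigmaFinite ((surf d).restrict (hyperplane g p)) := by
  rw [← map_volume_orthogonal p hg]
  exact (isometry_add_orthogonal p).isClosedEmbedding.measurableEmbedding.sigmaFinite_map

lemma surf_hyperplane_inter_lt_top (hg : g ≠ 0) {s : Set (Vec d)} (hs : Bornology.IsBounded s) :
    surf d (s ∩ hyperplane g p) < ⊤ := by
  obtain ⟨R, hR⟩ := hs.subset_closedBall p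
  have h1 : surf d (s ∩ hyperplane g p) ≤
      (surf d).restrict (hyperplane g p) (Metric.closedBall p R) := by
    rw [Measure.restrict_apply measurableSet_closedBall]
    exact measure_mono (inter_subset_inter_left _ hR)
  refine h1.trans_lt ?_
  rw [← map_volume_orthogonal p hg, (isometry_add_orthogonal
    p).isClosedEmbedding.measurableEmbedding.map_apply]
  refine (measure_mono (t := Metric.closedBall 0 R) ?_).trans_lt measure_closedBall_lt_top
  intro y hy
  simpa [dist_eq_norm] using hy

/-- A hyperplane of a hyperplane has vanishing surface measure. -/
lemma surf_hyperplane_inter_eq_zero (hg : g ≠ 0) {A : Vec d →ᵃ[ℝ] ℝ} {x y : Vec d}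
    (hx : x ∈ hyperplane g p) (hy : y ∈ hyperplane g p) (hxy : A x ≠ A y) (c : ℝ) :
    surf d (hyperplane g p ∩ {z | A z = c}) = 0 := by
  have hA : Continuous A := A.continuous_of_finiteDimensional
  rw [inter_comm, ← Measure.restrict_apply (isClosed_eq hA continuous_const).measurableSet,
    ← map_volume_orthogonal p hg, (isometry_add_orthogonal
    p).isClosedEmbedding.measurableEmbedding.map_apply]
  let f : (ℝ ∙ g)ᗮ →ᵃ[ℝ] ℝ := A.comp ((ℝ ∙ g)ᗮ.subtype.toAffineMap +
    AffineMap.const ℝ _ p)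
  have hf : ∀ y, f y = A (p + (y : Vec d)) := fun y => by simp [f, add_comm]
  have : (fun y : (ℝ ∙ g)ᗮ => p + (y : Vec d)) ⁻¹' {z | A z = c}
      = ((AffineSubspace.mk' c (⊥ : Submodule ℝ ℝ)).comap f : Set (ℝ ∙ g)ᗮ) := by
    ext z
    simp [hf, AffineSubspace.mem_mk', sub_eq_zero]
  rw [this]
  -- The level set is an affine subspace of the hyperplane; it is proper because `A` takes different
  -- values at `x` and `y`.
  refine Measure.addHaar_affineSubspace _ _ fun htop => hxy ?_
  have key : ∀ z ∈ hyperplane g p, A z = c := by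
    intro z hz
    rw [← range_add_orthogonal] at hz
    obtain ⟨w, rfl⟩ := hz
    have : w ∈ (AffineSubspace.mk' c (⊥ : Submodule ℝ ℝ)).comap f := by rw [htop]; trivial
    simpa [hf, AffineSubspace.mem_mk', sub_eq_zero] using this
  rw [key x hx, key y hy]

lemma surf_translate (s : Set (Vec d)) (a : Vec d) : surf d ((fun x => x + a) ⁻¹' s) = surf d s := by
  have : (surf d).IsAddRightInvariant := by unfold surf; infer_instance
  exact measure_preimage_add_right _ a s

/-- Lebesgue measure as the product of the surface measure of a hyperplane and the length in a
transversal direction. -/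
lemma measurePreserving_hyperplane_prod (hg : g ≠ 0) {v : Vec d}
    (hv : inner ℝ g v = 1) :
    MeasurePreserving (fun q : Vec d × ℝ => q.1 + q.2 • v)
      (((surf d).restrict (hyperplane g p)).prod (ENNReal.ofReal ‖g‖⁻¹ • volume)) volume := by
  have := sigmaFinite_surf_hyperplane p hg
  have hgn : 0 < ‖g‖ := norm_pos_iff.2 hg
  refine ⟨by fun_prop, ?_⟩
  ext t ht
  have hm : Measurable (fun q : Vec d × ℝ => q.1 + q.2 • v) := by fun_prop
  rw [Measure.map_apply hm ht, Measure.prod_apply_symm (hm ht)]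
  have hvol := EuclideanGeometry.euclideanHausdorffMeasure_eq_lintegral p hg ht
  have hfr : Module.finrank ℝ (Vec d) = d := finrank_euclideanSpace_fin
  rw [InnerProductSpace.euclideanHausdorffMeasure_eq_volume, hfr] at hvol
  rw [hvol]
  set F : ℝ → ENNReal := fun r => (surf d).restrict (hyperplane g p)
    ((fun x => (x, r)) ⁻¹' ((fun q : Vec d × ℝ => q.1 + q.2 • v) ⁻¹' t)) with hF
  have hFm : Measurable F := measurable_measure_prodMk_right (hm ht)
  -- Since `⟨g, v⟩ = 1`, the slice through `p + r • g` is the base hyperplane translated by `(‖g‖ ^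
  -- 2 * r) • v`, and the surface measure is translation invariant. The substitution `r ↦ ‖g‖ ^ 2 *
  -- r` later contributes `‖g‖ ^ 2`, which turns `‖g‖⁻¹` into the factor `‖g‖` of orthogonal
  -- slicing.
  have hcross : ∀ r : ℝ, Measure.euclideanHausdorffMeasure (d - 1)
      (t ∩ (AffineSubspace.mk' (r • g +ᵥ p) (ℝ ∙ g)ᗮ : Set (Vec d))) = F (‖g‖ ^ 2 * r) := by
    intro r
    change surf d _ = _
    rw [hF]
    dsimp only
    rw [Measure.restrict_apply' (isClosed_hyperplane p).measurableSet,
      ← surf_translate _ ((‖g‖ ^ 2 * r) • v)]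
    congr 1
    ext x
    have e1 : inner ℝ g g = ‖g‖ ^ 2 := real_inner_self_eq_norm_sq g
    simp only [mem_preimage, mem_inter_iff, SetLike.mem_coe, AffineSubspace.mem_mk', vsub_eq_sub,
      vadd_eq_add, Submodule.mem_orthogonal_singleton_iff_inner_right, hyperplane, mem_ofPred_eq,
      inner_sub_right, inner_add_right, inner_smul_right, e1, hv]
    constructor <;> rintro ⟨h1, h2⟩ <;> exact ⟨h1, by linarith⟩
  simp_rw [hcross]
  rw [lintegral_smul_measure]
  have hne : ‖g‖ ^ 2 ≠ 0 := by positivity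
  have hscale := Real.smul_map_volume_mul_left hne
  conv_lhs => rw [← hscale, lintegral_smul_measure,
    lintegral_map hFm (by fun_prop)]
  rw [← ofReal_norm, smul_eq_mul, smul_eq_mul, ← mul_assoc, ← ENNReal.ofReal_mul (by positivity)]
  congr 2
  rw [abs_of_pos (by positivity)]
  field_simp

end Hyperplane

/-! ### The divergence theorem on a simplex, by Fubini along its edges. -/

section Simplex

variable {d : ℕ} (b : AffineBasis (Fin (d + 1)) ℝ (Vec d))

/-- The gradient of a barycentric coordinate. -/
def cgrad (i : Fin (d + 1)) : Vec d :=
  (InnerProductSpace.toDual ℝ (Vec d)).symm (LinearMap.toContinuousLinearMap (b.coord i).linear)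

lemma inner_cgrad (i : Fin (d + 1)) (v : Vec d) :
    inner ℝ (cgrad b i) v = (b.coord i).linear v := by
  simp [cgrad]

lemma coord_add (i : Fin (d + 1)) (x v : Vec d) :
    b.coord i (x + v) = b.coord i x + inner ℝ (cgrad b i) v := by
  have := (b.coord i).map_vadd x v
  simp only [vadd_eq_add] at this
  rw [inner_cgrad, add_comm x v, this, add_comm]

lemma coord_sub (i : Fin (d + 1)) (x y : Vec d) :
    inner ℝ (cgrad b i) (x - y) = b.coord i x - b.coord i y := by
  have := coord_add b i y (x - y)
  rw [add_sub_cancel] at this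
  linarith

lemma continuous_coord (i : Fin (d + 1)) : Continuous (b.coord i) :=
  (b.coord i).continuous_of_finiteDimensional

lemma inner_cgrad_edge {i j : Fin (d + 1)} (hij : i ≠ j) :
    inner ℝ (cgrad b i) (b i - b j) = 1 := by
  rw [coord_sub, b.coord_apply_eq, b.coord_apply_ne hij, sub_zero]

lemma inner_cgrad_edge' {i j : Fin (d + 1)} (hij : i ≠ j) :
    inner ℝ (cgrad b j) (b i - b j) = -1 := by
  rw [coord_sub, b.coord_apply_eq, b.coord_apply_ne hij.symm, zero_sub]

lemma inner_cgrad_edge_of_ne {i j k : Fin (d + 1)} (hi : k ≠ i) (hj : k ≠ j) :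
    inner ℝ (cgrad b k) (b i - b j) = 0 := by
  rw [coord_sub, b.coord_apply_ne hi, b.coord_apply_ne hj, sub_zero]

lemma cgrad_ne_zero (hd : 1 ≤ d) (i : Fin (d + 1)) : cgrad b i ≠ 0 := by
  have : Nontrivial (Fin (d + 1)) := Fin.nontrivial_iff_two_le.2 (by omega)
  obtain ⟨j, hj⟩ := exists_ne i
  intro h
  have := inner_cgrad_edge b hj.symm
  rw [h, inner_zero_left] at this
  exact zero_ne_one this

/-- The closed simplex with the vertices `b`. -/
def cell : Set (Vec d) := convexHull ℝ (range b)

/-- The facet opposite to the vertex `b i`. -/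
def face (i : Fin (d + 1)) : Set (Vec d) := {x ∈ cell b | b.coord i x = 0}

lemma mem_cell {x : Vec d} : x ∈ cell b ↔ ∀ i, 0 ≤ b.coord i x := by
  rw [cell, b.convexHull_eq_nonneg_coord]; rfl

lemma isCompact_cell : IsCompact (cell b) := (finite_range b).isCompact_convexHull ℝ

lemma convex_cell : Convex ℝ (cell b) := convex_convexHull ℝ _

lemma interior_cell : interior (cell b) = {x | ∀ i, 0 < b.coord i x} := b.interior_convexHull

lemma mem_frontier_cell {x : Vec d} : x ∈ frontier (cell b) ↔ ∃ i, x ∈ face b i := by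
  rw [frontier, (isCompact_cell b).isClosed.closure_eq, interior_cell, Set.mem_sdiff, mem_cell]
  simp only [mem_ofPred_eq, not_forall, not_lt, face, mem_cell]
  constructor
  · rintro ⟨h, i, hi⟩; exact ⟨i, h, le_antisymm hi (h i)⟩
  · rintro ⟨i, h, hi⟩; exact ⟨h, i, hi.le⟩

lemma frontier_cell : frontier (cell b) = ⋃ i, face b i := by
  ext x; rw [mem_frontier_cell, mem_iUnion]

lemma isCompact_face (i : Fin (d + 1)) : IsCompact (face b i) :=
  (isCompact_cell b).inter_right (isClosed_eq (continuous_coord b i) continuous_const)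

lemma mem_hyperplane_iff_coord {i j : Fin (d + 1)} (hij : i ≠ j) {x : Vec d} :
    x ∈ hyperplane (cgrad b i) (b j) ↔ b.coord i x = 0 := by
  rw [hyperplane, mem_ofPred_eq, coord_sub, b.coord_apply_ne hij, sub_zero]

lemma face_eq {i j : Fin (d + 1)} (hij : i ≠ j) :
    face b i = cell b ∩ hyperplane (cgrad b i) (b j) := by
  ext x
  rw [mem_inter_iff, mem_hyperplane_iff_coord b hij]; rfl

lemma surf_restrict_face {i j : Fin (d + 1)} (hij : i ≠ j) :
    (surf d).restrict (face b i)
      = ((surf d).restrict (hyperplane (cgrad b i) (b j))).restrict (cell b) := by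
  rw [Measure.restrict_restrict (isCompact_cell b).measurableSet, ← face_eq b hij]

lemma surf_face_lt_top (hd : 1 ≤ d) (i : Fin (d + 1)) : surf d (face b i) < ⊤ := by
  have : Nontrivial (Fin (d + 1)) := Fin.nontrivial_iff_two_le.2 (by omega)
  obtain ⟨j, hj⟩ := exists_ne i
  rw [face_eq b hj.symm]
  exact surf_hyperplane_inter_lt_top _ (cgrad_ne_zero b hd i) (isCompact_cell b).isBounded

lemma surf_frontier_cell_lt_top (hd : 1 ≤ d) : surf d (frontier (cell b)) < ⊤ := by
  rw [frontier_cell]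
  exact (measure_iUnion_le _).trans_lt (by
    rw [tsum_fintype]
    exact ENNReal.sum_lt_top.2 fun i _ => surf_face_lt_top b hd i)

lemma surf_face_inter_face (hd : 1 ≤ d) {i j : Fin (d + 1)} (hij : i ≠ j) :
    surf d (face b i ∩ face b j) = 0 := by
  by_cases h : ∃ k, k ≠ i ∧ k ≠ j
  · obtain ⟨k, hki, hkj⟩ := h
    refine measure_mono_null ?_ (surf_hyperplane_inter_eq_zero (b k) (cgrad_ne_zero b hd i)
      (A := b.coord j) (x := b k) (y := b j) ?_ ?_ ?_ 0)
    · rintro x ⟨hi, hj⟩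
      exact ⟨(mem_hyperplane_iff_coord b hki.symm).2 hi.2, hj.2⟩
    · exact (mem_hyperplane_iff_coord b hki.symm).2 (b.coord_apply_ne hki.symm)
    · exact (mem_hyperplane_iff_coord b hki.symm).2 (b.coord_apply_ne hij)
    · rw [b.coord_apply_eq, b.coord_apply_ne hkj.symm]; exact zero_ne_one
  · push Not at h
    have : face b i ∩ face b j = ∅ := by
      refine eq_empty_of_forall_notMem ?_
      rintro x ⟨hi, hj⟩
      have hs := b.sum_coord_apply_eq_one x
      rw [Finset.sum_eq_zero fun k _ => ?_] at hs
      · exact zero_ne_one hs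
      · by_cases hk : k = i
        · rw [hk]; exact hi.2
        · rw [h k hk]; exact hj.2
    rw [this, measure_empty]

/-- The translation along an edge maps a facet to the adjacent one, and the surface measures
correspond up to the heights. -/
lemma map_face (hd : 1 ≤ d) {i j : Fin (d + 1)} (hij : i ≠ j) :
    ENNReal.ofReal ‖cgrad b i‖⁻¹ •
        ((surf d).restrict (face b i)).map (fun x => x + b.coord j x • (b i - b j))
      = ENNReal.ofReal ‖cgrad b j‖⁻¹ • (surf d).restrict (face b j) := by
  set v := b i - b j with hv
  have hπ : Measurable fun x : Vec d => x + b.coord j x • v := by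
    have := continuous_coord b j; fun_prop
  ext t ht
  -- `x + b.coord j x • v` is the projection along `v` onto the hyperplane of facet `j`. Thus `A` is
  -- a prism over `t ∩ face b j` whose fibres in direction `v` have parameter length 1. Slicing over
  -- either hyperplane computes its volume, and comparing the two results gives the claim.
  set A : Set (Vec d) := {x | b.coord i x ∈ Icc (0 : ℝ) 1 ∧ x + b.coord j x • v ∈ t ∩ cell b}
    with hA
  have hAm : MeasurableSet A :=
    ((continuous_coord b i).measurable measurableSet_Icc).inter
      (hπ (ht.inter (isCompact_cell b).measurableSet))
  have e1 : inner ℝ (cgrad b i) v = 1 := inner_cgrad_edge b hij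
  have e2 : inner ℝ (cgrad b j) v = -1 := inner_cgrad_edge' b hij
  have hi := measurePreserving_hyperplane_prod (b j) (cgrad_ne_zero b hd i)
    (inner_cgrad_edge b hij)
  have hj := measurePreserving_hyperplane_prod (b i) (cgrad_ne_zero b hd j)
    (inner_cgrad_edge b hij.symm)
  have vi : volume A = ENNReal.ofReal ‖cgrad b i‖⁻¹ *
      surf d ((fun x => x + b.coord j x • v) ⁻¹' t ∩ face b i) := by
    have := sigmaFinite_surf_hyperplane (b j) (cgrad_ne_zero b hd i)
    rw [← hi.map_eq, Measure.map_apply hi.measurable hAm, Measure.prod_apply (hi.measurable hAm)]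
    have : ∀ y ∈ hyperplane (cgrad b i) (b j),
        (ENNReal.ofReal ‖cgrad b i‖⁻¹ • volume)
          (Prod.mk y ⁻¹' ((fun q : Vec d × ℝ => q.1 + q.2 • (b i - b j)) ⁻¹' A))
        = ((fun x => x + b.coord j x • v) ⁻¹' t ∩ cell b).indicator
            (fun _ => ENNReal.ofReal ‖cgrad b i‖⁻¹) y := by
      intro y hy
      rw [mem_hyperplane_iff_coord b hij] at hy
      have hs : (Prod.mk y ⁻¹' ((fun q : Vec d × ℝ => q.1 + q.2 • (b i - b j)) ⁻¹' A))
          = {r | r ∈ Icc (0 : ℝ) 1 ∧ y + b.coord j y • v ∈ t ∩ cell b} := by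
        ext r
        simp only [hA, mem_preimage, mem_ofPred_eq, coord_add, inner_smul_right, ← hv, e1, e2, hy]
        have : y + r • v + (b.coord j y + r * -1) • v = y + b.coord j y • v := by module
        rw [this]; simp
      have hc : y + b.coord j y • v ∈ cell b ↔ y ∈ cell b := by
        simp only [mem_cell, coord_add, inner_smul_right]
        constructor
        · intro h k
          by_cases hki : k = i
          · rw [hki, hy]
          by_cases hkj : k = j
          · have := h i
            rw [e1, hy] at this
            rw [hkj]; linarith
          · simpa [hv, inner_cgrad_edge_of_ne b hki hkj] using h k
        · intro h k
          by_cases hki : k = i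
          · rw [hki, hy, e1]; linarith [h j]
          by_cases hkj : k = j
          · rw [hkj, e2]; linarith
          · simpa [hv, inner_cgrad_edge_of_ne b hki hkj] using h k
      rw [hs, Measure.smul_apply]
      by_cases hy' : y ∈ (fun x => x + b.coord j x • v) ⁻¹' t ∩ cell b
      · rw [indicator_of_mem hy']
        have : {r : ℝ | r ∈ Icc (0 : ℝ) 1 ∧ y + b.coord j y • v ∈ t ∩ cell b} = Icc 0 1 := by
          ext r; exact and_iff_left ⟨hy'.1, hc.2 hy'.2⟩
        rw [this]
        simp
      · rw [indicator_of_notMem hy']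
        have : ¬ y + b.coord j y • v ∈ t ∩ cell b := fun h => hy' ⟨h.1, hc.1 h.2⟩
        simp [this]
    rw [setLIntegral_congr_fun (isClosed_hyperplane _).measurableSet this,
      lintegral_indicator ((hπ ht).inter (isCompact_cell b).measurableSet), setLIntegral_const,
      Measure.restrict_apply ((hπ ht).inter (isCompact_cell b).measurableSet), face_eq b hij,
      inter_assoc]
  have vj : volume A = ENNReal.ofReal ‖cgrad b j‖⁻¹ * surf d (t ∩ face b j) := by
    have := sigmaFinite_surf_hyperplane (b i) (cgrad_ne_zero b hd j)
    rw [← hj.map_eq, Measure.map_apply hj.measurable hAm, Measure.prod_apply (hj.measurable hAm)]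
    have : ∀ y ∈ hyperplane (cgrad b j) (b i),
        (ENNReal.ofReal ‖cgrad b j‖⁻¹ • volume)
          (Prod.mk y ⁻¹' ((fun q : Vec d × ℝ => q.1 + q.2 • (b j - b i)) ⁻¹' A))
        = (t ∩ cell b).indicator (fun _ => ENNReal.ofReal ‖cgrad b j‖⁻¹) y := by
      intro y hy
      rw [mem_hyperplane_iff_coord b hij.symm] at hy
      have hs : (Prod.mk y ⁻¹' ((fun q : Vec d × ℝ => q.1 + q.2 • (b j - b i)) ⁻¹' A))
          = {r | r ∈ Icc (b.coord i y - 1) (b.coord i y) ∧ y ∈ t ∩ cell b} := by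
        ext r
        have hv' : b j - b i = -v := by rw [hv]; abel
        simp only [hA, mem_preimage, mem_ofPred_eq, coord_add, inner_smul_right, hv',
          inner_neg_right, e1, e2, hy]
        have : y + r • -v + (0 + r * - -1) • v = y := by module
        rw [this]
        refine and_congr_left fun _ => ?_
        simp only [mem_Icc]
        constructor <;> rintro ⟨h1, h2⟩ <;> constructor <;> linarith
      rw [hs, Measure.smul_apply]
      by_cases hy' : y ∈ t ∩ cell b
      · rw [indicator_of_mem hy']
        have : {r : ℝ | r ∈ Icc (b.coord i y - 1) (b.coord i y) ∧ y ∈ t ∩ cell b}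
            = Icc (b.coord i y - 1) (b.coord i y) := by
          ext r; exact and_iff_left hy'
        rw [this]
        simp
      · rw [indicator_of_notMem hy']
        simp [hy']
    rw [setLIntegral_congr_fun (isClosed_hyperplane _).measurableSet this,
      lintegral_indicator (ht.inter (isCompact_cell b).measurableSet), setLIntegral_const,
      Measure.restrict_apply (ht.inter (isCompact_cell b).measurableSet), face_eq b hij.symm,
      inter_assoc]
  rw [Measure.smul_apply, Measure.smul_apply, Measure.map_apply hπ ht, Measure.restrict_apply
    (hπ ht), Measure.restrict_apply ht, smul_eq_mul, smul_eq_mul, ← vi, ← vj]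

/-- The fundamental theorem of calculus along an edge direction. -/
lemma integral_fderiv_edge_aux (hd : 1 ≤ d) {i j : Fin (d + 1)} (hij : i ≠ j) {ψ : Vec d → ℝ}
    (hψ : ContDiff ℝ 1 ψ) :
    ∫ x in cell b, fderiv ℝ ψ x (b i - b j) = ‖cgrad b i‖⁻¹ *
      ∫ y in face b i, (ψ (y + b.coord j y • (b i - b j)) - ψ y) ∂surf d := by
  set v := b i - b j with hv
  have e1 : inner ℝ (cgrad b i) v = 1 := inner_cgrad_edge b hij
  have e2 : inner ℝ (cgrad b j) v = -1 := inner_cgrad_edge' b hij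
  have := sigmaFinite_surf_hyperplane (b j) (cgrad_ne_zero b hd i)
  have hi := measurePreserving_hyperplane_prod (b j) (cgrad_ne_zero b hd i)
    (inner_cgrad_edge b hij)
  have hcont : Continuous fun x => fderiv ℝ ψ x v := (hψ.continuous_fderiv one_ne_zero).clm_apply
    continuous_const
  set G : Vec d → ℝ := (cell b).indicator fun x => fderiv ℝ ψ x v with hG
  have hGi : Integrable G volume := by
    rw [hG, integrable_indicator_iff (isCompact_cell b).measurableSet]
    exact hcont.continuousOn.integrableOn_compact (isCompact_cell b)
  have hGm := hGi.aestronglyMeasurable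
  rw [← integral_indicator (isCompact_cell b).measurableSet]
  change ∫ x, G x = _
  rw [← hi.map_eq, integral_map hi.measurable.aemeasurable (hi.map_eq ▸ hGm),
    integral_prod (fun q : Vec d × ℝ => G (q.1 + q.2 • (b i - b j)))
      (hi.integrable_comp_of_integrable hGi)]
  have hinner : ∀ y ∈ hyperplane (cgrad b i) (b j),
      ∫ r : ℝ, G (y + r • (b i - b j)) ∂(ENNReal.ofReal ‖cgrad b i‖⁻¹ • volume)
      = (cell b).indicator (fun y => ‖cgrad b i‖⁻¹ * (ψ (y + b.coord j y • v) - ψ y)) y := by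
    intro y hy
    rw [mem_hyperplane_iff_coord b hij] at hy
    rw [integral_smul_measure, ENNReal.toReal_ofReal (by positivity), smul_eq_mul]
    -- Along `v` only the coordinates `i` and `j` change, with slopes `1` and `-1`. A line starting
    -- on facet `i` therefore leaves the simplex through facet `j`, at parameter `b.coord j y`.
    have hmem : ∀ r, y + r • v ∈ cell b ↔ y ∈ cell b ∧ r ∈ Icc 0 (b.coord j y) := by
      intro r
      simp only [mem_cell, coord_add, inner_smul_right, mem_Icc]
      constructor
      · intro h
        have hr := h i
        rw [e1, hy] at hr
        have hrj := h j
        rw [e2] at hrj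
        refine ⟨fun k => ?_, by linarith, by linarith⟩
        by_cases hki : k = i
        · rw [hki, hy]
        by_cases hkj : k = j
        · rw [hkj]; linarith
        · simpa [hv, inner_cgrad_edge_of_ne b hki hkj] using h k
      · rintro ⟨h, hr0, hr1⟩ k
        by_cases hki : k = i
        · rw [hki, hy, e1]; linarith
        by_cases hkj : k = j
        · rw [hkj, e2]; linarith
        · simpa [hv, inner_cgrad_edge_of_ne b hki hkj] using h k
    by_cases hyc : y ∈ cell b
    · rw [indicator_of_mem hyc]
      congr 1
      have h0 : 0 ≤ b.coord j y := (mem_cell b).1 hyc j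
      have : (fun r : ℝ => G (y + r • (b i - b j))) = (Icc 0 (b.coord j y)).indicator
          fun r => fderiv ℝ ψ (y + r • v) v := by
        ext r
        by_cases hr : r ∈ Icc 0 (b.coord j y)
        · rw [indicator_of_mem hr, hG, indicator_of_mem ((hmem r).2 ⟨hyc, hr⟩)]
        · rw [indicator_of_notMem hr, hG, indicator_of_notMem fun h => hr ((hmem r).1 h).2]
      rw [this, integral_indicator measurableSet_Icc, integral_Icc_eq_integral_Ioc,
        ← intervalIntegral.integral_of_le h0]
      have hder : ∀ r : ℝ, HasDerivAt (fun r => ψ (y + r • v)) (fderiv ℝ ψ (y + r • v) v) r := by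
        intro r
        have h1 : HasDerivAt (fun r : ℝ => y + r • v) v r := by
          simpa using ((hasDerivAt_id r).smul_const v).const_add y
        exact ((hψ.differentiable one_ne_zero).differentiableAt.hasFDerivAt).comp_hasDerivAt r h1
      rw [intervalIntegral.integral_eq_sub_of_hasDerivAt (fun r _ => hder r)]
      · simp
      · exact (hcont.comp (by fun_prop : Continuous fun r : ℝ => y + r • v)).intervalIntegrable _ _
    · rw [indicator_of_notMem hyc]
      have : (fun r : ℝ => G (y + r • (b i - b j))) = fun _ => 0 := by
        ext r
        rw [hG, indicator_of_notMem fun h => hyc ((hmem r).1 h).1]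
      rw [this, integral_zero, mul_zero]
  rw [setIntegral_congr_fun (isClosed_hyperplane _).measurableSet hinner,
    integral_indicator (isCompact_cell b).measurableSet, ← surf_restrict_face b hij,
    integral_const_mul]

lemma integrableOn_face (hd : 1 ≤ d) {E : Type*} [NormedAddCommGroup E] (i : Fin (d + 1))
    {ψ : Vec d → E} (hψ : Continuous ψ) : IntegrableOn ψ (face b i) (surf d) := by
  obtain ⟨C, hC⟩ := (isCompact_face b i).exists_bound_of_continuousOn hψ.continuousOn
  exact Measure.integrableOn_of_bounded (surf_face_lt_top b hd i).ne hψ.aestronglyMeasurable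
    ((ae_restrict_iff' (isCompact_face b i).measurableSet).2 (Eventually.of_forall hC))

/-- `map_face` moves the values at the exit points of the segments onto facet `j`, so that each
facet enters with its own height factor. -/
lemma integral_fderiv_edge (hd : 1 ≤ d) {i j : Fin (d + 1)} (hij : i ≠ j) {ψ : Vec d → ℝ}
    (hψ : ContDiff ℝ 1 ψ) :
    ∫ x in cell b, fderiv ℝ ψ x (b i - b j) =
      ‖cgrad b j‖⁻¹ * ∫ y in face b j, ψ y ∂surf d
        - ‖cgrad b i‖⁻¹ * ∫ y in face b i, ψ y ∂surf d := by
  have hπ : Continuous fun x : Vec d => x + b.coord j x • (b i - b j) := by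
    have := continuous_coord b j; fun_prop
  have h1 : IntegrableOn (fun x => ψ (x + b.coord j x • (b i - b j))) (face b i) (surf d) :=
    integrableOn_face b hd i (hψ.continuous.comp hπ)
  rw [integral_fderiv_edge_aux b hd hij hψ, integral_sub h1 (integrableOn_face b hd i hψ.continuous),
    mul_sub]
  congr 1
  have h := congrArg (fun μ => ∫ x, ψ x ∂μ) (map_face b hd hij)
  rwa [integral_smul_measure, integral_smul_measure, ENNReal.toReal_ofReal (by positivity),
    ENNReal.toReal_ofReal (by positivity), integral_map hπ.aemeasurable
    hψ.continuous.aestronglyMeasurable] at h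

/-- The outward unit normal of the facet opposite to `b i`. -/
def fnormal (i : Fin (d + 1)) : Vec d := -(‖cgrad b i‖⁻¹ • cgrad b i)

lemma norm_fnormal (hd : 1 ≤ d) (i : Fin (d + 1)) : ‖fnormal b i‖ = 1 := by
  rw [fnormal, norm_neg, norm_smul, norm_inv, norm_norm,
    inv_mul_cancel₀ (norm_ne_zero_iff.2 (cgrad_ne_zero b hd i))]

/-- The divergence theorem on a simplex. -/
lemma integral_fderiv_cell (hd : 1 ≤ d) {ψ : Vec d → ℝ} (hψ : ContDiff ℝ 1 ψ) (w : Vec d) :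
    ∫ x in cell b, fderiv ℝ ψ x w = ∑ k, ∫ y in face b k, inner ℝ (fnormal b k) w * ψ y ∂surf d := by
  have hint : ∀ u : Vec d, IntegrableOn (fun x => fderiv ℝ ψ x u) (cell b) := fun u =>
    ((hψ.continuous_fderiv one_ne_zero).clm_apply
      continuous_const).continuousOn.integrableOn_compact (isCompact_cell b)
  let P : Vec d →ₗ[ℝ] ℝ :=
    { toFun := fun u => ∫ x in cell b, fderiv ℝ ψ x u
      map_add' := fun u v => by
        simp only [map_add]
        exact integral_add (hint u) (hint v)
      map_smul' := fun c u => by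
        simp only [map_smul, RingHom.id_apply, smul_eq_mul]
        exact integral_const_mul _ _ }
  let Q : Vec d →ₗ[ℝ] ℝ :=
    ∑ k, (∫ y in face b k, ψ y ∂surf d) • (innerSL ℝ (fnormal b k) : Vec d →ₗ[ℝ] ℝ)
  have hQ : ∀ u, Q u = ∑ k, ∫ y in face b k, inner ℝ (fnormal b k) u * ψ y ∂surf d := by
    intro u
    simp only [Q, LinearMap.sum_apply, LinearMap.smul_apply, smul_eq_mul]
    refine Finset.sum_congr rfl fun k _ => ?_
    rw [integral_const_mul, mul_comm]
    rfl
  rw [← hQ]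
  change P w = Q w
  -- Both sides are linear in `w`, so the edges issuing from `b 0`, which form a basis, suffice.
  -- Along such an edge all but two of the facet normals are orthogonal to `w`.
  have : P = Q := by
    refine (b.basisOf 0).ext ?_
    rintro ⟨i, hi⟩
    rw [AffineBasis.basisOf_apply, vsub_eq_sub]
    change ∫ x in cell b, fderiv ℝ ψ x (b i - b 0) = _
    rw [integral_fderiv_edge b hd hi hψ, hQ, Fintype.sum_eq_add i 0 hi]
    · simp only [integral_const_mul, fnormal, inner_neg_left, real_inner_smul_left,
        inner_cgrad_edge b hi, inner_cgrad_edge' b hi]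
      ring
    · rintro k ⟨hki, hk0⟩
      simp [fnormal, real_inner_smul_left, inner_cgrad_edge_of_ne b hki hk0]
  rw [this]

end Simplex

/-! ### The trace inequality on a facet. -/

section TraceInequality

variable {d : ℕ} (b : AffineBasis (Fin (d + 1)) ℝ (Vec d))

lemma coord_le_one {x : Vec d} (hx : x ∈ cell b) (i : Fin (d + 1)) : b.coord i x ≤ 1 := by
  rw [← b.sum_coord_apply_eq_one x]
  exact Finset.single_le_sum (f := fun i => b.coord i x) (fun k _ => (mem_cell b).1 hx k)
    (Finset.mem_univ i)

lemma hasFDerivAt_coord (i : Fin (d + 1)) (x : Vec d) :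
    HasFDerivAt (b.coord i) (innerSL ℝ (cgrad b i)) x := by
  have : (b.coord i : Vec d → ℝ) = fun y => innerSL ℝ (cgrad b i) y + b.coord i 0 := by
    ext y
    have := coord_sub b i y 0
    rw [sub_zero] at this
    rw [innerSL_apply_apply, this, sub_add_cancel]
  rw [this]
  exact (innerSL ℝ (cgrad b i)).hasFDerivAt.add_const _

lemma contDiff_coord (i : Fin (d + 1)) {n : WithTop ℕ∞} : ContDiff ℝ n (b.coord i) := by
  have : (b.coord i : Vec d → ℝ) = fun y => innerSL ℝ (cgrad b i) y + b.coord i 0 := by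
    ext y
    have := coord_sub b i y 0
    rw [sub_zero] at this
    rw [innerSL_apply_apply, this, sub_add_cancel]
  rw [this]
  exact (innerSL ℝ (cgrad b i)).contDiff.add contDiff_const

/-- The trace inequality on a facet of a simplex. -/
lemma exists_integral_face_le (hd : 1 ≤ d) (i : Fin (d + 1)) :
    ∃ C : ℝ, 0 ≤ C ∧ ∀ φ : Vec d → Vec d, ContDiff ℝ 1 φ →
      ∫ x in face b i, ‖φ x‖ ^ 2 ∂surf d
        ≤ C * ∫ x in cell b, (‖φ x‖ ^ 2 + ‖fderiv ℝ φ x‖ ^ 2) := by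
  have hg : 0 < ‖cgrad b i‖ := norm_pos_iff.2 (cgrad_ne_zero b hd i)
  refine ⟨‖cgrad b i‖ * ∑ j, (1 + ‖b i - b j‖), mul_nonneg hg.le
    (Finset.sum_nonneg fun j _ => add_nonneg zero_le_one (norm_nonneg _)), fun φ hφ => ?_⟩
  have hφ2 : ContDiff ℝ 1 fun x => ‖φ x‖ ^ 2 :=
    (contDiff_norm_sq ℝ (E := Vec d) (n := 1)).comp hφ
  have hψ : ∀ j, ContDiff ℝ 1 fun x => ‖φ x‖ ^ 2 * b.coord j x := fun j =>
    hφ2.mul (contDiff_coord b j)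
  -- The edge formula is applied to `‖φ‖ ^ 2` times the coordinate `j`: the product vanishes on
  -- facet `j`, so only facet `i` is left. Summing over `j ≠ i` recovers `‖φ‖ ^ 2`, because the
  -- remaining coordinates add up to 1 on facet `i`.
  have hbound : ∀ j, i ≠ j → ‖cgrad b i‖⁻¹ * ∫ x in face b i, ‖φ x‖ ^ 2 * b.coord j x ∂surf d ≤
      (1 + ‖b i - b j‖) * ∫ x in cell b, (‖φ x‖ ^ 2 + ‖fderiv ℝ φ x‖ ^ 2) := by
    intro j hij
    have h := integral_fderiv_edge b hd hij (hψ j)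
    have h0 : ∫ y in face b j, ‖φ y‖ ^ 2 * b.coord j y ∂surf d = 0 := by
      rw [setIntegral_congr_fun (isCompact_face b j).measurableSet
        (g := fun _ => (0 : ℝ)) fun y hy => by simp [hy.2]]
      simp
    rw [h0, mul_zero, zero_sub] at h
    rw [← neg_eq_iff_eq_neg] at h
    rw [← h, ← integral_neg, ← integral_const_mul]
    refine setIntegral_mono_on ?_ ?_ (isCompact_cell b).measurableSet fun x hx => ?_
    · exact (((hψ j).continuous_fderiv one_ne_zero).clm_apply
        continuous_const).neg.continuousOn.integrableOn_compact (isCompact_cell b)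
    · have := hφ.continuous_fderiv one_ne_zero
      have := hφ.continuous
      exact ContinuousOn.integrableOn_compact (isCompact_cell b) (by fun_prop)
    · have hd1 : HasFDerivAt φ (fderiv ℝ φ x) x :=
        ((hφ.differentiable one_ne_zero) x).hasFDerivAt
      have hd2 := (hd1.norm_sq.mul (hasFDerivAt_coord b j x)).fderiv
      have : (fun x => ‖φ x‖ ^ 2 * b.coord j x) = (fun x => ‖φ x‖ ^ 2) * b.coord j := rfl
      rw [this, hd2]
      simp only [_root_.add_apply, _root_.smul_apply, smul_eq_mul,
        ContinuousLinearMap.comp_apply, innerSL_apply_apply, inner_cgrad_edge' b hij]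
      have hc0 := (mem_cell b).1 hx j
      have hc1 := coord_le_one b hx j
      have h1 : |inner ℝ (φ x) (fderiv ℝ φ x (b i - b j))| ≤
          ‖φ x‖ * (‖fderiv ℝ φ x‖ * ‖b i - b j‖) :=
        (abs_real_inner_le_norm _ _).trans (mul_le_mul_of_nonneg_left
          ((fderiv ℝ φ x).le_opNorm _) (norm_nonneg _))
      set s := inner ℝ (φ x) (fderiv ℝ φ x (b i - b j))
      set p := ‖φ x‖
      set q := ‖fderiv ℝ φ x‖
      set v := ‖b i - b j‖
      have hp : 0 ≤ p := norm_nonneg _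
      have hq : 0 ≤ q := norm_nonneg _
      have hv : 0 ≤ v := norm_nonneg _
      have h2 : -(b.coord j x * s) ≤ |s| := by
        rw [← mul_neg]
        calc b.coord j x * -s ≤ b.coord j x * |s| :=
              mul_le_mul_of_nonneg_left (neg_le_abs s) hc0
          _ ≤ 1 * |s| := mul_le_mul_of_nonneg_right hc1 (abs_nonneg _)
          _ = |s| := one_mul _
      have h3 : 2 * (p * (q * v)) ≤ v * (p ^ 2 + q ^ 2) := by
        nlinarith [mul_nonneg hv (sq_nonneg (p - q))]
      simp only [nsmul_eq_mul, Nat.cast_ofNat]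
      nlinarith [sq_nonneg q]
  have hsum : ∫ x in face b i, ‖φ x‖ ^ 2 ∂surf d
      = ∑ j ∈ Finset.univ.erase i, ∫ x in face b i, ‖φ x‖ ^ 2 * b.coord j x ∂surf d := by
    rw [← integral_finsetSum _ fun j _ => integrableOn_face b hd i (hψ j).continuous]
    refine setIntegral_congr_fun (isCompact_face b i).measurableSet fun x hx => ?_
    rw [← Finset.mul_sum]
    have := b.sum_coord_apply_eq_one x
    rw [← Finset.add_sum_erase _ _ (Finset.mem_univ i), hx.2, zero_add] at this
    rw [this, mul_one]
  have hnn : 0 ≤ ∫ x in cell b, (‖φ x‖ ^ 2 + ‖fderiv ℝ φ x‖ ^ 2) :=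
    integral_nonneg fun x => by positivity
  rw [mul_assoc, ← inv_mul_le_iff₀ hg, hsum, Finset.mul_sum, Finset.sum_mul]
  calc _ ≤ ∑ j ∈ Finset.univ.erase i, (1 + ‖b i - b j‖) *
        ∫ x in cell b, (‖φ x‖ ^ 2 + ‖fderiv ℝ φ x‖ ^ 2) :=
        Finset.sum_le_sum fun j hj => hbound j (Finset.ne_of_mem_erase hj).symm
    _ ≤ _ := Finset.sum_le_sum_of_subset_of_nonneg (Finset.erase_subset _ _)
        fun j _ _ => mul_nonneg (add_nonneg zero_le_one (norm_nonneg _)) hnn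

/-- In terms of lower integrals the bound can be summed over facets and enlarged to the whole domain
without integrability conditions. -/
lemma exists_lintegral_face_le (hd : 1 ≤ d) (i : Fin (d + 1)) :
    ∃ C : NNReal, ∀ φ : Vec d → Vec d, ContDiff ℝ 1 φ →
      ∫⁻ x in face b i, ‖φ x‖ₑ ^ 2 ∂surf d
        ≤ C * ((∫⁻ x in cell b, ‖φ x‖ₑ ^ 2) + ∫⁻ x in cell b, ‖fderiv ℝ φ x‖ₑ ^ 2) := by
  obtain ⟨C, hC0, hC⟩ := exists_integral_face_le b hd i
  refine ⟨C.toNNReal, fun φ hφ => ?_⟩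
  have h := ENNReal.ofReal_le_ofReal (hC φ hφ)
  have c1 := hφ.continuous
  have c2 := hφ.continuous_fderiv one_ne_zero
  have e : ∀ {E : Type} [NormedAddCommGroup E] (y : E), ENNReal.ofReal (‖y‖ ^ 2) = ‖y‖ₑ ^ 2 := by
    intro E _ y
    rw [ENNReal.ofReal_pow (norm_nonneg _), ofReal_norm]
  have hint : IntegrableOn (fun x => ‖φ x‖ ^ 2 + ‖fderiv ℝ φ x‖ ^ 2) (cell b) :=
    ContinuousOn.integrableOn_compact (isCompact_cell b) (by fun_prop)
  rw [ENNReal.ofReal_mul hC0, ofReal_integral_eq_lintegral_ofReal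
    (integrableOn_face b hd i (by fun_prop)) (Eventually.of_forall fun x => by positivity),
    ofReal_integral_eq_lintegral_ofReal hint (Eventually.of_forall fun x => by positivity)] at h
  rw [← lintegral_add_left (by fun_prop)]
  convert h using 2
  · simp only [e]
  · rfl
  · refine lintegral_congr fun x => ?_
    rw [ENNReal.ofReal_add (by positivity) (by positivity), e, e]

end TraceInequality

/-! ### Sets that are locally half spaces, and their outward normals. -/

section HalfSpace

variable {d : ℕ}

/-- Near `x`, the set `K` is a half space with outward unit normal `n`. -/
def HalfSpaceAt (K : Set (Vec d)) (x n : Vec d) : Prop :=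
  ‖n‖ = 1 ∧ ∀ᶠ y in 𝓝 x, (y ∈ K ↔ inner ℝ n (y - x) ≤ 0)

variable {K L : Set (Vec d)} {x n m : Vec d}

/-- Testing with the component of `m` orthogonal to `n` gives `1 - ⟨m, n⟩ ^ 2 ≤ 0`, and testing with
`-n` excludes `⟨m, n⟩ = -1`. -/
lemma eq_of_halfSpace_le (hn : ‖n‖ = 1) (hm : ‖m‖ = 1)
    (h : ∀ u : Vec d, inner ℝ n u ≤ 0 → inner ℝ m u ≤ 0) : m = n := by
  have nn : inner ℝ n n = (1 : ℝ) := by rw [real_inner_self_eq_norm_sq, hn, one_pow]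
  have mm : inner ℝ m m = (1 : ℝ) := by rw [real_inner_self_eq_norm_sq, hm, one_pow]
  have h1 := h (m - (inner ℝ n m : ℝ) • n) (by
    rw [inner_sub_right, inner_smul_right, nn]; linarith)
  rw [inner_sub_right, inner_smul_right, mm, real_inner_comm] at h1
  have h2 := h (-n) (by rw [inner_neg_right, nn]; norm_num)
  rw [inner_neg_right] at h2
  have h3 : inner ℝ m n ≤ (1 : ℝ) := by
    simpa [hn, hm] using real_inner_le_norm m n
  have h4 : (1 : ℝ) ≤ inner ℝ m n := by
    by_contra hlt
    push Not at hlt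
    nlinarith
  exact (inner_eq_one_iff_of_norm_eq_one hm hn).1 (le_antisymm h3 h4)

lemma tendsto_add_smul (x u : Vec d) : Tendsto (fun ε : ℝ => x + ε • u) (𝓝[>] 0) (𝓝 x) := by
  have : Continuous fun ε : ℝ => x + ε • u := by fun_prop
  have h := this.tendsto 0
  simp only [zero_smul, add_zero] at h
  exact h.mono_left nhdsWithin_le_nhds

namespace HalfSpaceAt

lemma mem (h : HalfSpaceAt K x n) : x ∈ K := h.2.self_of_nhds.2 (by simp)

lemma eventually_ray (h : HalfSpaceAt K x n) (u : Vec d) :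
    ∀ᶠ ε : ℝ in 𝓝[>] 0, (x + ε • u ∈ K ↔ inner ℝ n u ≤ 0) := by
  filter_upwards [(tendsto_add_smul x u).eventually h.2, self_mem_nhdsWithin] with ε hε hpos
  rw [hε, add_sub_cancel_left, inner_smul_right]
  exact ⟨fun h => nonpos_of_mul_nonpos_right h hpos, fun h => mul_nonpos_of_nonneg_of_nonpos
    (le_of_lt hpos) h⟩

lemma eventually_interior (h : HalfSpaceAt K x n) {u : Vec d} (hu : inner ℝ n u < 0) :
    ∀ᶠ ε : ℝ in 𝓝[>] 0, x + ε • u ∈ interior K := by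
  filter_upwards [(tendsto_add_smul x u).eventually h.2.eventually_nhds, self_mem_nhdsWithin]
    with ε hε hpos
  rw [mem_interior_iff_mem_nhds]
  have h1 : ∀ᶠ y in 𝓝 (x + ε • u), inner ℝ n (y - x) < 0 := by
    refine (isOpen_lt (by fun_prop : Continuous fun y : Vec d => inner ℝ n (y - x))
      continuous_const).mem_nhds ?_
    rw [mem_ofPred_eq, add_sub_cancel_left, inner_smul_right]
    exact mul_neg_of_pos_of_neg hpos hu
  filter_upwards [hε, h1] with y hy1 hy2
  exact hy1.2 hy2.le

/-- Convexity globalizes the local inequality, since a short piece of the segment from `x` to any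
point of `K` stays in `K`. Conversely every outward normal is nonpositive on the half space of `n`
and so equals `n`. -/
lemma outwardNormal_eq (h : HalfSpaceAt K x n) (hK : Convex ℝ K) : outwardNormal K x = n := by
  have h1 : IsOutwardNormal K x n := by
    refine ⟨h.1, fun y hy => ?_⟩
    have hev := h.eventually_ray (y - x)
    have h01 : ∀ᶠ ε : ℝ in 𝓝[>] 0, ε ∈ Ioo (0 : ℝ) 1 := Ioo_mem_nhdsGT one_pos
    obtain ⟨ε, hε, hε0, hε1⟩ := (hev.and h01).exists
    refine hε.1 ?_
    exact hK.add_smul_sub_mem h.mem hy ⟨hε0.le, hε1.le⟩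
  have h2 : ∀ ν, IsOutwardNormal K x ν → ν = n := by
    rintro ν ⟨hν, hν'⟩
    refine eq_of_halfSpace_le h.1 hν fun u hu => ?_
    obtain ⟨ε, hε, hpos⟩ := ((h.eventually_ray u).and self_mem_nhdsWithin).exists
    have := hν' _ (hε.2 hu)
    rw [add_sub_cancel_left, inner_smul_right] at this
    exact nonpos_of_mul_nonpos_right this hpos
  have hex : ∃! ν, IsOutwardNormal K x ν := ⟨n, h1, h2⟩
  rw [outwardNormal, dif_pos hex]
  exact h2 _ hex.choose_spec.1

lemma unique (h : HalfSpaceAt K x n) (h' : HalfSpaceAt K x m) : m = n := by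
  refine eq_of_halfSpace_le h.1 h'.1 fun u hu => ?_
  obtain ⟨ε, hε, hε'⟩ := ((h.eventually_ray u).and (h'.eventually_ray u)).exists
  exact hε'.1 (hε.2 hu)

lemma notMem_interior (h : HalfSpaceAt K x n) : x ∉ interior K := by
  intro hx
  obtain ⟨ε, hε, hK⟩ := ((h.eventually_ray n).and ((tendsto_add_smul x n).eventually
    (mem_interior_iff_mem_nhds.1 hx))).exists
  have := hε.1 hK
  rw [real_inner_self_eq_norm_sq, h.1] at this
  norm_num at this

lemma mem_frontier (h : HalfSpaceAt K x n) : x ∈ frontier K :=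
  ⟨subset_closure h.mem, h.notMem_interior⟩

lemma congr (h : HalfSpaceAt K x n) (hKL : ∀ᶠ y in 𝓝 x, (y ∈ K ↔ y ∈ L)) : HalfSpaceAt L x n :=
  ⟨h.1, by filter_upwards [h.2, hKL] with y h1 h2; rw [← h2, h1]⟩

end HalfSpaceAt

/-- Near a relative interior point of a facet the other barycentric inequalities stay strict, so a
single constraint describes the simplex. -/
lemma halfSpaceAt_cell (b : AffineBasis (Fin (d + 1)) ℝ (Vec d)) (hd : 1 ≤ d) {i : Fin (d + 1)}
    (hx : x ∈ face b i) (h : ∀ j, j ≠ i → 0 < b.coord j x) :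
    HalfSpaceAt (cell b) x (fnormal b i) := by
  refine ⟨norm_fnormal b hd i, ?_⟩
  have hev : ∀ᶠ y in 𝓝 x, ∀ j, j ≠ i → 0 < b.coord j y := by
    rw [eventually_all]
    intro j
    by_cases hj : j = i
    · simp [hj]
    · filter_upwards [(continuous_coord b j).continuousAt.eventually (lt_mem_nhds (h j hj))]
        with y hy _ using hy
  have hg : 0 < ‖cgrad b i‖ := norm_pos_iff.2 (cgrad_ne_zero b hd i)
  filter_upwards [hev] with y hy
  rw [fnormal, inner_neg_left, real_inner_smul_left, coord_sub, hx.2, sub_zero, mem_cell,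
    neg_nonpos]
  constructor
  · intro hc
    exact mul_nonneg (by positivity) (hc i)
  · intro hi j
    by_cases hj : j = i
    · rw [hj]; exact nonneg_of_mul_nonneg_right hi (by positivity)
    · exact (hy j hj).le

lemma ae_face_interior (b : AffineBasis (Fin (d + 1)) ℝ (Vec d)) (hd : 1 ≤ d) :
    ∀ᵐ x ∂surf d, ∀ i, x ∈ face b i → ∀ j, j ≠ i → 0 < b.coord j x := by
  rw [ae_all_iff]
  intro i
  have : ∀ᵐ x ∂surf d, ∀ j, j ≠ i → x ∉ face b i ∩ face b j := by
    rw [ae_all_iff]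
    intro j
    by_cases hj : j = i
    · simp [hj]
    · have := measure_eq_zero_iff_ae_notMem.1 (surf_face_inter_face b hd (Ne.symm hj))
      filter_upwards [this] with x hx _ using hx
  filter_upwards [this] with x hx hxi j hj
  refine lt_of_le_of_ne ((mem_cell b).1 hxi.1 j) fun h => hx j hj ⟨hxi, hxi.1, h.symm⟩

lemma IsSimplex.exists_basis (hK : IsSimplex K) :
    ∃ b : AffineBasis (Fin (d + 1)) ℝ (Vec d), K = cell b := by
  obtain ⟨p, hp, rfl⟩ := hK
  refine ⟨⟨p, hp, ?_⟩, rfl⟩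
  rw [hp.affineSpan_eq_top_iff_card_eq_finrank_add_one]
  simp

lemma IsSimplex.isCompact (hK : IsSimplex K) : IsCompact K := by
  obtain ⟨b, rfl⟩ := hK.exists_basis; exact isCompact_cell b

lemma IsSimplex.convex (hK : IsSimplex K) : Convex ℝ K := by
  obtain ⟨b, rfl⟩ := hK.exists_basis; exact convex_cell b

lemma IsSimplex.interior_nonempty (hK : IsSimplex K) : (interior K).Nonempty := by
  obtain ⟨b, rfl⟩ := hK.exists_basis; exact ⟨_, b.centroid_mem_interior_convexHull⟩

lemma IsSimplex.volume_frontier (hK : IsSimplex K) : volume (frontier K) = 0 :=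
  hK.convex.addHaar_frontier _

lemma IsSimplex.ae_halfSpaceAt (hd : 1 ≤ d) (hK : IsSimplex K) :
    ∀ᵐ x ∂surf d, x ∈ frontier K → ∃ n, HalfSpaceAt K x n := by
  obtain ⟨b, rfl⟩ := hK.exists_basis
  filter_upwards [ae_face_interior b hd] with x hx hxK
  obtain ⟨i, hi⟩ := (mem_frontier_cell b).1 hxK
  exact ⟨_, halfSpaceAt_cell b hd hi (hx i hi)⟩

lemma IsSimplex.surf_frontier_lt_top (hd : 1 ≤ d) (hK : IsSimplex K) :
    surf d (frontier K) < ⊤ := by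
  obtain ⟨b, rfl⟩ := hK.exists_basis; exact surf_frontier_cell_lt_top b hd

end HalfSpace

/-! ### How the cells of a triangulation meet at almost every point of their boundaries. -/

section Triangulation

variable {d : ℕ} {Ω : Set (Vec d)} {M : Finset (Set (Vec d))} {K L : Set (Vec d)} {x n : Vec d}

/-- Every cell of `M` is a half space near `x` if `x` lies on its boundary. -/
def RegularAt (M : Finset (Set (Vec d))) (x : Vec d) : Prop :=
  ∀ K ∈ M, x ∈ frontier K → ∃ n, HalfSpaceAt K x n

namespace IsTriangulation

lemma ae_regularAt (hd : 1 ≤ d) (hM : IsTriangulation Ω M) : ∀ᵐ x ∂surf d, RegularAt M x := by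
  have : ∀ᵐ x ∂surf d, ∀ K : M, x ∈ frontier K.1 → ∃ n, HalfSpaceAt K.1 x n :=
    ae_all_iff.2 fun K => (hM.simplex K K.2).ae_halfSpaceAt hd
  filter_upwards [this] with x hx K hK using hx ⟨K, hK⟩

lemma subset (hM : IsTriangulation Ω M) (hK : K ∈ M) : K ⊆ closure Ω := by
  rw [← hM.cover]; exact subset_biUnion_of_mem (u := fun K => K) hK

lemma interior_subset (hM : IsTriangulation Ω M) (hΩ : interior (closure Ω) = Ω) (hK : K ∈ M) :
    interior K ⊆ Ω := by
  rw [← hΩ]; exact interior_mono (hM.subset hK)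

lemma eventually_mem_cells (hM : IsTriangulation Ω M) (x : Vec d) :
    ∀ᶠ y in 𝓝 x, y ∈ closure Ω → ∃ K ∈ M, x ∈ K ∧ y ∈ K := by
  have : ∀ᶠ y in 𝓝 x, ∀ K : M, y ∈ K.1 → x ∈ K.1 := by
    rw [eventually_all]
    intro K
    by_cases hx : x ∈ K.1
    · simp [hx]
    · filter_upwards [(hM.simplex K K.2).isCompact.isClosed.isOpen_compl.mem_nhds hx] with y hy h
      exact absurd h hy
  filter_upwards [this] with y hy hyΩ
  rw [← hM.cover, mem_iUnion₂] at hyΩ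
  obtain ⟨K, hK, hyK⟩ := hyΩ
  exact ⟨K, hK, hy ⟨K, hK⟩ hyK, hyK⟩

/-- If `L` had a normal `m ≠ -n` at `x`, the direction `-(n + m)` would point strictly into both
cells, against disjointness of the interiors. If `x` were interior to `L`, the direction `-n` would
do so. -/
lemma opposite (hM : IsTriangulation Ω M) (hx : RegularAt M x) (hK : K ∈ M) (hL : L ∈ M)
    (hKL : K ≠ L) (hKx : HalfSpaceAt K x n) (hLx : x ∈ L) : HalfSpaceAt L x (-n) := by
  have nn : inner ℝ n n = (1 : ℝ) := by rw [real_inner_self_eq_norm_sq, hKx.1, one_pow]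
  have hdisj := disjoint_left.1 (hM.disjoint K hK L hL hKL)
  by_cases hi : x ∈ interior L
  · have h1 := hKx.eventually_interior (u := -n) (by rw [inner_neg_right, nn]; norm_num)
    obtain ⟨ε, h1, h2⟩ := (h1.and ((tendsto_add_smul x (-n)).eventually
      (isOpen_interior.mem_nhds hi))).exists
    exact absurd h2 (hdisj h1)
  · obtain ⟨m, hm⟩ := hx L hL ⟨subset_closure hLx, hi⟩
    by_cases h : m = -n
    · rwa [← h]
    · have mm : inner ℝ m m = (1 : ℝ) := by rw [real_inner_self_eq_norm_sq, hm.1, one_pow]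
      have hlt : (-1 : ℝ) < inner ℝ n m := by
        have h1 : |inner ℝ n m| ≤ ‖n‖ * ‖m‖ := abs_real_inner_le_norm n m
        rw [hKx.1, hm.1, one_mul] at h1
        refine lt_of_le_of_ne (abs_le.1 h1).1 fun h2 => h ?_
        have := (inner_eq_one_iff_of_norm_eq_one (𝕜 := ℝ) (x := -n) (y := m)
          (by rw [norm_neg, hKx.1]) hm.1).1 (by rw [inner_neg_left, ← h2]; norm_num)
        exact this.symm
      have h1 := hKx.eventually_interior (u := -(n + m)) (by
        rw [inner_neg_right, inner_add_right, nn]; linarith)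
      have h2 := hm.eventually_interior (u := -(n + m)) (by
        rw [inner_neg_right, inner_add_right, mm, real_inner_comm]; linarith)
      obtain ⟨ε, h1, h2⟩ := (h1.and h2).exists
      exact absurd h2 (hdisj h1)

/-- A cell alone at `x` would be a neighbourhood of `x`. A third cell would be opposite to both `K`
and `L`, which forces `n = -n`. The argument is pointwise, so hanging nodes do no harm. -/
lemma exists_opposite_of_mem (hM : IsTriangulation Ω M) (hΩ : IsOpen Ω) (hx : RegularAt M x)
    (hxΩ : x ∈ Ω) (hK : K ∈ M) (hKx : HalfSpaceAt K x n) :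
    ∃ L ∈ M, L ≠ K ∧ HalfSpaceAt L x (-n) ∧ ∀ L' ∈ M, x ∈ L' → L' = K ∨ L' = L := by
  have h1 : ∃ L ∈ M, L ≠ K ∧ x ∈ L := by
    by_contra hcon
    push Not at hcon
    refine hKx.notMem_interior (mem_interior_iff_mem_nhds.2 ?_)
    filter_upwards [hM.eventually_mem_cells x, hΩ.mem_nhds hxΩ] with y hy hyΩ
    obtain ⟨L, hL, hxL, hyL⟩ := hy (subset_closure hyΩ)
    by_cases h : L = K
    · rwa [← h]
    · exact absurd hxL (hcon L hL h)
  obtain ⟨L, hL, hLK, hxL⟩ := h1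
  have hLn := hM.opposite hx hK hL hLK.symm hKx hxL
  refine ⟨L, hL, hLK, hLn, fun L' hL' hxL' => ?_⟩
  by_contra hcon
  push Not at hcon
  have h1 := hM.opposite hx hK hL' hcon.1.symm hKx hxL'
  have h2 := hM.opposite hx hL hL' hcon.2.symm hLn hxL'
  have h3 := h1.unique h2
  have h4 : n = 0 := by
    rw [neg_neg] at h3
    have h5 : (2 : ℝ) • n = 0 := by rw [two_smul]; nth_rw 1 [h3]; simp
    exact (smul_eq_zero.1 h5).resolve_left two_ne_zero
  have := hKx.1
  rw [h4, norm_zero] at this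
  exact zero_ne_one this

/-- Two cells meeting at `x` would be opposite half spaces and fill a neighbourhood of `x`, so `x`
would lie in `interior (closure Ω) = Ω`. One-sidedness of the domain is essential here: at a slit
two cells do meet on the boundary. -/
lemma halfSpaceAt_of_mem_frontier (hM : IsTriangulation Ω M) (hΩ : IsOpen Ω)
    (hΩ' : interior (closure Ω) = Ω) (hx : RegularAt M x) (hxΩ : x ∈ frontier Ω) (hK : K ∈ M)
    (hxK : x ∈ K) :
    (∃ n, HalfSpaceAt K x n ∧ HalfSpaceAt (closure Ω) x n) ∧ (∀ L ∈ M, x ∈ L → L = K) ∧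
      ∀ᶠ y in 𝓝 x, (y ∈ K ↔ y ∈ closure Ω) := by
  have hxn : x ∉ Ω := by rw [hΩ.frontier_eq] at hxΩ; exact hxΩ.2
  have hxi : x ∉ interior K := fun h => hxn (hM.interior_subset hΩ' hK h)
  obtain ⟨n, hn⟩ := hx K hK ⟨subset_closure hxK, hxi⟩
  have huniq : ∀ L ∈ M, x ∈ L → L = K := by
    intro L hL hxL
    by_contra hLK
    have hLn := hM.opposite hx hK hL (Ne.symm hLK) hn hxL
    refine hxn ?_
    rw [← hΩ', mem_interior_iff_mem_nhds]
    filter_upwards [hn.2, hLn.2] with y h1 h2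
    rw [inner_neg_left, neg_nonpos] at h2
    rcases le_total (inner ℝ n (y - x)) 0 with h | h
    · exact hM.subset hK (h1.2 h)
    · exact hM.subset hL (h2.2 h)
  have hev : ∀ᶠ y in 𝓝 x, (y ∈ K ↔ y ∈ closure Ω) := by
    filter_upwards [hM.eventually_mem_cells x] with y hy
    refine ⟨fun h => hM.subset hK h, fun h => ?_⟩
    obtain ⟨L, hL, hxL, hyL⟩ := hy h
    rwa [huniq L hL hxL] at hyL
  exact ⟨⟨n, hn, hn.congr hev⟩, huniq, hev⟩

lemma frontier_subset (hM : IsTriangulation Ω M) (hΩ : IsOpen Ω)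
    (hΩ' : interior (closure Ω) = Ω) : frontier Ω ⊆ ⋃ K ∈ M, frontier K := by
  intro x hx
  have hxn : x ∉ Ω := by rw [hΩ.frontier_eq] at hx; exact hx.2
  have hxc : x ∈ ⋃ K ∈ M, K := by rw [hM.cover]; exact frontier_subset_closure hx
  rw [mem_iUnion₂] at hxc ⊢
  obtain ⟨K, hK, hxK⟩ := hxc
  exact ⟨K, hK, subset_closure hxK, fun h => hxn (hM.interior_subset hΩ' hK h)⟩

lemma volume_frontier (hM : IsTriangulation Ω M) (hΩ : IsOpen Ω)
    (hΩ' : interior (closure Ω) = Ω) : volume (frontier Ω) = 0 := by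
  refine measure_mono_null (hM.frontier_subset hΩ hΩ') ?_
  exact (measure_biUnion_null_iff M.countable_toSet).2 fun K hK => (hM.simplex K hK).volume_frontier

end IsTriangulation

end Triangulation

instance completeSpace_pair {d : ℕ} (Ω : Set (Vec d)) : CompleteSpace (Pair Ω) :=
  inferInstance

instance completeSpace_dual_pair {d : ℕ} (Ω : Set (Vec d)) : CompleteSpace (Pair Ω →L[ℝ] ℝ) :=
  inferInstance

/-! ### Extension of bounded operators by density and orthogonal projection. -/

section Extension

/-- A bounded linear map on a subspace of a space with a Hilbert norm extends to the whole space. -/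
lemma exists_continuousLinearMap_extension {X Hb Z E : Type*} [NormedAddCommGroup X]
    [NormedSpace ℝ X] [NormedAddCommGroup Hb] [InnerProductSpace ℝ Hb] [CompleteSpace Hb]
    [NormedAddCommGroup Z] [NormedSpace ℝ Z] [CompleteSpace Z] [AddCommGroup E] [Module ℝ E]
    (j : X ≃L[ℝ] Hb) (e : E →ₗ[ℝ] X) (f : E →ₗ[ℝ] Z) {C : ℝ} (hC : 0 ≤ C)
    (h : ∀ φ, ‖f φ‖ ≤ C * ‖e φ‖) : ∃ T : X →L[ℝ] Z, ∀ φ, T (e φ) = f φ := by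
  let e₀ : E →ₗ[ℝ] Hb := (j : X →ₗ[ℝ] Hb) ∘ₗ e
  let D : Submodule ℝ Hb := (LinearMap.range e₀).topologicalClosure
  have : CompleteSpace D := (LinearMap.range e₀).isClosed_topologicalClosure.completeSpace_coe
  let e' : E →ₗ[ℝ] D := e₀.codRestrict D fun φ =>
    (LinearMap.range e₀).le_topologicalClosure (LinearMap.mem_range_self e₀ φ)
  have hdense : DenseRange e' := by
    intro x
    rw [closure_subtype]
    have hx : x.1 ∈ closure (range e₀) := x.2
    convert hx using 2
    ext y
    constructor
    · rintro ⟨_, ⟨φ, rfl⟩, rfl⟩; exact ⟨φ, rfl⟩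
    · rintro ⟨φ, rfl⟩; exact ⟨_, ⟨φ, rfl⟩, rfl⟩
  have hnorm : ∃ C', ∀ φ, ‖f φ‖ ≤ C' * ‖e' φ‖ := by
    refine ⟨C * ‖(j.symm : Hb →L[ℝ] X)‖, fun φ => (h φ).trans ?_⟩
    rw [mul_assoc]
    refine mul_le_mul_of_nonneg_left ?_ hC
    have := (j.symm : Hb →L[ℝ] X).le_opNorm (e₀ φ)
    have h2 : (j.symm : Hb →L[ℝ] X) (e₀ φ) = e φ := j.symm_apply_apply (e φ)
    rwa [h2] at this
  -- Density extends `f` to the closure `D` of the range only. The Hilbert norm supplies a bounded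
  -- projection onto `D`, hence an operator on the whole space.
  refine ⟨(f.extendOfNorm e').comp (D.orthogonalProjectionOnto.comp (j : X →L[ℝ] Hb)), fun φ => ?_⟩
  have hp : D.orthogonalProjectionOnto (j (e φ)) = e' φ :=
    D.orthogonalProjectionOnto_mem_subspace_eq_self (e' φ)
  change f.extendOfNorm e' (D.orthogonalProjectionOnto (j (e φ))) = f φ
  rw [hp, LinearMap.extendOfNorm_eq hdense hnorm]

variable {d : ℕ}

/-- `H¹(Ω)` pairs as a Hilbert space, up to equivalence of norms. -/
def pairEquiv (Ω : Set (Vec d)) : Pair Ω ≃L[ℝ] WithLp 2 (HSpace Ω ×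
    Lp (EuclideanSpace ℝ (Fin (Module.finrank ℝ (Mat d)))) 2 (volume.restrict Ω)) :=
  -- The operator norm on `Mat d` is not a Hilbert norm in general, so gradients are transported to
  -- a Euclidean space of the same dimension.
  let A : GSpace Ω ≃L[ℝ]
      Lp (EuclideanSpace ℝ (Fin (Module.finrank ℝ (Mat d)))) 2 (volume.restrict Ω) :=
    ContinuousLinearEquiv.equivOfInverse
      ((toEuclidean (E := Mat d)).toContinuousLinearMap.compLpL 2 (volume.restrict Ω))
      ((toEuclidean (E := Mat d)).symm.toContinuousLinearMap.compLpL 2 (volume.restrict Ω))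
      (fun x => by
        ext1
        refine (ContinuousLinearMap.coeFn_compLpL _ _).trans ?_
        filter_upwards [ContinuousLinearMap.coeFn_compLpL
          (toEuclidean (E := Mat d)).toContinuousLinearMap x] with y hy
        rw [hy]; simp)
      (fun x => by
        ext1
        refine (ContinuousLinearMap.coeFn_compLpL _ _).trans ?_
        filter_upwards [ContinuousLinearMap.coeFn_compLpL
          (toEuclidean (E := Mat d)).symm.toContinuousLinearMap x] with y hy
        rw [hy]; simp)
  ((ContinuousLinearEquiv.refl ℝ (HSpace Ω)).prodCongr A).trans
    (WithLp.prodContinuousLinearEquiv 2 ℝ _ _).symm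

end Extension

/-! ### Trace operators on surfaces that satisfy a trace inequality. -/

section Trace

variable {d : ℕ} {Ω : Set (Vec d)}

/-- Smooth vector fields on `ℝ^d`. -/
def smoothFields (d : ℕ) : Submodule ℝ (Vec d → Vec d) where
  carrier := {φ | ContDiff ℝ ∞ φ}
  add_mem' := fun h1 h2 => by
    rw [mem_ofPred_eq] at *
    exact h1.add h2
  zero_mem' := by
    rw [mem_ofPred_eq]
    exact contDiff_const
  smul_mem' := fun c _ h => by
    rw [mem_ofPred_eq] at *
    exact h.const_smul c

lemma smoothFields.contDiff {d : ℕ} (φ : smoothFields d) : ContDiff ℝ ∞ φ.1 := φ.2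

lemma isFiniteMeasure_restrict (hΩ : Bornology.IsBounded Ω) :
    IsFiniteMeasure ((volume : Measure (Vec d)).restrict Ω) :=
  ⟨by rw [Measure.restrict_apply_univ]; exact hΩ.measure_lt_top⟩

lemma memLp_of_continuous (hΩ : Bornology.IsBounded Ω) {E : Type*} [NormedAddCommGroup E]
    {φ : Vec d → E} (hφ : Continuous φ) : MemLp φ 2 (volume.restrict Ω) := by
  have := isFiniteMeasure_restrict hΩ
  obtain ⟨C, hC⟩ := hΩ.isCompact_closure.exists_bound_of_continuousOn hφ.continuousOn
  refine MemLp.of_bound hφ.aestronglyMeasurable C ?_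
  refine ae_restrict_of_ae_restrict_of_subset subset_closure ?_
  exact (ae_restrict_iff' isClosed_closure.measurableSet).2 (Eventually.of_forall hC)

lemma smoothFields.memLp (hΩ : Bornology.IsBounded Ω) (φ : smoothFields d) :
    MemLp φ.1 2 (volume.restrict Ω) :=
  memLp_of_continuous hΩ ((smoothFields.contDiff φ).continuous)

lemma smoothFields.memLp_fderiv (hΩ : Bornology.IsBounded Ω) (φ : smoothFields d) :
    MemLp (fderiv ℝ φ.1) 2 (volume.restrict Ω) :=
  memLp_of_continuous hΩ ((smoothFields.contDiff φ).continuous_fderiv (by simp))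

/-- The values in `L²(Ω)` of a smooth field. -/
def smoothValue (hΩ : Bornology.IsBounded Ω) : smoothFields d →ₗ[ℝ] HSpace Ω where
  toFun φ := (smoothFields.memLp hΩ φ).toLp φ.1
  map_add' φ ψ := MemLp.toLp_add (smoothFields.memLp hΩ φ) (smoothFields.memLp hΩ ψ)
  map_smul' c φ := MemLp.toLp_const_smul c (smoothFields.memLp hΩ φ)

/-- The gradient in `L²(Ω)` of a smooth field. -/
def smoothGradient (hΩ : Bornology.IsBounded Ω) : smoothFields d →ₗ[ℝ] GSpace Ω where
  toFun φ := (smoothFields.memLp_fderiv hΩ φ).toLp (fderiv ℝ φ.1)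
  map_add' φ ψ := by
    have h : ∀ φ : smoothFields d, Differentiable ℝ φ.1 := fun φ =>
      (smoothFields.contDiff φ).differentiable (by simp)
    rw [← MemLp.toLp_add]
    exact MemLp.toLp_congr _ _ (ae_of_all _ fun x => fderiv_add (h φ x) (h ψ x))
  map_smul' c φ := by
    have h : Differentiable ℝ φ.1 := (smoothFields.contDiff φ).differentiable (by simp)
    rw [RingHom.id_apply, ← MemLp.toLp_const_smul]
    exact MemLp.toLp_congr _ _ (ae_of_all _ fun x => fderiv_const_smul (h x) c)

/-- The pair `(φ, ∇φ)` of a smooth field. -/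
def smoothPair (hΩ : Bornology.IsBounded Ω) : smoothFields d →ₗ[ℝ] Pair Ω :=
  (smoothValue hΩ).prod (smoothGradient hΩ)

/-- The closure of the smooth fields in `H¹(Ω)`. -/
def H1closure (hΩ : Bornology.IsBounded Ω) : Submodule ℝ (Pair Ω) :=
  (LinearMap.range (smoothPair hΩ)).topologicalClosure

/-- The trace inequality on the surface `S`. -/
def TraceIneq (Ω S : Set (Vec d)) : Prop :=
  ∃ C : NNReal, ∀ φ : Vec d → Vec d, ContDiff ℝ 1 φ → ∫⁻ x in S, ‖φ x‖ₑ ^ 2 ∂surf d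
    ≤ C * ((∫⁻ x in Ω, ‖φ x‖ₑ ^ 2) + ∫⁻ x in Ω, ‖fderiv ℝ φ x‖ₑ ^ 2)

lemma TraceIneq.biUnion {ι : Type*} {S : ι → Set (Vec d)} (s : Finset ι)
    (h : ∀ i ∈ s, TraceIneq Ω (S i)) : TraceIneq Ω (⋃ i ∈ s, S i) := by
  classical
  induction s using Finset.induction_on with
  | empty => exact ⟨0, fun φ _ => by simp⟩
  | insert a s ha ih =>
    obtain ⟨C, hC⟩ := ih fun i hi => h i (Finset.mem_insert_of_mem hi)
    obtain ⟨C', hC'⟩ := h a (Finset.mem_insert_self _ _)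
    refine ⟨C' + C, fun φ hφ => ?_⟩
    rw [Finset.set_biUnion_insert]
    refine (lintegral_union_le _ _ _).trans ?_
    rw [ENNReal.coe_add, add_mul]
    exact add_le_add (hC' φ hφ) (hC φ hφ)

lemma IsSimplex.traceIneq {K : Set (Vec d)} (hd : 1 ≤ d) (hK : IsSimplex K)
    (hKΩ : interior K ⊆ Ω) : TraceIneq Ω (frontier K) := by
  have hvol := hK.volume_frontier
  have hae : (volume : Measure (Vec d)).restrict K = volume.restrict (interior K) :=
    Measure.restrict_congr_set (by
      have := interior_ae_eq_of_null_frontier hvol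
      exact this.symm)
  obtain ⟨b, rfl⟩ := hK.exists_basis
  have : TraceIneq Ω (⋃ i ∈ (Finset.univ : Finset (Fin (d + 1))), face b i) := by
    refine TraceIneq.biUnion _ fun i _ => ?_
    obtain ⟨C, hC⟩ := exists_lintegral_face_le b hd i
    refine ⟨C, fun φ hφ => (hC φ hφ).trans ?_⟩
    rw [hae]
    gcongr
  simpa [frontier_cell] using this

lemma eLpNorm_two_sq {α E : Type*} [MeasurableSpace α] [NormedAddCommGroup E] (μ : Measure α)
    (f : α → E) : eLpNorm f 2 μ ^ 2 = ∫⁻ x, ‖f x‖ₑ ^ 2 ∂μ := by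
  have := eLpNorm_nnreal_pow_eq_lintegral (f := f) (μ := μ) (p := 2) two_ne_zero
  simpa using this

lemma TraceIneq.memLp (hΩ : Bornology.IsBounded Ω) {S : Set (Vec d)} (hS : TraceIneq Ω S)
    (φ : smoothFields d) : MemLp φ.1 2 ((surf d).restrict S) := by
  obtain ⟨C, hC⟩ := hS
  refine ⟨((smoothFields.contDiff φ).continuous).aestronglyMeasurable, ?_⟩
  have h := hC φ.1 ((smoothFields.contDiff φ).of_le (by simp))
  rw [← eLpNorm_two_sq, ← eLpNorm_two_sq, ← eLpNorm_two_sq] at h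
  have h2 : eLpNorm φ.1 2 ((surf d).restrict S) ^ 2 < ⊤ := h.trans_lt
    (ENNReal.mul_lt_top ENNReal.coe_lt_top (ENNReal.add_lt_top.2
      ⟨ENNReal.pow_lt_top (smoothFields.memLp hΩ φ).eLpNorm_lt_top,
        ENNReal.pow_lt_top (smoothFields.memLp_fderiv hΩ φ).eLpNorm_lt_top⟩))
  by_contra hcon
  rw [not_lt, top_le_iff] at hcon
  rw [hcon] at h2
  simp at h2

/-- The trace inequality bounds restriction to `S` by the `H¹` norm on smooth fields, and the
extension lemma applies. Only the values on `H1closure` have a meaning as traces; elsewhere they are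
an artefact of the projection. -/
theorem exists_trace_operator (hΩ : Bornology.IsBounded Ω) {S : Set (Vec d)}
    (hS : TraceIneq Ω S) : ∃ T : Pair Ω →L[ℝ] Lp (Vec d) 2 ((surf d).restrict S),
      ∀ φ : smoothFields d, T (smoothPair hΩ φ) = (hS.memLp hΩ φ).toLp φ.1 := by
  let f : smoothFields d →ₗ[ℝ] Lp (Vec d) 2 ((surf d).restrict S) :=
    { toFun := fun φ => (hS.memLp hΩ φ).toLp φ.1
      map_add' := fun φ ψ => rfl
      map_smul' := fun c φ => rfl }
  obtain ⟨C, hC⟩ := id hS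
  -- The norm of `Pair Ω` is a maximum, so the sum of two squares costs the factor 2 under the root.
  refine exists_continuousLinearMap_extension (pairEquiv Ω) (smoothPair hΩ) f
    (C := Real.sqrt (2 * C)) (Real.sqrt_nonneg _) fun φ => ?_
  have h := hC φ.1 ((smoothFields.contDiff φ).of_le (by simp))
  rw [← eLpNorm_two_sq, ← eLpNorm_two_sq, ← eLpNorm_two_sq] at h
  have n0 : ‖f φ‖ = (eLpNorm φ.1 2 ((surf d).restrict S)).toReal :=
    Lp.norm_toLp _ (hS.memLp hΩ φ)
  have n1 : ‖(smoothPair hΩ φ).1‖ = (eLpNorm φ.1 2 (volume.restrict Ω)).toReal :=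
    Lp.norm_toLp _ (smoothFields.memLp hΩ φ)
  have n2 : ‖(smoothPair hΩ φ).2‖ = (eLpNorm (fderiv ℝ φ.1) 2 (volume.restrict Ω)).toReal :=
    Lp.norm_toLp _ (smoothFields.memLp_fderiv hΩ φ)
  have f1 := (smoothFields.memLp hΩ φ).eLpNorm_lt_top
  have f2 := (smoothFields.memLp_fderiv hΩ φ).eLpNorm_lt_top
  have h' := ENNReal.toReal_mono (ENNReal.mul_ne_top ENNReal.coe_ne_top
    (ENNReal.add_lt_top.2 ⟨ENNReal.pow_lt_top f1, ENNReal.pow_lt_top f2⟩).ne) h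
  rw [ENNReal.toReal_mul, ENNReal.toReal_add (ENNReal.pow_lt_top f1).ne
    (ENNReal.pow_lt_top f2).ne, ENNReal.toReal_pow, ENNReal.toReal_pow, ENNReal.toReal_pow,
    ENNReal.coe_toReal, ← n0, ← n1, ← n2] at h'
  have l1 : ‖(smoothPair hΩ φ).1‖ ≤ ‖smoothPair hΩ φ‖ := norm_fst_le _
  have l2 : ‖(smoothPair hΩ φ).2‖ ≤ ‖smoothPair hΩ φ‖ := norm_snd_le _
  refine abs_le_of_sq_le_sq' ?_ (by positivity) |>.2
  rw [mul_pow, Real.sq_sqrt (by positivity)]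
  refine h'.trans ?_
  have := pow_le_pow_left₀ (norm_nonneg _) l1 2
  have := pow_le_pow_left₀ (norm_nonneg _) l2 2
  rw [mul_comm (2 : ℝ), mul_assoc]
  exact mul_le_mul_of_nonneg_left (by linarith) C.2

/-- `T` is the trace operator on the surface `S`. -/
def IsTraceOperator (hΩ : Bornology.IsBounded Ω) (S : Set (Vec d))
    (T : Pair Ω →L[ℝ] Lp (Vec d) 2 ((surf d).restrict S)) : Prop :=
  ∀ φ : smoothFields d, T (smoothPair hΩ φ) =ᵐ[(surf d).restrict S] φ.1

lemma enorm_smoothPair_sub_fst (hΩ : Bornology.IsBounded Ω) (φ : smoothFields d) (p : Pair Ω) :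
    ‖(smoothPair hΩ φ - p).1‖ₑ = eLpNorm (fun x => φ.1 x - p.1 x) 2 (volume.restrict Ω) := by
  rw [Lp.enorm_def]
  refine eLpNorm_congr_ae ?_
  refine (Lp.coeFn_sub _ _).trans ?_
  filter_upwards [(smoothFields.memLp hΩ φ).coeFn_toLp] with x hx
  rw [Pi.sub_apply, ← hx]; rfl

lemma enorm_smoothPair_sub_snd (hΩ : Bornology.IsBounded Ω) (φ : smoothFields d) (p : Pair Ω) :
    ‖(smoothPair hΩ φ - p).2‖ₑ
      = eLpNorm (fun x => fderiv ℝ φ.1 x - p.2 x) 2 (volume.restrict Ω) := by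
  rw [Lp.enorm_def]
  refine eLpNorm_congr_ae ?_
  refine (Lp.coeFn_sub _ _).trans ?_
  filter_upwards [(smoothFields.memLp_fderiv hΩ φ).coeFn_toLp] with x hx
  rw [Pi.sub_apply, ← hx]; rfl

lemma tendsto_smoothPair_iff (hΩ : Bornology.IsBounded Ω) (φ : ℕ → smoothFields d) (p : Pair Ω) :
    Tendsto (fun m => smoothPair hΩ (φ m)) atTop (𝓝 p) ↔
      Tendsto (fun m => eLpNorm (fun x => (φ m).1 x - p.1 x) 2 (volume.restrict Ω)) atTop (𝓝 0) ∧
      Tendsto (fun m => eLpNorm (fun x => fderiv ℝ (φ m).1 x - p.2 x) 2 (volume.restrict Ω))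
        atTop (𝓝 0) := by
  simp_rw [← enorm_smoothPair_sub_fst hΩ, ← enorm_smoothPair_sub_snd hΩ]
  rw [← tendsto_sub_nhds_zero_iff, Prod.tendsto_iff, Prod.fst_zero, Prod.snd_zero,
    tendsto_zero_iff_enorm_tendsto_zero, tendsto_zero_iff_enorm_tendsto_zero]

variable {S S' : Set (Vec d)} {T : Pair Ω →L[ℝ] Lp (Vec d) 2 ((surf d).restrict S)}

lemma IsTrace.mem_H1closure (hΩ : Bornology.IsBounded Ω) {p : Pair Ω} {γ : Vec d → Vec d}
    (h : IsTrace Ω S p γ) : p ∈ H1closure hΩ := by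
  obtain ⟨-, φ, hφ, h1, h2, -⟩ := h
  refine mem_closure_of_tendsto ((tendsto_smoothPair_iff hΩ (fun m => ⟨φ m, hφ m⟩) p).2 ⟨h1, h2⟩)
    (Eventually.of_forall fun m => ⟨_, rfl⟩)

lemma IsTraceOperator.enorm_sub (hΩ : Bornology.IsBounded Ω) (hT : IsTraceOperator hΩ S T)
    (φ : smoothFields d) (p : Pair Ω) : ‖T (smoothPair hΩ φ) - T p‖ₑ
      = eLpNorm (fun x => φ.1 x - T p x) 2 ((surf d).restrict S) := by
  rw [Lp.enorm_def]
  refine eLpNorm_congr_ae ?_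
  refine (Lp.coeFn_sub _ _).trans ?_
  filter_upwards [hT φ] with x hx
  rw [Pi.sub_apply, ← hx]

lemma IsTraceOperator.isTrace (hΩ : Bornology.IsBounded Ω) (hT : IsTraceOperator hΩ S T)
    {p : Pair Ω} (hp : p ∈ H1closure hΩ) : IsTrace Ω S p (T p) := by
  obtain ⟨q, hq, hqp⟩ := mem_closure_iff_seq_limit.1 hp
  choose φ hφ using hq
  have hlim : Tendsto (fun m => smoothPair hΩ (φ m)) atTop (𝓝 p) := by simpa [hφ] using hqp
  obtain ⟨h1, h2⟩ := (tendsto_smoothPair_iff hΩ φ p).1 hlim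
  refine ⟨Lp.memLp _, fun m => (φ m).1, fun m => (φ m).2, h1, h2, ?_⟩
  have h3 := (T.continuous.tendsto p).comp hlim
  rw [← tendsto_sub_nhds_zero_iff, tendsto_zero_iff_enorm_tendsto_zero] at h3
  simpa only [Function.comp_apply, hT.enorm_sub] using h3

/-- The smooth fields that define the trace converge in `H¹(Ω)`, so by continuity of `T` their
restrictions converge to `T p` in `L²(S)`, while on `S'` they converge to `γ`. One operator on a
large surface thus computes the traces on all its parts. -/
lemma IsTraceOperator.ae_eq (hΩ : Bornology.IsBounded Ω) (hT : IsTraceOperator hΩ S T)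
    (hS : S' ⊆ S) {p : Pair Ω} {γ : Vec d → Vec d} (h : IsTrace Ω S' p γ) :
    γ =ᵐ[(surf d).restrict S'] T p := by
  obtain ⟨hγ, φ, hφ, h1, h2, h3⟩ := h
  have hlim := (tendsto_smoothPair_iff hΩ (fun m => ⟨φ m, hφ m⟩) p).2 ⟨h1, h2⟩
  have h4 := (T.continuous.tendsto p).comp hlim
  rw [← tendsto_sub_nhds_zero_iff, tendsto_zero_iff_enorm_tendsto_zero] at h4
  simp only [Function.comp_apply, hT.enorm_sub] at h4
  have hTp : AEStronglyMeasurable (T p) ((surf d).restrict S') :=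
    (Lp.aestronglyMeasurable (T p)).mono_measure (Measure.restrict_mono_set _ hS)
  have hle : ∀ m, eLpNorm (fun x => γ x - T p x) 2 ((surf d).restrict S') ≤
      eLpNorm (fun x => φ m x - γ x) 2 ((surf d).restrict S')
        + eLpNorm (fun x => φ m x - T p x) 2 ((surf d).restrict S) := by
    intro m
    have hφm : AEStronglyMeasurable (φ m) ((surf d).restrict S') :=
      (hφ m).continuous.aestronglyMeasurable
    calc eLpNorm (fun x => γ x - T p x) 2 ((surf d).restrict S')
        = eLpNorm ((fun x => φ m x - T p x) - fun x => φ m x - γ x) 2 ((surf d).restrict S') := by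
          congr 1; ext1 x; simp
      _ ≤ eLpNorm (fun x => φ m x - T p x) 2 ((surf d).restrict S')
          + eLpNorm (fun x => φ m x - γ x) 2 ((surf d).restrict S') :=
          eLpNorm_sub_le (hφm.sub hTp) (hφm.sub hγ.1) one_le_two
      _ ≤ _ := by
          rw [add_comm]
          gcongr
  have hz : eLpNorm (fun x => γ x - T p x) 2 ((surf d).restrict S') = 0 := by
    have := ge_of_tendsto' (h3.add h4) hle
    simpa using this
  have hz := (eLpNorm_eq_zero_iff (hγ.1.sub hTp) two_ne_zero).1 hz
  filter_upwards [hz] with x hx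
  exact sub_eq_zero.1 hx

lemma IsTrace.mono {p : Pair Ω} {γ : Vec d → Vec d} (hS : S' ⊆ S) (h : IsTrace Ω S p γ) :
    IsTrace Ω S' p γ := by
  obtain ⟨hγ, φ, hφ, h1, h2, h3⟩ := h
  refine ⟨hγ.mono_measure (Measure.restrict_mono_set _ hS), φ, hφ, h1, h2, ?_⟩
  exact tendsto_of_tendsto_of_tendsto_of_le_of_le tendsto_const_nhds h3 (fun _ => zero_le)
    fun m => eLpNorm_mono_measure _ (Measure.restrict_mono_set _ hS)

lemma IsTraceOperator.trace_ae_eq (hΩ : Bornology.IsBounded Ω) (hT : IsTraceOperator hΩ S T)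
    (hS : S' ⊆ S) {p : Pair Ω} (hp : p ∈ H1closure hΩ) :
    trace Ω S' p =ᵐ[(surf d).restrict S'] T p := by
  have hex : ∃ γ, IsTrace Ω S' p γ := ⟨_, (hT.isTrace hΩ hp).mono hS⟩
  rw [trace, dif_pos hex]
  exact hT.ae_eq hΩ hS hex.choose_spec

/-- A trace on `Γ_D` comes with approximating smooth fields, so no density theorem for `H¹(Ω)` is
needed. -/
lemma VSpace.mem_H1closure (hΩ : Bornology.IsBounded Ω) {ΓD : Set (Vec d)} {p : Pair Ω}
    (hp : p ∈ VSpace Ω ΓD) : p ∈ H1closure hΩ := hp.2.mem_H1closure hΩ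

lemma IsTraceOperator.ae_eq_zero (hΩ : Bornology.IsBounded Ω) (hT : IsTraceOperator hΩ S T)
    {ΓD : Set (Vec d)} (hS : ΓD ⊆ S) {p : Pair Ω} (hp : p ∈ VSpace Ω ΓD) :
    T p =ᵐ[(surf d).restrict ΓD] 0 := (hT.ae_eq hΩ hS hp.2).symm

end Trace

/-! ### Algebra of strain and stress, and integration by parts for a constant stress. -/

section Stress

variable {d : ℕ}

/-- An entry of the strain as a continuous linear functional of the gradient. -/
def strainL (i j : Fin d) : Mat d →L[ℝ] ℝ := LinearMap.toContinuousLinearMap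
  { toFun := fun A => strain A i j
    map_add' := fun A B => by simp only [strain, _root_.add_apply, PiLp.add_apply]; ring
    map_smul' := fun c A => by
      simp only [strain, _root_.smul_apply, PiLp.smul_apply, smul_eq_mul, RingHom.id_apply]; ring }

lemma strainL_apply (i j : Fin d) (A : Mat d) : strainL i j A = strain A i j := rfl

lemma strain_add (A B : Mat d) : strain (A + B) = strain A + strain B := by
  ext i j; exact (strainL i j).map_add A B

lemma strain_smul (c : ℝ) (A : Mat d) : strain (c • A) = c • strain A := by
  ext i j; exact (strainL i j).map_smul c A

lemma strain_symm (A : Mat d) (i j : Fin d) : strain A i j = strain A j i := by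
  simp only [strain]; ring

/-- The integrand of the form `a`. -/
def stressForm (μ₀ lam₀ : ℝ) (A B : Mat d) : ℝ :=
  2 * μ₀ * (∑ i, ∑ j, strain A i j * strain B i j) + lam₀ * ((strain A).trace * (strain B).trace)

/-- The stress for the gradient `A`. -/
def stress (μ₀ lam₀ : ℝ) (A : Mat d) : Matrix (Fin d) (Fin d) ℝ :=
  (2 * μ₀) • strain A + (lam₀ * (strain A).trace) • (1 : Matrix (Fin d) (Fin d) ℝ)

lemma normalStress_apply (μ₀ lam₀ : ℝ) (A : Mat d) (ν : Vec d) (i : Fin d) :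
    normalStress μ₀ lam₀ A ν i = ∑ j, stress μ₀ lam₀ A i j * ν j := rfl

/-- Pairing with a symmetric matrix does not see the antisymmetric part of `B`, so its strain may be
replaced by the gradient itself, to which the divergence theorem applies. -/
lemma stressForm_eq (μ₀ lam₀ : ℝ) (A B : Mat d) : stressForm μ₀ lam₀ A B
    = ∑ i, ∑ j, stress μ₀ lam₀ A i j * B (EuclideanSpace.single j 1) i := by
  have h1 : ∑ i, ∑ j, strain A i j * strain B i j
      = ∑ i, ∑ j, strain A i j * B (EuclideanSpace.single j 1) i := by
    have h2 : ∑ i, ∑ j, strain A i j * B (EuclideanSpace.single i 1) j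
        = ∑ i, ∑ j, strain A i j * B (EuclideanSpace.single j 1) i := by
      rw [Finset.sum_comm]
      simp_rw [strain_symm A]
    have h3 : ∑ i, ∑ j, strain A i j * strain B i j
        = (∑ i, ∑ j, strain A i j * B (EuclideanSpace.single j 1) i
          + ∑ i, ∑ j, strain A i j * B (EuclideanSpace.single i 1) j) / 2 := by
      rw [← Finset.sum_add_distrib, Finset.sum_div]
      refine Finset.sum_congr rfl fun i _ => ?_
      rw [← Finset.sum_add_distrib, Finset.sum_div]
      refine Finset.sum_congr rfl fun j _ => ?_
      rw [strain.eq_1 B]; ring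
    rw [h3, h2]; ring
  have h4 : (strain B).trace = ∑ i, B (EuclideanSpace.single i 1) i := by
    rw [Matrix.trace]
    refine Finset.sum_congr rfl fun i _ => ?_
    rw [Matrix.diag_apply, strain]; ring
  rw [stressForm, h1, h4]
  have h5 : ∀ i j, stress μ₀ lam₀ A i j * B (EuclideanSpace.single j 1) i
      = 2 * μ₀ * (strain A i j * B (EuclideanSpace.single j 1) i)
        + (if i = j then lam₀ * (strain A).trace * B (EuclideanSpace.single j 1) i else 0) := by
    intro i j
    rw [stress, Matrix.add_apply, Matrix.smul_apply, Matrix.smul_apply, Matrix.one_apply]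
    split_ifs <;> simp only [smul_eq_mul] <;> ring
  simp_rw [h5, Finset.sum_add_distrib]
  simp only [Finset.sum_ite_eq, Finset.mem_univ, if_true, Finset.mul_sum, mul_assoc]

/-- The normal stress as a bilinear map of the gradient and the normal. -/
def normalStressL (μ₀ lam₀ : ℝ) (A : Mat d) : Vec d →L[ℝ] Vec d := LinearMap.toContinuousLinearMap
  { toFun := fun ν => normalStress μ₀ lam₀ A ν
    map_add' := fun ν ν' => by
      ext i; simp only [normalStress_apply, PiLp.add_apply, mul_add, Finset.sum_add_distrib]
    map_smul' := fun c ν => by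
      ext i
      simp only [normalStress_apply, PiLp.smul_apply, smul_eq_mul, RingHom.id_apply, Finset.mul_sum]
      exact Finset.sum_congr rfl fun j _ => by ring }

lemma normalStress_neg (μ₀ lam₀ : ℝ) (A : Mat d) (ν : Vec d) :
    normalStress μ₀ lam₀ A (-ν) = -normalStress μ₀ lam₀ A ν :=
  (normalStressL μ₀ lam₀ A).map_neg ν

lemma stress_add (μ₀ lam₀ : ℝ) (A B : Mat d) :
    stress μ₀ lam₀ (A + B) = stress μ₀ lam₀ A + stress μ₀ lam₀ B := by
  simp only [stress, strain_add, Matrix.trace_add, smul_add, mul_add, add_smul]; abel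

lemma stress_smul (μ₀ lam₀ c : ℝ) (A : Mat d) :
    stress μ₀ lam₀ (c • A) = c • stress μ₀ lam₀ A := by
  simp only [stress, strain_smul, Matrix.trace_smul, smul_add, smul_eq_mul]
  congr 1
  · rw [smul_comm]
  · rw [smul_smul]; congr 1; ring

lemma normalStress_add_left (μ₀ lam₀ : ℝ) (A B : Mat d) (ν : Vec d) :
    normalStress μ₀ lam₀ (A + B) ν = normalStress μ₀ lam₀ A ν + normalStress μ₀ lam₀ B ν := by
  ext i
  simp only [normalStress_apply, PiLp.add_apply, stress_add, Matrix.add_apply, add_mul,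
    Finset.sum_add_distrib]

lemma normalStress_smul_left (μ₀ lam₀ c : ℝ) (A : Mat d) (ν : Vec d) :
    normalStress μ₀ lam₀ (c • A) ν = c • normalStress μ₀ lam₀ A ν := by
  ext i
  simp only [normalStress_apply, PiLp.smul_apply, stress_smul, Matrix.smul_apply, smul_eq_mul,
    Finset.mul_sum, mul_assoc]

/-- The form `a` as a continuous bilinear map on pairs. -/
def aFormL (Ω : Set (Vec d)) (μ₀ lam₀ : ℝ) : Pair Ω →L[ℝ] Pair Ω →L[ℝ] ℝ :=
  let I : Lp ℝ 2 (volume.restrict Ω) →L[ℝ] Lp ℝ 2 (volume.restrict Ω) →L[ℝ] ℝ := innerSL ℝ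
  let P : Fin d → Fin d → Pair Ω →L[ℝ] Lp ℝ 2 (volume.restrict Ω) := fun i j =>
    ((strainL i j).compLpL 2 (volume.restrict Ω)).comp (ContinuousLinearMap.snd ℝ _ _)
  (2 * μ₀) • ∑ i, ∑ j, I.bilinearComp (P i j) (P i j)
    + lam₀ • ∑ i, ∑ j, I.bilinearComp (P i i) (P j j)

lemma aFormL_apply (Ω : Set (Vec d)) (μ₀ lam₀ : ℝ) (v w : Pair Ω) :
    aFormL Ω μ₀ lam₀ v w = aForm μ₀ lam₀ v w := by
  have hP : ∀ i j k l, Integrable (fun x => strain (v.2 x) i j * strain (w.2 x) k l)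
        (volume.restrict Ω) ∧
      inner ℝ ((strainL i j).compLpL 2 (volume.restrict Ω) v.2)
        ((strainL k l).compLpL 2 (volume.restrict Ω) w.2)
      = ∫ x in Ω, strain (v.2 x) i j * strain (w.2 x) k l := by
    intro i j k l
    have hae : (fun x => (inner ℝ ((strainL i j).compLpL 2 (volume.restrict Ω) v.2 x)
        ((strainL k l).compLpL 2 (volume.restrict Ω) w.2 x) : ℝ))
        =ᵐ[volume.restrict Ω] fun x => strain (v.2 x) i j * strain (w.2 x) k l := by
      filter_upwards [ContinuousLinearMap.coeFn_compLpL (p := 2) (strainL i j) v.2,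
        ContinuousLinearMap.coeFn_compLpL (p := 2) (strainL k l) w.2] with x h1 h2
      rw [h1, h2, strainL_apply, strainL_apply, real_inner_eq_re_inner, RCLike.inner_apply]
      simp [mul_comm]
    exact ⟨(L2.integrable_inner _ _).congr hae, by rw [L2.inner_def]; exact integral_congr_ae hae⟩
  have e1 : aForm μ₀ lam₀ v w = ∫ x in Ω, (2 * μ₀ * (∑ i, ∑ j, strain (v.2 x) i j *
      strain (w.2 x) i j) + lam₀ * ∑ i, ∑ j, strain (v.2 x) i i * strain (w.2 x) j j) := by
    rw [aForm]
    refine integral_congr_ae (Eventually.of_forall fun x => ?_)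
    simp only [Matrix.trace, Matrix.diag_apply, Finset.sum_mul_sum]
  rw [e1, integral_add, integral_const_mul, integral_const_mul,
    integral_finsetSum _ fun i _ => integrable_finsetSum _ fun j _ => (hP i j i j).1,
    integral_finsetSum _ fun i _ => integrable_finsetSum _ fun j _ => (hP i i j j).1]
  · simp_rw [integral_finsetSum _ fun j _ => (hP _ j _ j).1,
      integral_finsetSum _ fun j _ => (hP _ _ j j).1, ← (hP _ _ _ _).2]
    simp only [aFormL, _root_.add_apply, _root_.smul_apply, _root_.sum_apply,
      ContinuousLinearMap.bilinearComp_apply, smul_eq_mul]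
    rfl
  · exact (integrable_finsetSum _ fun i _ => integrable_finsetSum _ fun j _ =>
      (hP i j i j).1).const_mul _
  · exact (integrable_finsetSum _ fun i _ => integrable_finsetSum _ fun j _ =>
      (hP i i j j).1).const_mul _

/-- Integration by parts on a simplex for a constant stress. -/
lemma integral_stressForm_cell (b : AffineBasis (Fin (d + 1)) ℝ (Vec d)) (hd : 1 ≤ d)
    (μ₀ lam₀ : ℝ) (A : Mat d) {φ : Vec d → Vec d} (hφ : ContDiff ℝ 1 φ) :
    ∫ x in cell b, stressForm μ₀ lam₀ A (fderiv ℝ φ x)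
      = ∑ k, ∫ x in face b k, inner ℝ (normalStress μ₀ lam₀ A (fnormal b k)) (φ x) ∂surf d := by
  have hφi : ∀ i, ContDiff ℝ 1 fun x => φ x i := fun i =>
    (EuclideanSpace.proj (𝕜 := ℝ) i).contDiff.comp hφ
  have hder : ∀ x i (u : Vec d), fderiv ℝ φ x u i = fderiv ℝ (fun x => φ x i) x u := by
    intro x i u
    have h1 : HasFDerivAt φ (fderiv ℝ φ x) x := ((hφ.differentiable one_ne_zero) x).hasFDerivAt
    have := ((EuclideanSpace.proj (𝕜 := ℝ) i).hasFDerivAt.comp x h1).fderiv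
    change _ = fderiv ℝ (⇑(EuclideanSpace.proj (𝕜 := ℝ) i) ∘ φ) x u
    rw [this]; rfl
  have hint : ∀ i j, IntegrableOn (fun x => stress μ₀ lam₀ A i j *
      fderiv ℝ (fun x => φ x i) x (EuclideanSpace.single j 1)) (cell b) := fun i j =>
    ContinuousOn.integrableOn_compact (isCompact_cell b) (continuous_const.mul
      (((hφi i).continuous_fderiv one_ne_zero).clm_apply continuous_const)).continuousOn
  have hintf : ∀ k i j, IntegrableOn (fun x => stress μ₀ lam₀ A i j * fnormal b k j * φ x i)
      (face b k) (surf d) := fun k i j =>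
    integrableOn_face b hd k (continuous_const.mul (hφi i).continuous)
  simp_rw [stressForm_eq, hder]
  rw [integral_finsetSum _ fun i _ => integrable_finsetSum _ fun j _ => hint i j]
  simp_rw [integral_finsetSum _ fun j _ => hint _ j, integral_const_mul,
    integral_fderiv_cell b hd (hφi _)]
  have hR : ∀ k, ∫ x in face b k, inner ℝ (normalStress μ₀ lam₀ A (fnormal b k)) (φ x) ∂surf d
      = ∑ i, ∑ j, ∫ x in face b k, stress μ₀ lam₀ A i j * fnormal b k j * φ x i ∂surf d := by
    intro k
    simp_rw [← integral_finsetSum _ fun j _ => hintf k _ j]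
    rw [← integral_finsetSum _ fun i _ => integrable_finsetSum _ fun j _ => hintf k i j]
    refine integral_congr_ae (Eventually.of_forall fun x => ?_)
    simp only [PiLp.inner_apply, normalStress_apply, RCLike.inner_apply, conj_trivial]
    refine Finset.sum_congr rfl fun i _ => ?_
    rw [mul_comm, Finset.sum_mul]
  simp_rw [hR, Finset.mul_sum]
  rw [Finset.sum_comm' (t' := Finset.univ) (s' := fun _ => Finset.univ) (by simp)]
  refine (Finset.sum_congr rfl fun j _ => Finset.sum_comm).trans ?_
  rw [Finset.sum_comm]
  refine Finset.sum_congr rfl fun k _ => ?_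
  rw [Finset.sum_comm]
  refine Finset.sum_congr rfl fun i _ => Finset.sum_congr rfl fun j _ => ?_
  rw [← integral_const_mul]
  refine integral_congr_ae (Eventually.of_forall fun x => ?_)
  simp only [EuclideanSpace.inner_single_right, conj_trivial, one_mul]
  ring

end Stress

/-! ### `L²` pairings over a measure dominated by two others. -/

section OverlapPair

variable {α E : Type*} [MeasurableSpace α] [NormedAddCommGroup E] [InnerProductSpace ℝ E]
  {μ ν ρ : Measure α}

/-- The inclusion of `L²` spaces for a smaller measure. -/
def lpMono (h : ρ ≤ μ) : Lp E 2 μ →L[ℝ] Lp E 2 ρ :=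
  LinearMap.mkContinuous
    { toFun := fun g => ((Lp.memLp g).mono_measure h).toLp g
      map_add' := fun g g' => by
        rw [← MemLp.toLp_add, MemLp.toLp_eq_toLp_iff]
        exact h.absolutelyContinuous.ae_le (Lp.coeFn_add g g')
      map_smul' := fun c g => by
        rw [RingHom.id_apply, ← MemLp.toLp_const_smul, MemLp.toLp_eq_toLp_iff]
        exact h.absolutelyContinuous.ae_le (Lp.coeFn_smul c g) } 1 fun g => by
    rw [one_mul]
    change ‖((Lp.memLp g).mono_measure h).toLp g‖ ≤ _
    rw [Lp.norm_toLp, Lp.norm_def]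
    exact ENNReal.toReal_mono (Lp.eLpNorm_ne_top g) (eLpNorm_mono_measure _ h)

lemma coeFn_lpMono (h : ρ ≤ μ) (g : Lp E 2 μ) : lpMono h g =ᵐ[ρ] g :=
  ((Lp.memLp g).mono_measure h).coeFn_toLp

/-- The `L²(ρ)` inner product of elements of `L²` spaces for larger measures. -/
def overlapPair (hμ : ρ ≤ μ) (hν : ρ ≤ ν) : Lp E 2 μ →L[ℝ] Lp E 2 ν →L[ℝ] ℝ :=
  let I : Lp E 2 ρ →L[ℝ] Lp E 2 ρ →L[ℝ] ℝ := innerSL ℝ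
  I.bilinearComp (lpMono hμ) (lpMono hν)

lemma overlapPair_apply (hμ : ρ ≤ μ) (hν : ρ ≤ ν) (g : Lp E 2 μ) (h : Lp E 2 ν) :
    overlapPair hμ hν g h = ∫ x, inner ℝ (g x) (h x) ∂ρ := by
  change inner ℝ (lpMono hμ g) (lpMono hν h) = _
  rw [L2.inner_def]
  refine integral_congr_ae ?_
  filter_upwards [coeFn_lpMono hμ g, coeFn_lpMono hν h] with x h1 h2
  rw [h1, h2]

lemma integrable_inner_of_le (hμ : ρ ≤ μ) (hν : ρ ≤ ν) (g : Lp E 2 μ) (h : Lp E 2 ν) :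
    Integrable (fun x => inner ℝ (g x) (h x)) ρ := by
  refine (L2.integrable_inner (𝕜 := ℝ) (lpMono hμ g) (lpMono hν h)).congr ?_
  filter_upwards [coeFn_lpMono hμ g, coeFn_lpMono hν h] with x h1 h2
  rw [h1, h2]

end OverlapPair

/-! ### Splitting integrals over the domain into cells. -/

section CellSums

variable {d : ℕ} {Ω : Set (Vec d)} {M : Finset (Set (Vec d))} {K : Set (Vec d)}

namespace IsTriangulation

lemma measurableSet (hM : IsTriangulation Ω M) (hK : K ∈ M) : MeasurableSet K :=
  (hM.simplex K hK).isCompact.isClosed.measurableSet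

lemma restrict_cell_le (hM : IsTriangulation Ω M) (hΩ' : interior (closure Ω) = Ω) (hK : K ∈ M) :
    volume.restrict K ≤ volume.restrict Ω := by
  have h1 : volume.restrict K = volume.restrict (interior K) :=
    Measure.restrict_congr_set
      (interior_ae_eq_of_null_frontier (hM.simplex K hK).volume_frontier).symm
  rw [h1]
  exact Measure.restrict_mono (hM.interior_subset hΩ' hK) le_rfl

/-- A common point of two cells lies on the boundary of one of them, and boundaries of convex sets
are null. -/
lemma aedisjoint (hM : IsTriangulation Ω M) :
    (M : Set (Set (Vec d))).Pairwise fun K L => AEDisjoint volume K L := by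
  intro K hK L hL hKL
  refine measure_mono_null (t := frontier K ∪ frontier L) ?_ (measure_union_null
    (hM.simplex K hK).volume_frontier (hM.simplex L hL).volume_frontier)
  rintro x ⟨hxK, hxL⟩
  by_contra hcon
  rw [mem_union, not_or, frontier, frontier, Set.mem_sdiff, Set.mem_sdiff, not_and_not_right,
    not_and_not_right] at hcon
  exact Set.disjoint_left.1 (hM.disjoint K hK L hL hKL) (hcon.1 (subset_closure hxK))
    (hcon.2 (subset_closure hxL))

lemma ae_eq_closure (hM : IsTriangulation Ω M) (hΩ : IsOpen Ω)
    (hΩ' : interior (closure Ω) = Ω) : closure Ω =ᵐ[volume] Ω :=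
  closure_ae_eq_of_null_frontier (hM.volume_frontier hΩ hΩ')

/-- An integral over the domain is the sum of the integrals over the cells. -/
lemma integral_eq_sum (hM : IsTriangulation Ω M) (hΩ : IsOpen Ω)
    (hΩ' : interior (closure Ω) = Ω) {E : Type*} [NormedAddCommGroup E] [NormedSpace ℝ E]
    {f : Vec d → E} (hf : IntegrableOn f Ω) : ∫ x in Ω, f x = ∑ K ∈ M, ∫ x in K, f x := by
  rw [← setIntegral_congr_set (hM.ae_eq_closure hΩ hΩ')]
  have h1 : closure Ω = ⋃ K : M, (K : Set (Vec d)) := by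
    rw [← hM.cover]; ext x; simp
  have h2 : IntegrableOn f (closure Ω) := hf.congr_set_ae (hM.ae_eq_closure hΩ hΩ')
  rw [h1, integral_iUnion_ae, tsum_fintype, Finset.sum_coe_sort M fun K => ∫ x in K, f x]
  · exact fun K => (hM.measurableSet K.2).nullMeasurableSet
  · exact fun K L hKL => hM.aedisjoint K.2 L.2 (fun h => hKL (Subtype.ext h))
  · rwa [← h1]

end IsTriangulation

end CellSums

/-! ### Continuous piecewise linear fields as elements of `H¹` pairs. -/

section PiecewiseLinear

variable {d : ℕ}

/-- Continuous piecewise linear fields over `M`. -/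
structure IsPL (Ω : Set (Vec d)) (M : Finset (Set (Vec d))) (w : Vec d → Vec d) : Prop where
  continuousOn : ContinuousOn w (closure Ω)
  affine : ∀ K ∈ M, ∃ A : Vec d →ᵃ[ℝ] Vec d, EqOn w A K

variable {Ω : Set (Vec d)} {M M₀ : Finset (Set (Vec d))} {w w' : Vec d → Vec d} {K : Set (Vec d)}
  {x : Vec d}

namespace IsPL

lemma add (h : IsPL Ω M w) (h' : IsPL Ω M w') : IsPL Ω M (fun x => w x + w' x) where
  continuousOn := h.continuousOn.add h'.continuousOn
  affine K hK := by
    obtain ⟨A, hA⟩ := h.affine K hK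
    obtain ⟨A', hA'⟩ := h'.affine K hK
    exact ⟨A + A', fun x hx => by simp [hA hx, hA' hx]⟩

lemma const_smul (h : IsPL Ω M w) (c : ℝ) : IsPL Ω M (fun x => c • w x) where
  continuousOn := h.continuousOn.const_smul c
  affine K hK := by
    obtain ⟨A, hA⟩ := h.affine K hK
    exact ⟨c • A, fun x hx => by simp [hA hx]⟩

lemma sub (h : IsPL Ω M w) (h' : IsPL Ω M w') : IsPL Ω M (fun x => w x - w' x) where
  continuousOn := h.continuousOn.sub h'.continuousOn
  affine K hK := by
    obtain ⟨A, hA⟩ := h.affine K hK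
    obtain ⟨A', hA'⟩ := h'.affine K hK
    exact ⟨A - A', fun x hx => by simp [hA hx, hA' hx]⟩

lemma refine (h : IsPL Ω M₀ w) (hM : Refines M M₀) : IsPL Ω M w where
  continuousOn := h.continuousOn
  affine K hK := by
    obtain ⟨L, hL, hKL⟩ := hM K hK
    obtain ⟨A, hA⟩ := h.affine L hL
    exact ⟨A, hA.mono hKL⟩

/-- The gradient on a cell. -/
lemma exists_grad (h : IsPL Ω M w) (hK : K ∈ M) :
    ∃ B : Mat d, ∀ x ∈ K, HasFDerivWithinAt w B K x := by
  obtain ⟨A, hA⟩ := h.affine K hK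
  refine ⟨LinearMap.toContinuousLinearMap A.linear, fun x hx => ?_⟩
  have h1 : HasFDerivAt A (LinearMap.toContinuousLinearMap A.linear) x := by
    rw [A.decomp]
    exact (LinearMap.toContinuousLinearMap A.linear).hasFDerivAt.add_const (A 0)
  exact h1.hasFDerivWithinAt.congr hA (hA hx)

open Classical in
/-- The gradient on the cell `K`. -/
def grad (h : IsPL Ω M w) (K : Set (Vec d)) : Mat d :=
  if hK : K ∈ M then (h.exists_grad hK).choose else 0

lemma hasFDerivWithinAt (h : IsPL Ω M w) (hK : K ∈ M) (hx : x ∈ K) :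
    HasFDerivWithinAt w (h.grad K) K x := by
  rw [grad, dif_pos hK]; exact (h.exists_grad hK).choose_spec x hx

lemma hasFDerivAt (h : IsPL Ω M w) (hK : K ∈ M) (hx : x ∈ interior K) :
    HasFDerivAt w (h.grad K) x :=
  (h.hasFDerivWithinAt hK (interior_subset hx)).hasFDerivAt (mem_interior_iff_mem_nhds.1 hx)

lemma fderivWithin_eq (hM : IsTriangulation Ω M) (h : IsPL Ω M w) (hK : K ∈ M) (hx : x ∈ K) :
    fderivWithin ℝ w K x = h.grad K :=
  (h.hasFDerivWithinAt hK hx).fderivWithin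
    (uniqueDiffWithinAt_convex (hM.simplex K hK).convex (hM.simplex K hK).interior_nonempty
      (subset_closure hx))

lemma memLp (h : IsPL Ω M w) (hM : IsTriangulation Ω M) : MemLp w 2 (volume.restrict Ω) := by
  have hc : IsCompact (closure Ω) := by
    rw [← hM.cover]; exact M.isCompact_biUnion fun K hK => (hM.simplex K hK).isCompact
  have : IsFiniteMeasure (volume.restrict (closure Ω)) :=
    ⟨by rw [Measure.restrict_apply_univ]; exact hc.measure_lt_top⟩
  obtain ⟨C, hC⟩ := hc.exists_bound_of_continuousOn h.continuousOn
  have h1 : MemLp w 2 (volume.restrict (closure Ω)) :=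
    MemLp.of_bound (h.continuousOn.aestronglyMeasurable isClosed_closure.measurableSet) C
      ((ae_restrict_iff' isClosed_closure.measurableSet).2 (Eventually.of_forall hC))
  exact h1.mono_measure (Measure.restrict_mono_set _ subset_closure)

lemma ae_fderiv_cell (h : IsPL Ω M w) (hM : IsTriangulation Ω M) (hK : K ∈ M) :
    ∀ᵐ x ∂volume.restrict K, fderiv ℝ w x = h.grad K := by
  rw [← Measure.restrict_congr_set
      (interior_ae_eq_of_null_frontier (hM.simplex K hK).volume_frontier),
    ae_restrict_iff' isOpen_interior.measurableSet]
  exact Eventually.of_forall fun x hx => (h.hasFDerivAt hK hx).fderiv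

lemma _root_.Visco.IsTriangulation.ae_of_cells (hM : IsTriangulation Ω M) {p : Vec d → Prop}
    (h : ∀ K ∈ M, ∀ᵐ x ∂volume.restrict K, p x) : ∀ᵐ x ∂volume.restrict Ω, p x := by
  have h1 : ∀ᵐ x ∂volume.restrict (⋃ K ∈ M, K), p x := by
    rw [ae_restrict_biUnion_finset_iff]
    exact h
  rw [hM.cover] at h1
  exact (Measure.restrict_mono_set _ subset_closure).absolutelyContinuous.ae_le h1

lemma memLp_fderiv (h : IsPL Ω M w) (hM : IsTriangulation Ω M) (hΩ : Bornology.IsBounded Ω) :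
    MemLp (fderiv ℝ w) 2 (volume.restrict Ω) := by
  have := isFiniteMeasure_restrict hΩ
  refine MemLp.of_bound (measurable_fderiv ℝ w).aestronglyMeasurable (∑ K ∈ M, ‖h.grad K‖) ?_
  refine hM.ae_of_cells fun K hK => ?_
  filter_upwards [h.ae_fderiv_cell hM hK] with x hx
  rw [hx]
  exact Finset.single_le_sum (f := fun K => ‖h.grad K‖) (fun _ _ => norm_nonneg _) hK

open Classical in
lemma toPair_fst (h : IsPL Ω M w) (hM : IsTriangulation Ω M) :
    (toPair Ω w).1 =ᵐ[volume.restrict Ω] w := by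
  change (if h : MemLp w 2 (volume.restrict Ω) then h.toLp w else 0 : HSpace Ω)
    =ᵐ[volume.restrict Ω] w
  rw [dif_pos (h.memLp hM)]
  exact MemLp.coeFn_toLp _

open Classical in
lemma toPair_snd (h : IsPL Ω M w) (hM : IsTriangulation Ω M) (hΩ : Bornology.IsBounded Ω) :
    (toPair Ω w).2 =ᵐ[volume.restrict Ω] fderiv ℝ w := by
  change (if h : MemLp (fderiv ℝ w) 2 (volume.restrict Ω) then h.toLp (fderiv ℝ w) else 0 :
    GSpace Ω) =ᵐ[volume.restrict Ω] fderiv ℝ w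
  rw [dif_pos (h.memLp_fderiv hM hΩ)]
  exact MemLp.coeFn_toLp _

/-- The pointwise derivative is additive only where both fields are differentiable. This holds in
the interior of every cell, hence almost everywhere. -/
lemma toPair_add_smul (h : IsPL Ω M w) (h' : IsPL Ω M w') (hM : IsTriangulation Ω M)
    (hΩ : Bornology.IsBounded Ω) (c : ℝ) :
    toPair Ω (fun x => w x + c • w' x) = toPair Ω w + c • toPair Ω w' := by
  have h3 := h.add (h'.const_smul c)
  refine Prod.ext ?_ ?_
  · refine Lp.ext ?_
    refine (h3.toPair_fst hM).trans ?_
    rw [Prod.fst_add, Prod.smul_fst]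
    filter_upwards [Lp.coeFn_add (toPair Ω w).1 (c • (toPair Ω w').1),
      Lp.coeFn_smul c (toPair Ω w').1, h.toPair_fst hM, h'.toPair_fst hM] with x h1 h2 h4 h5
    rw [h1, Pi.add_apply, h2, Pi.smul_apply, h4, h5]
  · refine Lp.ext ?_
    refine (h3.toPair_snd hM hΩ).trans ?_
    rw [Prod.snd_add, Prod.smul_snd]
    have hae : ∀ᵐ x ∂volume.restrict Ω, ∃ B B' : Mat d, HasFDerivAt w B x ∧ HasFDerivAt w' B' x := by
      refine hM.ae_of_cells fun K hK => ?_
      rw [← Measure.restrict_congr_set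
          (interior_ae_eq_of_null_frontier (hM.simplex K hK).volume_frontier),
        ae_restrict_iff' isOpen_interior.measurableSet]
      exact Eventually.of_forall fun x hx => ⟨_, _, h.hasFDerivAt hK hx, h'.hasFDerivAt hK hx⟩
    filter_upwards [Lp.coeFn_add (toPair Ω w).2 (c • (toPair Ω w').2),
      Lp.coeFn_smul c (toPair Ω w').2, h.toPair_snd hM hΩ, h'.toPair_snd hM hΩ, hae]
      with x h1 h2 h4 h5 ⟨B, B', hB, hB'⟩
    rw [h1, Pi.add_apply, h2, Pi.smul_apply, h4, h5, hB.fderiv, hB'.fderiv]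
    exact (hB.add (hB'.const_smul c)).fderiv

end IsPL

/-- `toPair` depends only on the values in the open set `Ω`. -/
lemma toPair_congr (hΩ : IsOpen Ω) (h : EqOn w w' Ω) : toPair Ω w = toPair Ω w' := by
  have h1 : w =ᵐ[volume.restrict Ω] w' :=
    (ae_restrict_iff' hΩ.measurableSet).2 (Eventually.of_forall h)
  have h2 : fderiv ℝ w =ᵐ[volume.restrict Ω] fderiv ℝ w' :=
    (ae_restrict_iff' hΩ.measurableSet).2 (Eventually.of_forall fun x hx =>
      (h.eventuallyEq_of_mem (hΩ.mem_nhds hx)).fderiv_eq)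
  unfold toPair
  rw [Prod.mk.injEq]
  constructor
  · by_cases hw : MemLp w 2 (volume.restrict Ω)
    · rw [dif_pos hw, dif_pos ((memLp_congr_ae h1).1 hw), MemLp.toLp_eq_toLp_iff]; exact h1
    · rw [dif_neg hw, dif_neg fun h => hw ((memLp_congr_ae h1).2 h)]
  · by_cases hw : MemLp (fderiv ℝ w) 2 (volume.restrict Ω)
    · rw [dif_pos hw, dif_pos ((memLp_congr_ae h2).1 hw), MemLp.toLp_eq_toLp_iff]; exact h2
    · rw [dif_neg hw, dif_neg fun h => hw ((memLp_congr_ae h2).2 h)]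

end PiecewiseLinear

/-! ### The divergence theorem on a cell for weak gradients and traces. -/

section Flux

variable {d : ℕ} {K : Set (Vec d)} {x : Vec d}

lemma norm_outwardNormal_le (K : Set (Vec d)) (x : Vec d) : ‖outwardNormal K x‖ ≤ 1 := by
  unfold outwardNormal
  split_ifs with h
  · exact h.choose_spec.1.1.le
  · simp

lemma ae_outwardNormal_face (b : AffineBasis (Fin (d + 1)) ℝ (Vec d)) (hd : 1 ≤ d)
    (i : Fin (d + 1)) :
    ∀ᵐ x ∂(surf d).restrict (face b i), outwardNormal (cell b) x = fnormal b i := by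
  rw [ae_restrict_iff' (isCompact_face b i).measurableSet]
  filter_upwards [ae_face_interior b hd] with x hx hxi
  exact (halfSpaceAt_cell b hd hxi (hx i hxi)).outwardNormal_eq (convex_cell b)

lemma IsSimplex.aestronglyMeasurable_outwardNormal (hd : 1 ≤ d) (hK : IsSimplex K) :
    AEStronglyMeasurable (outwardNormal K) ((surf d).restrict (frontier K)) := by
  obtain ⟨b, rfl⟩ := hK.exists_basis
  rw [frontier_cell, aestronglyMeasurable_iUnion_iff]
  exact fun i => ⟨fun _ => fnormal b i, stronglyMeasurable_const, ae_outwardNormal_face b hd i⟩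

lemma IsSimplex.isFiniteMeasure (hd : 1 ≤ d) (hK : IsSimplex K) :
    IsFiniteMeasure ((surf d).restrict (frontier K)) :=
  ⟨by rw [Measure.restrict_apply_univ]; exact hK.surf_frontier_lt_top hd⟩

lemma IsSimplex.memLp_flux (hd : 1 ≤ d) (hK : IsSimplex K) (μ₀ lam₀ : ℝ) (A : Mat d) :
    MemLp (fun x => normalStress μ₀ lam₀ A (outwardNormal K x)) 2
      ((surf d).restrict (frontier K)) := by
  have := hK.isFiniteMeasure hd
  refine MemLp.of_bound ((normalStressL μ₀ lam₀ A).continuous.comp_aestronglyMeasurable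
    (hK.aestronglyMeasurable_outwardNormal hd)) ‖normalStressL μ₀ lam₀ A‖
    (Eventually.of_forall fun x => ?_)
  refine ((normalStressL μ₀ lam₀ A).le_opNorm (outwardNormal K x)).trans ?_
  exact mul_le_of_le_one_right (norm_nonneg _) (norm_outwardNormal_le K x)

/-- `stressForm` with a fixed first argument as a linear functional. -/
def stressFormL (μ₀ lam₀ : ℝ) (A : Mat d) : Mat d →L[ℝ] ℝ :=
  LinearMap.toContinuousLinearMap
    { toFun := stressForm μ₀ lam₀ A
      map_add' := fun B C => by
        simp only [stressForm, strain_add, Matrix.add_apply, Matrix.trace_add, mul_add,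
          Finset.sum_add_distrib]
        ring
      map_smul' := fun c B => by
        simp only [stressForm, strain_smul, Matrix.smul_apply, Matrix.trace_smul, smul_eq_mul,
          RingHom.id_apply, mul_add, Finset.mul_sum]
        congr 1
        · exact Finset.sum_congr rfl fun i _ => Finset.sum_congr rfl fun j _ => by ring
        · ring }

lemma stressFormL_apply (μ₀ lam₀ : ℝ) (A B : Mat d) :
    stressFormL μ₀ lam₀ A B = stressForm μ₀ lam₀ A B := rfl

/-- Integration by parts on a simplex for a constant stress and a field of `H¹(Ω)`. -/
lemma IsTraceOperator.integral_stressForm (hd : 1 ≤ d) {Ω S : Set (Vec d)}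
    {hΩ : Bornology.IsBounded Ω} {T : Pair Ω →L[ℝ] Lp (Vec d) 2 ((surf d).restrict S)}
    (hT : IsTraceOperator hΩ S T) (hK : IsSimplex K)
    (hKΩ : (volume : Measure (Vec d)).restrict K ≤ volume.restrict Ω) (hS : frontier K ⊆ S)
    (μ₀ lam₀ : ℝ) (A : Mat d) {q : Pair Ω} (hq : q ∈ H1closure hΩ) :
    ∫ x in K, stressForm μ₀ lam₀ A (q.2 x)
      = ∫ x in frontier K, inner ℝ (normalStress μ₀ lam₀ A (outwardNormal K x)) (T q x)
          ∂surf d := by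
  have hle : (surf d).restrict (frontier K) ≤ (surf d).restrict S :=
    Measure.restrict_mono_set _ hS
  have hfin : IsFiniteMeasure ((volume : Measure (Vec d)).restrict K) :=
    ⟨by rw [Measure.restrict_apply_univ]; exact hK.isCompact.measure_lt_top⟩
  -- Pairing with the constant 1 in the volume and with the flux on the boundary exhibits both sides
  -- as continuous functionals of `q`.
  have h1 : MemLp (fun _ : Vec d => (1 : ℝ)) 2 (volume.restrict K) := memLp_const 1
  let F : Pair Ω →L[ℝ] ℝ := ((overlapPair le_rfl hKΩ (h1.toLp _)).comp
    ((stressFormL μ₀ lam₀ A).compLpL 2 (volume.restrict Ω))).comp (ContinuousLinearMap.snd ℝ _ _)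
  obtain ⟨N, hNx⟩ : ∃ N : Lp (Vec d) 2 ((surf d).restrict (frontier K)),
      N =ᵐ[(surf d).restrict (frontier K)]
        fun x => normalStress μ₀ lam₀ A (outwardNormal K x) :=
    ⟨(hK.memLp_flux hd μ₀ lam₀ A).toLp _, MemLp.coeFn_toLp _⟩
  let G : Pair Ω →L[ℝ] ℝ := (overlapPair le_rfl hle N).comp T
  have hF : ∀ q, F q = ∫ x in K, stressForm μ₀ lam₀ A (q.2 x) := by
    intro q
    refine (overlapPair_apply le_rfl hKΩ _ _).trans (integral_congr_ae ?_)
    filter_upwards [h1.coeFn_toLp, hKΩ.absolutelyContinuous.ae_le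
      (ContinuousLinearMap.coeFn_compLpL (p := 2) (stressFormL μ₀ lam₀ A) q.2)] with x hx1 hx2
    rw [hx1]
    refine (one_mul _).symm.trans ?_ |>.symm
    rw [one_mul]
    refine Eq.trans ?_ (congrArg (fun y : ℝ => inner ℝ (1 : ℝ) y) hx2.symm)
    rw [stressFormL_apply, real_inner_eq_re_inner, RCLike.inner_apply]
    simp
  have hG : ∀ q, G q = ∫ x in frontier K,
      inner ℝ (normalStress μ₀ lam₀ A (outwardNormal K x)) (T q x) ∂surf d := by
    intro q
    refine (overlapPair_apply le_rfl hle N (T q)).trans (integral_congr_ae ?_)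
    filter_upwards [hNx] with x hx
    rw [hx]
  rw [← hF, ← hG]
  -- By continuity it is enough to treat smooth fields, for which the identity is the facetwise
  -- divergence theorem.
  refine closure_minimal (t := {q | F q = G q}) ?_ (isClosed_eq F.continuous G.continuous) hq
  rintro _ ⟨φ, rfl⟩
  rw [mem_ofPred_eq, hF, hG]
  have hφ2 : (smoothPair hΩ φ).2 =ᵐ[volume.restrict K] fderiv ℝ φ.1 :=
    hKΩ.absolutelyContinuous.ae_le (smoothFields.memLp_fderiv hΩ φ).coeFn_toLp
  have hTφ : T (smoothPair hΩ φ) =ᵐ[(surf d).restrict (frontier K)] φ.1 :=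
    hle.absolutelyContinuous.ae_le (hT φ)
  have hint : IntegrableOn (fun x => inner ℝ (normalStress μ₀ lam₀ A (outwardNormal K x)) (φ.1 x))
      (frontier K) (surf d) := by
    refine (integrable_inner_of_le le_rfl hle N (T (smoothPair hΩ φ))).congr ?_
    filter_upwards [hNx, hTφ] with x hx1 hx2
    rw [hx1, hx2]
  have e1 : ∫ x in K, stressForm μ₀ lam₀ A ((smoothPair hΩ φ).2 x)
      = ∫ x in K, stressForm μ₀ lam₀ A (fderiv ℝ φ.1 x) := by
    refine integral_congr_ae ?_
    filter_upwards [hφ2] with x hx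
    rw [hx]
  have e2 : ∫ x in frontier K, inner ℝ (normalStress μ₀ lam₀ A (outwardNormal K x))
        (T (smoothPair hΩ φ) x) ∂surf d
      = ∫ x in frontier K, inner ℝ (normalStress μ₀ lam₀ A (outwardNormal K x)) (φ.1 x)
        ∂surf d := by
    refine integral_congr_ae ?_
    filter_upwards [hTφ] with x hx
    rw [hx]
  rw [e1, e2]
  obtain ⟨b, rfl⟩ := hK.exists_basis
  rw [integral_stressForm_cell b hd μ₀ lam₀ A ((smoothFields.contDiff φ).of_le (by simp))]
  rw [frontier_cell] at hint ⊢
  rw [integral_iUnion_ae (fun i => (isCompact_face b i).measurableSet.nullMeasurableSet)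
    (fun i j hij => surf_face_inter_face b hd hij) hint, tsum_fintype]
  refine Finset.sum_congr rfl fun k _ => integral_congr_ae ?_
  filter_upwards [ae_outwardNormal_face b hd k] with x hx
  rw [hx]

end Flux

/-! ### Jump residuals and boundary stresses of piecewise linear fields. -/

section Residual

variable {d : ℕ} {D : Data d} {M M' : Finset (Set (Vec d))} {w w' : Vec d → Vec d}
  {K L : Set (Vec d)} {x : Vec d}

namespace IsPL

lemma fderivWithin_add_smul (hM : IsTriangulation D.Ω M) (h : IsPL D.Ω M w)
    (h' : IsPL D.Ω M w') (c : ℝ) (hK : K ∈ M) (hx : x ∈ K) :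
    fderivWithin ℝ (fun x => w x + c • w' x) K x
      = fderivWithin ℝ w K x + c • fderivWithin ℝ w' K x := by
  rw [h.fderivWithin_eq hM hK hx, h'.fderivWithin_eq hM hK hx]
  exact ((h.hasFDerivWithinAt hK hx).add ((h'.hasFDerivWithinAt hK hx).const_smul c)).fderivWithin
    (uniqueDiffWithinAt_convex (hM.simplex K hK).convex (hM.simplex K hK).interior_nonempty
      (subset_closure hx))

open Classical in
/-- The jump residual is linear in the piecewise linear field. -/
lemma rd_add_smul (hM : IsTriangulation D.Ω M) (h : IsPL D.Ω M w) (h' : IsPL D.Ω M w') (c : ℝ)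
    (hK : K ∈ M) (hx : x ∈ K) :
    D.rd M (fun x => w x + c • w' x) K x = D.rd M w K x + c • D.rd M w' K x := by
  unfold Data.rd
  split_ifs with hxΩ
  · rw [smul_comm c, ← smul_add, Data.jump, Data.jump, Data.jump, Finset.smul_sum (r := c),
      ← Finset.sum_add_distrib]
    congr 1
    refine Finset.sum_congr rfl fun L hL => ?_
    rw [Finset.mem_filter] at hL
    rw [fderivWithin_add_smul hM h h' c hL.1 hL.2.2, fderivWithin_add_smul hM h h' c hK hx,
      normalStress_add_left, normalStress_add_left, normalStress_smul_left,
      normalStress_smul_left]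
    module
  · simp

/-- On `∂K` the one-sided gradients are constants, so the residual is a finite sum of bounded fluxes
cut off to the neighbouring cells, and the surface of `∂K` is finite. -/
lemma rd_memLp (hd : 1 ≤ d) (hM : IsTriangulation D.Ω M) (h : IsPL D.Ω M w) (hK : K ∈ M) :
    MemLp (D.rd M w K) 2 ((surf d).restrict (frontier K)) := by
  classical
  have hKs := hM.simplex K hK
  let F : Set (Vec d) → Vec d → Vec d := fun L x =>
    normalStress D.μ₀ D.lam₀ (h.grad L) (outwardNormal K x)
      - normalStress D.μ₀ D.lam₀ (h.grad K) (outwardNormal K x)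
  have h1 : MemLp (D.Ω.indicator fun x => (-(1 / 2) : ℝ) • ∑ L ∈ M, (if L ≠ K then
      L.indicator (F L) x else 0)) 2 ((surf d).restrict (frontier K)) := by
    refine MemLp.indicator D.domain.isOpen.measurableSet ?_
    change MemLp ((-(1 / 2) : ℝ) • fun x => ∑ L ∈ M, (if L ≠ K then L.indicator (F L) x else 0)) _ _
    refine MemLp.const_smul ?_ _
    refine memLp_finsetSum _ fun L hL => ?_
    by_cases hLK : L ≠ K
    · simp only [if_pos hLK]
      exact MemLp.indicator (hM.measurableSet hL)
        ((hKs.memLp_flux hd _ _ _).sub (hKs.memLp_flux hd _ _ _))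
    · simp only [if_neg hLK]
      exact MemLp.zero
  refine h1.ae_eq ?_
  refine (ae_restrict_iff' isClosed_frontier.measurableSet).2 (Eventually.of_forall fun x hx => ?_)
  have hxK : x ∈ K := hKs.isCompact.isClosed.frontier_subset hx
  rw [Data.rd]
  by_cases hxΩ : x ∈ D.Ω
  · rw [indicator_of_mem hxΩ, if_pos hxΩ, Data.jump, Finset.sum_filter]
    congr 1
    refine Finset.sum_congr rfl fun L hL => ?_
    by_cases hLK : L ≠ K
    · by_cases hxL : x ∈ L
      · rw [if_pos hLK, if_pos ⟨hLK, hxL⟩, indicator_of_mem hxL,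
          h.fderivWithin_eq hM hL hxL, h.fderivWithin_eq hM hK hxK]
      · rw [if_pos hLK, if_neg fun h => hxL h.2, indicator_of_notMem hxL]
    · rw [if_neg hLK, if_neg fun h => hLK h.1]
  · rw [indicator_of_notMem hxΩ, if_neg hxΩ]

end IsPL

open Classical in
lemma Data.rd_congr (hM : IsTriangulation D.Ω M) (h : EqOn w w' (closure D.Ω)) (hK : K ∈ M)
    (hx : x ∈ K) : D.rd M w K x = D.rd M w' K x := by
  unfold Data.rd
  split_ifs
  · congr 1
    refine Finset.sum_congr rfl fun L hL => ?_
    rw [Finset.mem_filter] at hL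
    rw [fderivWithin_congr (h.mono (hM.subset hL.1)) (h (hM.subset hL.1 hL.2.2)),
      fderivWithin_congr (h.mono (hM.subset hK)) (h (hM.subset hK hx))]
  · rfl

open Classical in
/-- The outward normal of the domain. -/
def Data.normal (D : Data d) (x : Vec d) : Vec d :=
  if h : ∃ n, HalfSpaceAt (closure D.Ω) x n then h.choose else 0

/-- The normal stress of `w` on the boundary of the domain. -/
def Data.bdryStress (D : Data d) (w : Vec d → Vec d) (x : Vec d) : Vec d :=
  normalStress D.μ₀ D.lam₀ (fderivWithin ℝ w (closure D.Ω) x) (D.normal x)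

lemma IsTriangulation.outwardNormal_eq_normal (hM : IsTriangulation D.Ω M) (hx : RegularAt M x)
    (hxΩ : x ∈ frontier D.Ω) (hK : K ∈ M) (hxK : x ∈ K) : outwardNormal K x = D.normal x := by
  obtain ⟨⟨n, hn, hn'⟩, -⟩ := hM.halfSpaceAt_of_mem_frontier D.domain.isOpen D.domain.one_sided
    hx hxΩ hK hxK
  have hex : ∃ n, HalfSpaceAt (closure D.Ω) x n := ⟨n, hn'⟩
  rw [hn.outwardNormal_eq (hM.simplex K hK).convex, Data.normal, dif_pos hex]
  exact hex.choose_spec.unique hn'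

/-- Near a regular boundary point the closure of the domain coincides with the only cell there, so
the one-sided gradient from the domain is the cell gradient. -/
lemma IsPL.hasFDerivWithinAt_closure (hM : IsTriangulation D.Ω M) (h : IsPL D.Ω M w)
    (hx : RegularAt M x) (hxΩ : x ∈ frontier D.Ω) (hK : K ∈ M) (hxK : x ∈ K) :
    HasFDerivWithinAt w (h.grad K) (closure D.Ω) x ∧ UniqueDiffWithinAt ℝ (closure D.Ω) x := by
  obtain ⟨-, -, hev⟩ := hM.halfSpaceAt_of_mem_frontier D.domain.isOpen D.domain.one_sided
    hx hxΩ hK hxK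
  exact ⟨(hasFDerivWithinAt_congr_set (hev.mono fun y hy => propext hy)).1
      (h.hasFDerivWithinAt hK hxK),
    (uniqueDiffWithinAt_convex (hM.simplex K hK).convex (hM.simplex K hK).interior_nonempty
      (subset_closure hxK)).mono (hM.subset hK)⟩

lemma IsPL.bdryStress_eq (hM : IsTriangulation D.Ω M) (h : IsPL D.Ω M w)
    (hx : RegularAt M x) (hxΩ : x ∈ frontier D.Ω) (hK : K ∈ M) (hxK : x ∈ K) :
    D.bdryStress w x = normalStress D.μ₀ D.lam₀ (h.grad K) (outwardNormal K x) := by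
  obtain ⟨h1, h2⟩ := h.hasFDerivWithinAt_closure hM hx hxΩ hK hxK
  rw [Data.bdryStress, h1.fderivWithin h2, hM.outwardNormal_eq_normal hx hxΩ hK hxK]

lemma IsTriangulation.exists_mem_of_mem_frontier (hM : IsTriangulation D.Ω M)
    (hxΩ : x ∈ frontier D.Ω) : ∃ K ∈ M, x ∈ frontier K := by
  simpa using hM.frontier_subset D.domain.isOpen D.domain.one_sided hxΩ

lemma IsTriangulation.mem_of_mem_frontier (hM : IsTriangulation D.Ω M) (hK : K ∈ M)
    (hx : x ∈ frontier K) : x ∈ K :=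
  (hM.simplex K hK).isCompact.isClosed.frontier_subset hx

/-- At a regular boundary point exactly one cell contributes. -/
lemma IsTriangulation.sum_indicator_frontier (hM : IsTriangulation D.Ω M) (hx : RegularAt M x)
    (hxΩ : x ∈ frontier D.Ω) {E : Type*} [AddCommMonoid E] (f : Set (Vec d) → Vec d → E)
    (hK : K ∈ M) (hxK : x ∈ frontier K) :
    ∑ L ∈ M, (frontier L).indicator (f L) x = f K x := by
  obtain ⟨-, huniq, -⟩ := hM.halfSpaceAt_of_mem_frontier D.domain.isOpen D.domain.one_sided
    hx hxΩ hK (hM.mem_of_mem_frontier hK hxK)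
  rw [Finset.sum_eq_single K, indicator_of_mem hxK]
  · intro L hL hLK
    exact indicator_of_notMem (fun h => hLK (huniq L hL (hM.mem_of_mem_frontier hL h))) _
  · exact fun h => absurd hK h

/-- The sum of the normal stresses over all cells reduces to jumps and the boundary stress. -/
lemma IsPL.sum_flux (hM : IsTriangulation D.Ω M) (h : IsPL D.Ω M w) (hx : RegularAt M x) :
    ∑ K ∈ M, (frontier K).indicator
        (fun x => normalStress D.μ₀ D.lam₀ (h.grad K) (outwardNormal K x)) x
      = ∑ K ∈ M, (frontier K).indicator (D.rd M w K) x
        + (frontier D.Ω).indicator (D.bdryStress w) x := by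
  classical
  by_cases hne : ∃ K ∈ M, x ∈ frontier K
  · obtain ⟨K, hK, hxK⟩ := hne
    have hxK' := hM.mem_of_mem_frontier hK hxK
    by_cases hxΩ : x ∈ D.Ω
    · have hxΩ' : x ∉ frontier D.Ω := by
        rw [D.domain.isOpen.frontier_eq]; exact fun h => h.2 hxΩ
      obtain ⟨n, hn⟩ := hx K hK hxK
      obtain ⟨L, hL, hLK, hLn, huniq⟩ := hM.exists_opposite_of_mem D.domain.isOpen hx hxΩ hK hn
      have hxL := hLn.mem_frontier
      have hpair : ∀ f : Set (Vec d) → Vec d → Vec d,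
          ∑ K ∈ M, (frontier K).indicator (f K) x = f K x + f L x := by
        intro f
        rw [← Finset.sum_subset (s₁ := {K, L}), Finset.sum_pair hLK.symm, indicator_of_mem hxK,
          indicator_of_mem hxL]
        · intro L' hL'
          rcases Finset.mem_insert.1 hL' with rfl | h
          · exact hK
          · rwa [Finset.mem_singleton.1 h]
        · intro L' hL' hnot
          refine indicator_of_notMem (fun h => hnot ?_) _
          rcases huniq L' hL' (hM.mem_of_mem_frontier hL' h) with rfl | rfl <;> simp
      have hfK : {L' ∈ M | L' ≠ K ∧ x ∈ L'} = {L} := by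
        ext L'
        rw [Finset.mem_filter, Finset.mem_singleton]
        constructor
        · rintro ⟨h1, h2, h3⟩; exact (huniq L' h1 h3).resolve_left h2
        · rintro rfl; exact ⟨hL, hLK, hLn.mem⟩
      have hfL : {L' ∈ M | L' ≠ L ∧ x ∈ L'} = {K} := by
        ext L'
        rw [Finset.mem_filter, Finset.mem_singleton]
        constructor
        · rintro ⟨h1, h2, h3⟩; exact (huniq L' h1 h3).resolve_right h2
        · rintro rfl; exact ⟨hK, hLK.symm, hxK'⟩
      -- Passing from `K` to `L` reverses both the normal and the order of the difference, so the
      -- two cells carry the same residual. With the factor one half they add up to the difference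
      -- of the two fluxes.
      rw [hpair, hpair, indicator_of_notMem hxΩ', add_zero, Data.rd, Data.rd, if_pos hxΩ,
        if_pos hxΩ, Data.jump, Data.jump, hfK, hfL, Finset.sum_singleton, Finset.sum_singleton,
        h.fderivWithin_eq hM hK hxK', h.fderivWithin_eq hM hL hLn.mem,
        hn.outwardNormal_eq (hM.simplex K hK).convex,
        hLn.outwardNormal_eq (hM.simplex L hL).convex, normalStress_neg, normalStress_neg]
      module
    · have hxΩ' : x ∈ frontier D.Ω := by
        rw [D.domain.isOpen.frontier_eq]; exact ⟨hM.subset hK hxK', hxΩ⟩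
      rw [hM.sum_indicator_frontier hx hxΩ' _ hK hxK, hM.sum_indicator_frontier hx hxΩ' _ hK hxK,
        indicator_of_mem hxΩ', Data.rd, if_neg hxΩ, zero_add,
        h.bdryStress_eq hM hx hxΩ' hK hxK']
  · have hxΩ : x ∉ frontier D.Ω := fun h => hne (hM.exists_mem_of_mem_frontier h)
    push Not at hne
    rw [indicator_of_notMem hxΩ, add_zero, Finset.sum_congr rfl fun K hK =>
      indicator_of_notMem (hne K hK) _, Finset.sum_congr rfl fun K hK =>
      indicator_of_notMem (hne K hK) (D.rd M w K)]

end Residual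

/-! ### Elementwise integration by parts for the form `a`. -/

section SurfaceForm

variable {d : ℕ} {D : Data d} {M M' : Finset (Set (Vec d))} {w w' : Vec d → Vec d}
  {K L : Set (Vec d)} {x : Vec d} {S : Set (Vec d)}
  {T : Pair D.Ω →L[ℝ] Lp (Vec d) 2 ((surf d).restrict S)}

lemma Data.measurableSet_ΓN (D : Data d) : MeasurableSet D.ΓN :=
  isClosed_frontier.measurableSet.diff D.ΓD_measurable

lemma Data.ΓN_subset (D : Data d) : D.ΓN ⊆ frontier D.Ω := sdiff_subset

namespace IsTriangulation

lemma frontier_subset_of_cells (hM : IsTriangulation D.Ω M) (hMS : ∀ K ∈ M, frontier K ⊆ S) :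
    frontier D.Ω ⊆ S :=
  (hM.frontier_subset D.domain.isOpen D.domain.one_sided).trans (iUnion₂_subset hMS)

lemma surf_ΓN_lt_top (hd : 1 ≤ d) (hM : IsTriangulation D.Ω M) : surf d D.ΓN < ⊤ := by
  refine (measure_mono (D.ΓN_subset.trans
    (hM.frontier_subset D.domain.isOpen D.domain.one_sided))).trans_lt ?_
  exact (measure_biUnion_lt_top M.finite_toSet fun K hK => (hM.simplex K hK).surf_frontier_lt_top hd)

lemma biUnion_frontier_inter_ΓN (hM : IsTriangulation D.Ω M) :
    ⋃ K ∈ M, frontier K ∩ D.ΓN = D.ΓN := by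
  rw [← iUnion₂_inter, inter_eq_right]
  exact D.ΓN_subset.trans (hM.frontier_subset D.domain.isOpen D.domain.one_sided)

/-- Up to null sets the cell boundaries decompose `Γ_N`. -/
lemma sum_integral_ΓN (hd : 1 ≤ d) (hM : IsTriangulation D.Ω M) {f : Vec d → ℝ}
    (hf : IntegrableOn f D.ΓN (surf d)) :
    ∑ K ∈ M, ∫ x in frontier K ∩ D.ΓN, f x ∂surf d = ∫ x in D.ΓN, f x ∂surf d := by
  have hm : ∀ K, MeasurableSet (frontier K ∩ D.ΓN) := fun K =>
    isClosed_frontier.measurableSet.inter D.measurableSet_ΓN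
  rw [← integral_indicator D.measurableSet_ΓN]
  simp_rw [← integral_indicator (hm _)]
  rw [← integral_finsetSum]
  · refine integral_congr_ae ?_
    filter_upwards [hM.ae_regularAt hd] with x hx
    by_cases hxΓ : x ∈ D.ΓN
    · obtain ⟨K, hK, hxK⟩ := hM.exists_mem_of_mem_frontier (D.ΓN_subset hxΓ)
      rw [indicator_of_mem hxΓ]
      simp_rw [← indicator_indicator]
      rw [hM.sum_indicator_frontier hx (D.ΓN_subset hxΓ) (fun _ => D.ΓN.indicator f) hK hxK,
        indicator_of_mem hxΓ]
    · rw [indicator_of_notMem hxΓ]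
      exact Finset.sum_eq_zero fun K _ => indicator_of_notMem (fun h => hxΓ h.2) _
  · exact fun K _ => (integrable_indicator_iff (hm K)).2 (hf.mono_set inter_subset_right)

lemma ae_outwardNormal_eq_normal (hd : 1 ≤ d) (hM : IsTriangulation D.Ω M) :
    ∀ᵐ x ∂surf d, x ∈ frontier D.Ω → ∀ K ∈ M, x ∈ K → outwardNormal K x = D.normal x := by
  filter_upwards [hM.ae_regularAt hd] with x hx hxΩ K hK hxK
  exact hM.outwardNormal_eq_normal hx hxΩ hK hxK

end IsTriangulation

lemma IsPL.ae_differentiableWithinAt (hd : 1 ≤ d) (hM : IsTriangulation D.Ω M)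
    (h : IsPL D.Ω M w) : ∀ᵐ x ∂surf d, x ∈ frontier D.Ω →
      DifferentiableWithinAt ℝ w (closure D.Ω) x ∧ UniqueDiffWithinAt ℝ (closure D.Ω) x := by
  filter_upwards [hM.ae_regularAt hd] with x hx hxΩ
  obtain ⟨K, hK, hxK⟩ := hM.exists_mem_of_mem_frontier hxΩ
  obtain ⟨h1, h2⟩ := h.hasFDerivWithinAt_closure hM hx hxΩ hK (hM.mem_of_mem_frontier hK hxK)
  exact ⟨h1.differentiableWithinAt, h2⟩

lemma IsPL.bdryStress_memLp (hd : 1 ≤ d) (hM : IsTriangulation D.Ω M) (h : IsPL D.Ω M w) :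
    MemLp (D.bdryStress w) 2 ((surf d).restrict D.ΓN) := by
  have hfin : IsFiniteMeasure ((surf d).restrict D.ΓN) :=
    ⟨by rw [Measure.restrict_apply_univ]; exact hM.surf_ΓN_lt_top hd⟩
  have hae : ∀ K ∈ M, D.bdryStress w =ᵐ[(surf d).restrict (frontier K ∩ D.ΓN)]
      fun x => normalStress D.μ₀ D.lam₀ (h.grad K) (outwardNormal K x) := by
    intro K hK
    refine (ae_restrict_iff' (isClosed_frontier.measurableSet.inter D.measurableSet_ΓN)).2 ?_
    filter_upwards [hM.ae_regularAt hd] with x hx hxK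
    exact h.bdryStress_eq hM hx (D.ΓN_subset hxK.2) hK (hM.mem_of_mem_frontier hK hxK.1)
  refine MemLp.of_bound (C := ∑ K ∈ M, ‖normalStressL D.μ₀ D.lam₀ (h.grad K)‖) ?_ ?_
  · have hU : D.ΓN = ⋃ K : M, frontier (K : Set (Vec d)) ∩ D.ΓN := by
      refine hM.biUnion_frontier_inter_ΓN.symm.trans ?_
      ext x
      simp only [mem_iUnion, exists_prop, Subtype.exists]
    rw [hU]
    refine AEStronglyMeasurable.iUnion fun K => ?_
    refine AEStronglyMeasurable.congr ?_ (hae K.1 K.2).symm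
    exact ((hM.simplex K.1 K.2).memLp_flux hd _ _ _).1.mono_measure
      (Measure.restrict_mono_set _ inter_subset_left)
  · rw [← hM.biUnion_frontier_inter_ΓN, ae_restrict_biUnion_finset_iff]
    intro K hK
    filter_upwards [hae K hK] with x hx
    rw [hx]
    refine ((normalStressL D.μ₀ D.lam₀ (h.grad K)).le_opNorm (outwardNormal K x)).trans ?_
    refine (mul_le_of_le_one_right (norm_nonneg _) (norm_outwardNormal_le K x)).trans ?_
    exact Finset.single_le_sum (f := fun K => ‖normalStressL D.μ₀ D.lam₀ (h.grad K)‖)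
      (fun _ _ => norm_nonneg _) hK

open Classical in
/-- The boundary stress in `L²(Γ_N)`. -/
def Data.stressLp (D : Data d) (w : Vec d → Vec d) : Lp (Vec d) 2 ((surf d).restrict D.ΓN) :=
  if h : MemLp (D.bdryStress w) 2 ((surf d).restrict D.ΓN) then h.toLp _ else 0

lemma IsPL.coeFn_stressLp (hd : 1 ≤ d) (hM : IsTriangulation D.Ω M) (h : IsPL D.Ω M w) :
    D.stressLp w =ᵐ[(surf d).restrict D.ΓN] D.bdryStress w := by
  rw [Data.stressLp, dif_pos (h.bdryStress_memLp hd hM)]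
  exact MemLp.coeFn_toLp _

lemma IsTraceOperator.bdryPair_eq (hT : IsTraceOperator D.domain.bounded S T)
    (hS : frontier K ⊆ S) (r : Vec d → Vec d) {q : Pair D.Ω} (hq : q ∈ H1closure D.domain.bounded) :
    D.bdryPair K r q = ∫ x in frontier K, inner ℝ (r x) (T q x) ∂surf d := by
  refine integral_congr_ae ?_
  filter_upwards [hT.trace_ae_eq D.domain.bounded hS hq] with x hx
  rw [hx]

lemma IsPL.integrableOn_stressForm (hM : IsTriangulation D.Ω M) (h : IsPL D.Ω M w)
    (q : Pair D.Ω) (hK : K ∈ M) :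
    (fun x => stressForm D.μ₀ D.lam₀ ((toPair D.Ω w).2 x) (q.2 x)) =ᵐ[volume.restrict K]
      (fun x => stressForm D.μ₀ D.lam₀ (h.grad K) (q.2 x)) ∧
    IntegrableOn (fun x => stressForm D.μ₀ D.lam₀ ((toPair D.Ω w).2 x) (q.2 x)) K := by
  have hle := hM.restrict_cell_le D.domain.one_sided hK
  have hfin := isFiniteMeasure_restrict D.domain.bounded
  have h1 : (fun x => stressForm D.μ₀ D.lam₀ ((toPair D.Ω w).2 x) (q.2 x)) =ᵐ[volume.restrict K]
      (fun x => stressForm D.μ₀ D.lam₀ (h.grad K) (q.2 x)) := by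
    filter_upwards [hle.absolutelyContinuous.ae_le (h.toPair_snd hM D.domain.bounded),
      h.ae_fderiv_cell hM hK] with x hx1 hx2
    rw [hx1, hx2]
  refine ⟨h1, Integrable.congr ?_ h1.symm⟩
  have h2 : Integrable q.2 (volume.restrict D.Ω) := (Lp.memLp q.2).integrable one_le_two
  exact ((stressFormL D.μ₀ D.lam₀ (h.grad K)).integrable_comp h2).mono_measure hle

/-- Elementwise integration by parts: the form `a` in terms of the jump residual and of the stress
on the Neumann boundary. -/
theorem IsPL.a_eq (hd : 1 ≤ d) (hM : IsTriangulation D.Ω M) (h : IsPL D.Ω M w)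
    (hT : IsTraceOperator D.domain.bounded S T) (hMS : ∀ K ∈ M, frontier K ⊆ S)
    (hΓ : (surf d).restrict D.ΓN ≤ (surf d).restrict S) {q : Pair D.Ω} (hq : q ∈ D.V) :
    D.a (toPair D.Ω w) q = ∑ K ∈ M, D.bdryPair K (D.rd M w K) q
      + overlapPair le_rfl hΓ (D.stressLp w) (T q) := by
  have hq' := VSpace.mem_H1closure D.domain.bounded hq
  have hΩS := hM.frontier_subset_of_cells hMS
  let F : Set (Vec d) → Vec d → ℝ := fun K x =>
    inner ℝ (normalStress D.μ₀ D.lam₀ (h.grad K) (outwardNormal K x)) (T q x)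
  let R : Set (Vec d) → Vec d → ℝ := fun K x => inner ℝ (D.rd M w K x) (T q x)
  let G : Vec d → ℝ := fun x => inner ℝ (D.bdryStress w x) (T q x)
  have e1 : D.a (toPair D.Ω w) q = ∑ K ∈ M, ∫ x in frontier K, F K x ∂surf d := by
    change ∫ x in D.Ω, stressForm D.μ₀ D.lam₀ ((toPair D.Ω w).2 x) (q.2 x) = _
    rw [hM.integral_eq_sum D.domain.isOpen D.domain.one_sided]
    · refine Finset.sum_congr rfl fun K hK => ?_
      rw [integral_congr_ae (h.integrableOn_stressForm hM q hK).1]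
      exact hT.integral_stressForm hd (hM.simplex K hK)
        (hM.restrict_cell_le D.domain.one_sided hK) (hMS K hK) _ _ _ hq'
    · refine IntegrableOn.mono_set ?_ (subset_closure (s := D.Ω))
      rw [← hM.cover, integrableOn_finset_iUnion]
      exact fun K hK => (h.integrableOn_stressForm hM q hK).2
  have hFi : ∀ K ∈ M, IntegrableOn (F K) (frontier K) (surf d) := fun K hK => by
    have hm := (hM.simplex K hK).memLp_flux hd D.μ₀ D.lam₀ (h.grad K)
    refine (integrable_inner_of_le le_rfl (Measure.restrict_mono_set (surf d) (hMS K hK))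
      (hm.toLp _) (T q)).congr ?_
    filter_upwards [hm.coeFn_toLp] with x hx
    rw [hx]
  have hRi : ∀ K ∈ M, IntegrableOn (R K) (frontier K) (surf d) := fun K hK => by
    have hm := h.rd_memLp hd hM hK
    refine (integrable_inner_of_le le_rfl (Measure.restrict_mono_set (surf d) (hMS K hK))
      (hm.toLp _) (T q)).congr ?_
    filter_upwards [hm.coeFn_toLp] with x hx
    rw [hx]
  have hGi : IntegrableOn G D.ΓN (surf d) := by
    refine (integrable_inner_of_le le_rfl hΓ (D.stressLp w) (T q)).congr ?_
    filter_upwards [h.coeFn_stressLp hd hM] with x hx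
    rw [hx]
  have e2 : overlapPair le_rfl hΓ (D.stressLp w) (T q) = ∫ x in D.ΓN, G x ∂surf d := by
    rw [overlapPair_apply]
    refine integral_congr_ae ?_
    filter_upwards [h.coeFn_stressLp hd hM] with x hx
    rw [hx]
  have e3 : ∑ K ∈ M, D.bdryPair K (D.rd M w K) q = ∑ K ∈ M, ∫ x in frontier K, R K x ∂surf d :=
    Finset.sum_congr rfl fun K hK => hT.bdryPair_eq (hMS K hK) _ hq'
  have hfm : ∀ K : Set (Vec d), MeasurableSet (frontier K) := fun K =>
    isClosed_frontier.measurableSet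
  rw [e1, e2, e3, ← integral_indicator D.measurableSet_ΓN]
  simp_rw [← integral_indicator (hfm _)]
  have hi1 := fun K hK => (integrable_indicator_iff (hfm K)).2 (hFi K hK)
  have hi2 := fun K hK => (integrable_indicator_iff (hfm K)).2 (hRi K hK)
  rw [← integral_finsetSum _ hi1, ← integral_finsetSum _ hi2,
    ← integral_add (integrable_finsetSum _ hi2)
      ((integrable_indicator_iff D.measurableSet_ΓN).2 hGi)]
  refine integral_congr_ae ?_
  -- The trace of `q` vanishes on `Γ_D`, so of the stress on the whole boundary only the part on
  -- `Γ_N` contributes.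
  have hD := (ae_restrict_iff' D.ΓD_measurable).1
    (hT.ae_eq_zero D.domain.bounded (D.ΓD_subset.trans hΩS) hq)
  filter_upwards [hM.ae_regularAt hd, hD] with x hx hxD
  have key := congrArg (fun v => inner ℝ v (T q x)) (h.sum_flux hM hx)
  simp only [inner_add_left, sum_inner] at key
  have hind : ∀ (A : Set (Vec d)) (f : Vec d → Vec d),
      inner ℝ (A.indicator f x) (T q x) = A.indicator (fun x => inner ℝ (f x) (T q x)) x := by
    intro A f
    by_cases hA : x ∈ A
    · rw [indicator_of_mem hA, indicator_of_mem hA]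
    · rw [indicator_of_notMem hA, indicator_of_notMem hA, inner_zero_left]
  simp only [hind] at key
  refine key.trans ?_
  congr 1
  by_cases hxΩ : x ∈ frontier D.Ω
  · by_cases hxΓ : x ∈ D.ΓD
    · rw [indicator_of_mem hxΩ, indicator_of_notMem (fun h => h.2 hxΓ), hxD hxΓ]
      exact inner_zero_right _
    · rw [indicator_of_mem hxΩ, indicator_of_mem (show x ∈ D.ΓN from ⟨hxΩ, hxΓ⟩)]
  · rw [indicator_of_notMem hxΩ, indicator_of_notMem (fun h => hxΩ (D.ΓN_subset h))]

/-- The Neumann datum. -/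
def Data.gN (D : Data d) (t : ℝ) : Lp (Vec d) 2 ((surf d).restrict D.ΓN) := D.g t

lemma Data.memLp_gN (D : Data d) : MemLp D.gN 2 (volume.restrict (Ioc 0 D.T)) := D.g_mem

lemma IsTraceOperator.gPair_eq (hT : IsTraceOperator D.domain.bounded S T)
    (hΓS : D.ΓN ⊆ S) (hΓ : (surf d).restrict D.ΓN ≤ (surf d).restrict S)
    (t : ℝ) {q : Pair D.Ω} (hq : q ∈ H1closure D.domain.bounded) :
    D.gPair t q = overlapPair le_rfl hΓ (D.gN t) (T q) := by
  rw [overlapPair_apply]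
  refine integral_congr_ae ?_
  filter_upwards [hT.trace_ae_eq D.domain.bounded hΓS hq] with x hx
  rw [hx]
  rfl

end SurfaceForm

/-! ### Bounded functions of time and their convolutions with an integrable kernel. -/

section BddMeas

variable {X Y Z : Type*} [NormedAddCommGroup X] [NormedAddCommGroup Y] [NormedSpace ℝ Y]
  [NormedAddCommGroup Z] [NormedSpace ℝ Z] {μ ν : Measure ℝ} {u v : ℝ → X}

/-- Essentially bounded measurable functions. -/
def BddMeas (μ : Measure ℝ) (u : ℝ → X) : Prop :=
  AEStronglyMeasurable u μ ∧ ∃ C, 0 ≤ C ∧ ∀ᵐ t ∂μ, ‖u t‖ ≤ C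

namespace BddMeas

lemma mono (hu : BddMeas μ u) (h : ν ≤ μ) : BddMeas ν u := by
  obtain ⟨h1, C, hC, h2⟩ := hu
  exact ⟨h1.mono_measure h, C, hC, h.absolutelyContinuous.ae_le h2⟩

lemma congr (hu : BddMeas μ u) (h : u =ᵐ[μ] v) : BddMeas μ v := by
  obtain ⟨h1, C, hC, h2⟩ := hu
  refine ⟨h1.congr h, C, hC, ?_⟩
  filter_upwards [h2, h] with t ht1 ht2
  rwa [← ht2]

lemma const (c : X) : BddMeas μ fun _ => c :=
  ⟨aestronglyMeasurable_const, ‖c‖, norm_nonneg _, Eventually.of_forall fun _ => le_rfl⟩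

lemma add (hu : BddMeas μ u) (hv : BddMeas μ v) : BddMeas μ fun t => u t + v t := by
  obtain ⟨h1, C, hC, h2⟩ := hu
  obtain ⟨h1', C', hC', h2'⟩ := hv
  refine ⟨h1.add h1', C + C', by positivity, ?_⟩
  filter_upwards [h2, h2'] with t ht1 ht2
  exact (norm_add_le _ _).trans (add_le_add ht1 ht2)

lemma integrable [IsFiniteMeasure μ] (hu : BddMeas μ u) : Integrable u μ := by
  obtain ⟨h1, C, hC, h2⟩ := hu
  exact Integrable.of_bound h1 C h2

lemma of_continuousOn {a b : ℝ} (h : ContinuousOn u (Icc a b)) :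
    BddMeas (volume.restrict (Ioc a b)) u := by
  obtain ⟨C, hC⟩ := isCompact_Icc.exists_bound_of_continuousOn h
  refine ⟨(h.mono Ioc_subset_Icc_self).aestronglyMeasurable measurableSet_Ioc, max C 0,
    le_max_right _ _, (ae_restrict_iff' measurableSet_Ioc).2 (Eventually.of_forall fun t ht => ?_)⟩
  exact (hC t (Ioc_subset_Icc_self ht)).trans (le_max_left _ _)

variable [NormedSpace ℝ X]

lemma clm (hu : BddMeas μ u) (L : X →L[ℝ] Y) : BddMeas μ fun t => L (u t) := by
  obtain ⟨h1, C, hC, h2⟩ := hu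
  refine ⟨L.continuous.comp_aestronglyMeasurable h1, ‖L‖ * C, by positivity, ?_⟩
  filter_upwards [h2] with t ht
  exact (L.le_opNorm _).trans (by gcongr)

lemma bilin (hu : BddMeas μ u) {w : ℝ → Y} (hw : BddMeas μ w) (b : X →L[ℝ] Y →L[ℝ] Z) :
    BddMeas μ fun t => b (u t) (w t) := by
  obtain ⟨h1, C, hC, h2⟩ := hu
  obtain ⟨h1', C', hC', h2'⟩ := hw
  refine ⟨b.aestronglyMeasurable_comp₂ h1 h1', ‖b‖ * C * C', by positivity, ?_⟩
  filter_upwards [h2, h2'] with t ht1 ht2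
  exact (b.le_opNorm₂ _ _).trans (by gcongr)

lemma sub (hu : BddMeas μ u) (hv : BddMeas μ v) : BddMeas μ fun t => u t - v t := by
  have := hu.add (hv.clm (-ContinuousLinearMap.id ℝ X))
  simpa [sub_eq_add_neg] using this

lemma bilin_integrable {w : ℝ → Y} (hw : Integrable w μ) (hu : BddMeas μ u)
    (b : Y →L[ℝ] X →L[ℝ] Z) : Integrable (fun t => b (w t) (u t)) μ := by
  obtain ⟨h1, C, hC, h2⟩ := hu
  refine Integrable.mono' (hw.norm.const_mul (‖b‖ * C)) (b.aestronglyMeasurable_comp₂ hw.1 h1) ?_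
  filter_upwards [h2] with t ht
  refine (b.le_opNorm₂ _ _).trans ?_
  rw [mul_right_comm]
  gcongr

variable {k : ℝ → ℝ} {S R : Set ℝ}

lemma kernel_integrable (hk : Integrable k) (hu : BddMeas (volume.restrict S) u) (t : ℝ) :
    IntegrableOn (fun s => k (t - s) • u s) S :=
  hu.bilin_integrable (hk.comp_sub_left t).integrableOn (ContinuousLinearMap.lsmul ℝ ℝ)

lemma aestronglyMeasurable_kernel (hk : Integrable k) :
    AEStronglyMeasurable (fun p : ℝ × ℝ => k (p.1 - p.2))
      ((volume.restrict R).prod (volume.restrict S)) := by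
  rw [Measure.prod_restrict]
  exact (hk.1.comp_quasiMeasurePreserving
    (quasiMeasurePreserving_sub_of_right_invariant volume volume)).restrict

/-- The convolution of an integrable kernel with a bounded function is bounded. -/
lemma conv (hk : Integrable k) (hu : BddMeas (volume.restrict S) u) :
    BddMeas (volume.restrict R) fun t => ∫ s in S, k (t - s) • u s := by
  have hm : AEStronglyMeasurable (fun p : ℝ × ℝ => k (p.1 - p.2) • u p.2)
      ((volume.restrict R).prod (volume.restrict S)) :=
    (aestronglyMeasurable_kernel hk).smul hu.1.comp_snd
  obtain ⟨h1, C, hC, h2⟩ := hu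
  refine ⟨hm.integral_prod_right', C * ∫ s, ‖k s‖, by positivity, Eventually.of_forall fun t => ?_⟩
  have hi : Integrable (fun s => ‖k (t - s)‖) := (hk.comp_sub_left t).norm
  calc ‖∫ s in S, k (t - s) • u s‖ ≤ ∫ s in S, C * ‖k (t - s)‖ := by
        refine norm_integral_le_of_norm_le (hi.integrableOn.const_mul C) ?_
        filter_upwards [h2] with s hs
        rw [norm_smul, mul_comm]
        gcongr
    _ = C * ∫ s in S, ‖k (t - s)‖ := integral_const_mul _ _
    _ ≤ C * ∫ s, ‖k (t - s)‖ := by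
        exact mul_le_mul_of_nonneg_left
          (setIntegral_le_integral hi (Eventually.of_forall fun _ => norm_nonneg _)) hC
    _ = C * ∫ s, ‖k s‖ := by rw [integral_sub_left_eq_self (fun s => ‖k s‖) volume t]

/-- The adjoint of a convolution operator is the convolution in reversed time. -/
lemma conv_adjoint [CompleteSpace X] [CompleteSpace Y] (hk : Integrable k) {w : ℝ → Y}
    (hu : BddMeas (volume.restrict S) u) (hw : BddMeas (volume.restrict R) w)
    (hR : volume R ≠ ⊤) (b : X →L[ℝ] Y →L[ℝ] ℝ) :
    ∫ t in R, b (∫ s in S, k (t - s) • u s) (w t)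
      = ∫ s in S, b (u s) (∫ t in R, k (t - s) • w t) := by
  have hk' : Integrable fun x => k (-x) := hk.comp_neg
  have e1 : ∀ t, b (∫ s in S, k (t - s) • u s) (w t) = ∫ s in S, k (t - s) * b (u s) (w t) := by
    intro t
    rw [← ContinuousLinearMap.flip_apply, ← ContinuousLinearMap.integral_comp_comm _
      (hu.kernel_integrable hk t)]
    simp
  have e2 : ∀ s, b (u s) (∫ t in R, k (t - s) • w t) = ∫ t in R, k (t - s) * b (u s) (w t) := by
    intro s
    have := hw.kernel_integrable hk' s
    simp only [neg_sub] at this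
    rw [← ContinuousLinearMap.integral_comp_comm _ this]
    simp
  simp_rw [e1, e2]
  refine integral_integral_swap ?_
  obtain ⟨h1, C, hC, h2⟩ := hu
  obtain ⟨h1', C', hC', h2'⟩ := hw
  have hkm := aestronglyMeasurable_kernel (R := R) (S := S) hk
  have hfin : IsFiniteMeasure (volume.restrict R) :=
    ⟨by rw [Measure.restrict_apply_univ]; exact hR.lt_top⟩
  -- The inner integrals of `‖k (t - s)‖` are bounded uniformly in `t`, so finite measure of `R`
  -- makes the kernel integrable on the product.
  have hki : Integrable (fun p : ℝ × ℝ => k (p.1 - p.2))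
      ((volume.restrict R).prod (volume.restrict S)) := by
    refine (integrable_prod_iff hkm).2 ⟨Eventually.of_forall fun t =>
      (hk.comp_sub_left t).integrableOn, ?_⟩
    have := conv (R := R) (S := S) (u := fun _ => (1 : ℝ)) hk.norm (const 1)
    simpa using this.integrable
  refine Integrable.mono' (hki.norm.const_mul (‖b‖ * C * C'))
    (hkm.mul (b.aestronglyMeasurable_comp₂ h1.comp_snd h1'.comp_fst)) ?_
  have h3 := (Measure.quasiMeasurePreserving_fst (μ := volume.restrict R)
    (ν := volume.restrict S)).ae h2'
  have h4 := (Measure.quasiMeasurePreserving_snd (μ := volume.restrict R)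
    (ν := volume.restrict S)).ae h2
  filter_upwards [h3, h4] with p hp1 hp2
  simp only [Function.uncurry]
  rw [norm_mul, mul_comm]
  have := b.le_opNorm₂ (u p.2) (w p.1)
  gcongr
  refine this.trans ?_
  gcongr

end BddMeas

end BddMeas

/-! ### Functions in `H¹` in time, and integration by parts. -/

section H1Time

variable {X : Type*} [NormedAddCommGroup X] [NormedSpace ℝ X] {T : ℝ} {u v : ℝ → X} {S S' : Set X}

lemma _root_.AbsolutelyContinuousOnInterval.of_dist_le {Y Z : Type*} [PseudoMetricSpace Y]
    [PseudoMetricSpace Z] {f : ℝ → Y} {g : ℝ → Z} {a b : ℝ}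
    (hg : AbsolutelyContinuousOnInterval g a b)
    (h : ∀ x ∈ uIcc a b, ∀ y ∈ uIcc a b, dist (f x) (f y) ≤ dist (g x) (g y)) :
    AbsolutelyContinuousOnInterval f a b := by
  rw [absolutelyContinuousOnInterval_iff] at hg ⊢
  intro ε hε
  obtain ⟨δ, hδ, hδ'⟩ := hg ε hε
  refine ⟨δ, hδ, fun E hE hlt => (Finset.sum_le_sum fun i hi => ?_).trans_lt (hδ' E hE hlt)⟩
  exact h _ (hE.1 i hi).1 _ (hE.1 i hi).2

namespace MemH1Time

lemma exists_deriv [CompleteSpace X] (hT : 0 ≤ T) (h : MemH1Time T S u) :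
    ∃ w : ℝ → X, IntervalIntegrable w volume 0 T ∧
      (∀ t ∈ Icc 0 T, u t = u 0 + ∫ s in (0 : ℝ)..t, w s) ∧
      ∀ᵐ t ∂volume.restrict (Ioc 0 T), HasDerivAt u (w t) t := by
  obtain ⟨w, hw, hu⟩ := h.2
  have hi : IntervalIntegrable w volume 0 T :=
    (intervalIntegrable_iff_integrableOn_Ioc_of_le hT).2 (hw.integrable one_le_two)
  refine ⟨w, hi, hu, ?_⟩
  rw [← Measure.restrict_congr_set Ioo_ae_eq_Ioc, ae_restrict_iff' measurableSet_Ioo]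
  filter_upwards [hi.ae_hasDerivAt_integral] with t ht htT
  have h1 := ht (by rw [uIcc_of_le hT]; exact Ioo_subset_Icc_self htT) 0 left_mem_uIcc
  refine (h1.const_add (u 0)).congr_of_eventuallyEq ?_
  filter_upwards [Ioo_mem_nhds htT.1 htT.2] with s hs
  exact hu s (Ioo_subset_Icc_self hs)

lemma continuousOn [CompleteSpace X] (hT : 0 ≤ T) (h : MemH1Time T S u) :
    ContinuousOn u (Icc 0 T) := by
  obtain ⟨w, hw, hu, -⟩ := h.exists_deriv hT
  have h1 : ContinuousOn (fun t => u 0 + ∫ s in (0 : ℝ)..t, w s) (Icc 0 T) := by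
    have := intervalIntegral.continuousOn_primitive_interval' hw left_mem_uIcc
    rw [uIcc_of_le hT] at this
    exact continuousOn_const.add this
  exact h1.congr hu

lemma bddMeas [CompleteSpace X] (hT : 0 ≤ T) (h : MemH1Time T S u) :
    BddMeas (volume.restrict (Ioc 0 T)) u := BddMeas.of_continuousOn (h.continuousOn hT)

lemma ae_differentiableAt [CompleteSpace X] (hT : 0 ≤ T) (h : MemH1Time T S u) :
    ∀ᵐ t ∂volume.restrict (Ioc 0 T), DifferentiableAt ℝ u t := by
  obtain ⟨w, hw, hu, hd⟩ := h.exists_deriv hT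
  exact hd.mono fun t ht => ht.differentiableAt

lemma integrable_deriv [CompleteSpace X] (hT : 0 ≤ T) (h : MemH1Time T S u) :
    IntegrableOn (deriv u) (Ioc 0 T) := by
  obtain ⟨w, hw, hu, hd⟩ := h.exists_deriv hT
  refine Integrable.congr ((intervalIntegrable_iff_integrableOn_Ioc_of_le hT).1 hw) ?_
  filter_upwards [hd] with t ht
  exact ht.deriv.symm

/-- Integration by parts in time. -/
lemma integral_inner_deriv {E : Type*} [NormedAddCommGroup E] [InnerProductSpace ℝ E]
    [CompleteSpace E] {S S' : Set E} (hT : 0 ≤ T) {u v : ℝ → E} (hu : MemH1Time T S u)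
    (hv : MemH1Time T S' v) :
    ∫ t in (0 : ℝ)..T, (inner ℝ (deriv u t) (v t) + inner ℝ (u t) (deriv v t))
      = inner ℝ (u T) (v T) - inner ℝ (u 0) (v 0) := by
  obtain ⟨w, hw, hu1, hu2⟩ := hu.exists_deriv hT
  obtain ⟨y, hy, hv1, hv2⟩ := hv.exists_deriv hT
  obtain ⟨A, hA⟩ := isCompact_Icc.exists_bound_of_continuousOn (hu.continuousOn hT)
  obtain ⟨B, hB⟩ := isCompact_Icc.exists_bound_of_continuousOn (hv.continuousOn hT)
  have h0 : (0 : ℝ) ∈ Icc 0 T := ⟨le_rfl, hT⟩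
  have hA0 : 0 ≤ A := (norm_nonneg _).trans (hA 0 h0)
  have hB0 : 0 ≤ B := (norm_nonneg _).trans (hB 0 h0)
  -- The increments of `⟨u, v⟩` are dominated by those of the primitive of `p`. Hence `⟨u, v⟩` is
  -- absolutely continuous and equals the integral of its almost everywhere derivative.
  let p : ℝ → ℝ := fun s => B * ‖w s‖ + A * ‖y s‖
  have hp : IntervalIntegrable p volume 0 T := (hw.norm.const_mul B).add (hy.norm.const_mul A)
  have hac : AbsolutelyContinuousOnInterval (fun t => inner ℝ (u t) (v t)) 0 T := by
    refine (hp.absolutelyContinuousOnInterval_intervalIntegral (left_mem_uIcc)).of_dist_le ?_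
    rw [uIcc_of_le hT]
    have key : ∀ x ∈ Icc 0 T, ∀ z ∈ Icc 0 T, x ≤ z →
        dist (inner ℝ (u x) (v x)) (inner ℝ (u z) (v z))
          ≤ dist (∫ s in (0 : ℝ)..x, p s) (∫ s in (0 : ℝ)..z, p s) := by
      intro x hx z hz hxz
      have hsub : ∀ {f : ℝ → ℝ}, IntervalIntegrable f volume 0 T →
          IntervalIntegrable f volume 0 x ∧ IntervalIntegrable f volume 0 z ∧
          IntervalIntegrable f volume x z := fun {f} hf =>
        ⟨hf.mono_set (by rw [uIcc_of_le hT, uIcc_of_le hx.1]; exact Icc_subset_Icc le_rfl hx.2),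
          hf.mono_set (by rw [uIcc_of_le hT, uIcc_of_le hz.1]; exact Icc_subset_Icc le_rfl hz.2),
          hf.mono_set (by rw [uIcc_of_le hT, uIcc_of_le hxz]; exact Icc_subset_Icc hx.1 hz.2)⟩
      have hsub' : ∀ {f : ℝ → E}, IntervalIntegrable f volume 0 T →
          IntervalIntegrable f volume 0 x ∧ IntervalIntegrable f volume 0 z := fun {f} hf =>
        ⟨hf.mono_set (by rw [uIcc_of_le hT, uIcc_of_le hx.1]; exact Icc_subset_Icc le_rfl hx.2),
          hf.mono_set (by rw [uIcc_of_le hT, uIcc_of_le hz.1]; exact Icc_subset_Icc le_rfl hz.2)⟩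
      have du : u z - u x = ∫ s in x..z, w s := by
        rw [hu1 z hz, hu1 x hx, add_sub_add_left_eq_sub,
          intervalIntegral.integral_interval_sub_left (hsub' hw).2 (hsub' hw).1]
      have dv : v z - v x = ∫ s in x..z, y s := by
        rw [hv1 z hz, hv1 x hx, add_sub_add_left_eq_sub,
          intervalIntegral.integral_interval_sub_left (hsub' hy).2 (hsub' hy).1]
      have nu : ‖u z - u x‖ ≤ ∫ s in x..z, ‖w s‖ := by
        rw [du]; exact intervalIntegral.norm_integral_le_integral_norm hxz
      have nv : ‖v z - v x‖ ≤ ∫ s in x..z, ‖y s‖ := by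
        rw [dv]; exact intervalIntegral.norm_integral_le_integral_norm hxz
      have hpxz : ∫ s in x..z, p s = B * (∫ s in x..z, ‖w s‖) + A * ∫ s in x..z, ‖y s‖ := by
        rw [intervalIntegral.integral_add ((hsub hw.norm).2.2.const_mul B)
          ((hsub hy.norm).2.2.const_mul A), intervalIntegral.integral_const_mul,
          intervalIntegral.integral_const_mul]
      rw [dist_comm, dist_comm (∫ s in (0 : ℝ)..x, p s), Real.dist_eq, Real.dist_eq,
        intervalIntegral.integral_interval_sub_left (hsub hp).2.1 (hsub hp).1, hpxz]
      refine le_trans ?_ (le_abs_self _)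
      have e : (inner ℝ (u z) (v z) : ℝ) - inner ℝ (u x) (v x)
          = inner ℝ (u z - u x) (v z) + inner ℝ (u x) (v z - v x) := by
        rw [inner_sub_left, inner_sub_right]; ring
      rw [e]
      refine (abs_add_le _ _).trans (add_le_add ?_ ?_)
      · refine (abs_real_inner_le_norm _ _).trans ?_
        rw [mul_comm]
        exact mul_le_mul (hB z hz) nu (norm_nonneg _) hB0
      · refine (abs_real_inner_le_norm _ _).trans ?_
        exact mul_le_mul (hA x hx) nv (norm_nonneg _) hA0
    intro x hx z hz
    rcases le_total x z with h | h
    · exact key x hx z hz h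
    · rw [dist_comm, dist_comm (∫ s in (0 : ℝ)..x, p s)]
      exact key z hz x hx h
  rw [← hac.integral_deriv_eq_sub, intervalIntegral.integral_of_le hT,
    intervalIntegral.integral_of_le hT]
  refine integral_congr_ae ?_
  filter_upwards [hu2, hv2] with t h1 h2
  rw [(h1.inner ℝ h2).deriv, h1.deriv, h2.deriv, add_comm]

end MemH1Time

end H1Time

/-! ### Scalar ramps, the building blocks of interpolation in time. -/

section Ramp

/-- The continuous piecewise linear function that is `0` before `a` and `1` after `b`. -/
def ramp (a b t : ℝ) : ℝ := max 0 (min 1 ((t - a) / (b - a)))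

variable {a b t : ℝ}

lemma ramp_of_le (hab : a < b) (ht : t ≤ a) : ramp a b t = 0 := by
  have : (t - a) / (b - a) ≤ 0 := div_nonpos_of_nonpos_of_nonneg (by linarith) (by linarith)
  exact max_eq_left ((min_le_right _ _).trans this)

lemma ramp_of_ge (hab : a < b) (ht : b ≤ t) : ramp a b t = 1 := by
  have : 1 ≤ (t - a) / (b - a) := by rw [le_div_iff₀ (by linarith)]; linarith
  rw [ramp, min_eq_left this]
  exact max_eq_right zero_le_one

lemma ramp_of_mem (hab : a < b) (ht : t ∈ Icc a b) : ramp a b t = (t - a) / (b - a) := by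
  have h1 : (t - a) / (b - a) ≤ 1 := by rw [div_le_one (by linarith)]; linarith [ht.2]
  have h0 : 0 ≤ (t - a) / (b - a) := div_nonneg (by linarith [ht.1]) (by linarith)
  rw [ramp, min_eq_right h1, max_eq_right h0]

lemma exists_lipschitzWith_ramp (a b : ℝ) : ∃ C, LipschitzWith C (ramp a b) := by
  have h : LipschitzWith (Real.toNNReal |1 / (b - a)|) fun t : ℝ => (t - a) / (b - a) := by
    refine LipschitzWith.of_dist_le' (fun x y => ?_)
    rw [Real.dist_eq, Real.dist_eq, ← abs_mul]
    apply le_of_eq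
    congr 1
    ring
  exact ⟨_, (h.const_min 1).const_max 0⟩

lemma continuous_ramp (a b : ℝ) : Continuous (ramp a b) :=
  (exists_lipschitzWith_ramp a b).choose_spec.continuous

lemma memLp_deriv_ramp (a b T : ℝ) : MemLp (deriv (ramp a b)) 2 (volume.restrict (Ioc 0 T)) := by
  obtain ⟨C, hC⟩ := exists_lipschitzWith_ramp a b
  exact MemLp.of_bound (measurable_deriv _).aestronglyMeasurable C
    (Eventually.of_forall fun t => norm_deriv_le_of_lipschitz hC)

lemma integral_deriv_ramp (a b t : ℝ) :
    ∫ s in (0 : ℝ)..t, deriv (ramp a b) s = ramp a b t - ramp a b 0 := by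
  obtain ⟨C, hC⟩ := exists_lipschitzWith_ramp a b
  exact (hC.lipschitzOnWith (s := uIcc 0 t)).absolutelyContinuousOnInterval.integral_deriv_eq_sub

end Ramp

/-! ### Time slabs and piecewise linear interpolation in time. -/

namespace Mesh

variable {d : ℕ} {D : Data d} (𝒯 : Mesh D)

lemma τ_mono {m n : ℕ} (hmn : m ≤ n) (hn : n ≤ 𝒯.N) : 𝒯.τ m ≤ 𝒯.τ n := by
  induction n, hmn using Nat.le_induction with
  | base => exact le_rfl
  | succ n hmn ih =>
    have := 𝒯.τ_lt (n + 1) (Finset.mem_Icc.2 ⟨by omega, hn⟩)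
    rw [Nat.add_sub_cancel] at this
    exact (ih (by omega)).trans this.le

lemma τ_mem {n : ℕ} (hn : n ≤ 𝒯.N) : 𝒯.τ n ∈ Icc 0 D.T := by
  have h1 := 𝒯.τ_mono (Nat.zero_le n) hn
  have h2 := 𝒯.τ_mono hn le_rfl
  rw [𝒯.τ_zero] at h1
  rw [𝒯.τ_last] at h2
  exact ⟨h1, h2⟩

lemma one_le_N : 1 ≤ 𝒯.N := by
  by_contra h
  have h0 : 𝒯.N = 0 := by omega
  have := 𝒯.τ_last
  rw [h0, 𝒯.τ_zero] at this
  exact D.T_pos.ne this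

lemma exists_slab {t : ℝ} (ht : t ∈ Icc 0 D.T) :
    ∃ n ∈ Finset.Icc 1 𝒯.N, t ∈ Icc (𝒯.τ (n - 1)) (𝒯.τ n) := by
  have hex : ∃ n, 1 ≤ n ∧ t ≤ 𝒯.τ n := ⟨𝒯.N, 𝒯.one_le_N, by rw [𝒯.τ_last]; exact ht.2⟩
  classical
  have hs := Nat.find_spec hex
  refine ⟨Nat.find hex, Finset.mem_Icc.2 ⟨hs.1, Nat.find_min' hex
    ⟨𝒯.one_le_N, by rw [𝒯.τ_last]; exact ht.2⟩⟩, ?_, hs.2⟩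
  by_cases h1 : Nat.find hex = 1
  · rw [h1, 𝒯.τ_zero]; exact ht.1
  · have := Nat.find_min hex (m := Nat.find hex - 1) (by omega)
    rw [not_and] at this
    exact (not_le.1 (this (by omega))).le

lemma Icc_slab_subset {n : ℕ} (hn : n ∈ Finset.Icc 1 𝒯.N) :
    Icc (𝒯.τ (n - 1)) (𝒯.τ n) ⊆ Icc 0 D.T := by
  rw [Finset.mem_Icc] at hn
  exact Icc_subset_Icc (𝒯.τ_mem (by omega)).1 (𝒯.τ_mem hn.2).2

/-- Integrals over `(0, T)` are sums of integrals over the time intervals. -/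
lemma sum_integral_slab {E : Type*} [NormedAddCommGroup E] [NormedSpace ℝ E] {f : ℝ → E}
    (hf : IntegrableOn f (Ioc 0 D.T)) {m n : ℕ} (hmn : m ≤ n) (hn : n ≤ 𝒯.N) :
    ∑ i ∈ Finset.Icc (m + 1) n, ∫ t in (𝒯.τ (i - 1))..(𝒯.τ i), f t
      = ∫ t in (𝒯.τ m)..(𝒯.τ n), f t := by
  have hi : ∀ {a b : ℝ}, a ∈ Icc 0 D.T → b ∈ Icc 0 D.T → IntervalIntegrable f volume a b := by
    intro a b ha hb
    have := (intervalIntegrable_iff_integrableOn_Ioc_of_le D.T_pos.le).2 hf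
    refine this.mono_set ?_
    rw [uIcc_of_le D.T_pos.le]
    exact uIcc_subset_Icc ha hb
  induction n, hmn using Nat.le_induction with
  | base => simp
  | succ n hmn ih =>
    rw [Finset.sum_Icc_succ_top (by omega), ih (by omega), Nat.add_sub_cancel,
      intervalIntegral.integral_add_adjacent_intervals
        (hi (𝒯.τ_mem (by omega)) (𝒯.τ_mem (by omega)))
        (hi (𝒯.τ_mem (by omega)) (𝒯.τ_mem hn))]

section Interp

variable {E F : Type*} [NormedAddCommGroup E] [NormedSpace ℝ E] [NormedAddCommGroup F]
  [NormedSpace ℝ F]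

/-- The hat-function weight of the `n`-th time interval. -/
def slabRamp (n : ℕ) (t : ℝ) : ℝ := ramp (𝒯.τ (n - 1)) (𝒯.τ n) t

/-- Piecewise linear interpolation in time. -/
def interp (Y : ℕ → E) (t : ℝ) : E :=
  Y 0 + ∑ m ∈ Finset.Icc 1 𝒯.N, 𝒯.slabRamp m t • (Y m - Y (m - 1))

/-- On slab `n` all earlier ramps equal 1 and all later ones 0, so the sum of increments telescopes
up to the current slab. -/
lemma interp_of_mem_slab (Y : ℕ → E) {n : ℕ} (hn : n ∈ Finset.Icc 1 𝒯.N) {t : ℝ}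
    (ht : t ∈ Icc (𝒯.τ (n - 1)) (𝒯.τ n)) :
    𝒯.interp Y t = Y (n - 1) + 𝒯.slabRamp n t • (Y n - Y (n - 1)) := by
  have hn' := Finset.mem_Icc.1 hn
  have key : ∀ p ≤ 𝒯.N, ∑ m ∈ Finset.Icc 1 p, 𝒯.slabRamp m t • (Y m - Y (m - 1))
      = if p < n then Y p - Y 0
        else Y (n - 1) - Y 0 + 𝒯.slabRamp n t • (Y n - Y (n - 1)) := by
    intro p
    induction p with
    | zero => intro _; rw [if_pos (by omega)]; simp
    | succ p ih =>
      intro hp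
      have hlt := 𝒯.τ_lt (p + 1) (Finset.mem_Icc.2 ⟨by omega, hp⟩)
      rw [Finset.sum_Icc_succ_top (by omega), ih (by omega)]
      rcases lt_trichotomy (p + 1) n with h | h | h
      · rw [if_pos (by omega), if_pos h, slabRamp, ramp_of_ge hlt
          ((𝒯.τ_mono (show p + 1 ≤ n - 1 by omega) (by omega)).trans ht.1), Nat.add_sub_cancel]
        module
      · rw [if_pos (by omega), if_neg (by omega), ← h, Nat.add_sub_cancel]
      · rw [if_neg (by omega), if_neg (by omega), slabRamp, slabRamp, ramp_of_le hlt
          (ht.2.trans (𝒯.τ_mono (show n ≤ p + 1 - 1 by omega) (by omega))), zero_smul, add_zero]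
  rw [interp, key 𝒯.N le_rfl, if_neg (by omega)]
  module

lemma continuous_slabRamp (n : ℕ) : Continuous (𝒯.slabRamp n) := continuous_ramp _ _

lemma continuous_interp (Y : ℕ → E) : Continuous (𝒯.interp Y) :=
  continuous_const.add (continuous_finsetSum _ fun m _ =>
    (𝒯.continuous_slabRamp m).smul continuous_const)

lemma memH1Time_interp [CompleteSpace E] (Y : ℕ → E) : MemH1Time D.T univ (𝒯.interp Y) := by
  refine ⟨fun _ _ => mem_univ _,
    fun t => ∑ m ∈ Finset.Icc 1 𝒯.N, deriv (𝒯.slabRamp m) t • (Y m - Y (m - 1)), ?_, ?_⟩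
  · refine memLp_finsetSum _ fun m _ => ?_
    exact (ContinuousLinearMap.toSpanSingleton ℝ (Y m - Y (m - 1))).comp_memLp'
      (memLp_deriv_ramp _ _ _)
  · intro t ht
    have hi : ∀ m, IntervalIntegrable (fun s => deriv (𝒯.slabRamp m) s • (Y m - Y (m - 1)))
        volume 0 t := fun m =>
      (intervalIntegrable_iff_integrableOn_Ioc_of_le ht.1).2
        (((memLp_deriv_ramp _ _ t).integrable one_le_two).smul_const _)
    rw [intervalIntegral.integral_finsetSum fun m _ => hi m]
    simp only [interp, intervalIntegral.integral_smul_const]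
    have e : ∀ m, ∫ s in (0 : ℝ)..t, deriv (𝒯.slabRamp m) s
        = 𝒯.slabRamp m t - 𝒯.slabRamp m 0 := fun m => integral_deriv_ramp _ _ _
    simp only [e, add_assoc, ← Finset.sum_add_distrib, ← add_smul]
    congr 1
    refine Finset.sum_congr rfl fun m _ => ?_
    congr 1
    ring

end Interp

end Mesh

/-! ### Linearity of the boundary stress. -/

section BoundaryStress

variable {d : ℕ} {D : Data d} {w w' : Vec d → Vec d} {x : Vec d}

lemma Data.bdryStress_congr (hx : x ∈ closure D.Ω) (h : EqOn w w' (closure D.Ω)) :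
    D.bdryStress w x = D.bdryStress w' x := by
  rw [Data.bdryStress, Data.bdryStress, fderivWithin_congr h (h hx)]

lemma Data.bdryStress_add_smul (hu : UniqueDiffWithinAt ℝ (closure D.Ω) x)
    (hw : DifferentiableWithinAt ℝ w (closure D.Ω) x)
    (hw' : DifferentiableWithinAt ℝ w' (closure D.Ω) x) (c : ℝ) :
    D.bdryStress (fun x => w x + c • (w' x - w x)) x
      = D.bdryStress w x + c • (D.bdryStress w' x - D.bdryStress w x) := by
  have h : fderivWithin ℝ (fun x => w x + c • (w' x - w x)) (closure D.Ω) x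
      = fderivWithin ℝ w (closure D.Ω) x + c • (fderivWithin ℝ w' (closure D.Ω) x
        + (-1 : ℝ) • fderivWithin ℝ w (closure D.Ω) x) := by
    have e : fderivWithin ℝ w' (closure D.Ω) x + (-1 : ℝ) • fderivWithin ℝ w (closure D.Ω) x
        = fderivWithin ℝ w' (closure D.Ω) x - fderivWithin ℝ w (closure D.Ω) x := by
      ext; simp [sub_eq_add_neg]
    rw [e]
    exact (hw.hasFDerivWithinAt.add
      ((hw'.hasFDerivWithinAt.sub hw.hasFDerivWithinAt).const_smul c)).fderivWithin hu
  simp only [Data.bdryStress, h, normalStress_add_left, normalStress_smul_left]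
  module

end BoundaryStress

/-! ### Trial functions as interpolants of their nodal values. -/

section Trial

variable {d : ℕ} {D : Data d} {𝒯 : Mesh D} {U : ℝ → Vec d → Vec d}

lemma MemFE.isPL {M : Finset (Set (Vec d))} {w : Vec d → Vec d} (h : MemFE D M w) :
    IsPL D.Ω M w := ⟨h.continuousOn, h.affine⟩

namespace Mesh

lemma bar_of_mem {n : ℕ} (hn : n ∈ Finset.Icc 1 𝒯.N) {m : ℕ} (hm : m = n - 1 ∨ m = n)
    (hU : 𝒯.MemTrial U) : IsPL D.Ω (𝒯.bar n) (U (𝒯.τ m)) := by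
  have hn' := Finset.mem_Icc.1 hn
  rcases hm with rfl | rfl
  · exact (hU.node (n - 1) (by omega)).isPL.refine (𝒯.bar_left n hn)
  · exact (hU.node m hn'.2).isPL.refine (𝒯.bar_right m hn)

namespace MemTrial

variable (hU : 𝒯.MemTrial U)
include hU

lemma eq_interp {t : ℝ} (ht : t ∈ Icc 0 D.T) {x : Vec d} (hx : x ∈ closure D.Ω) :
    U t x = 𝒯.interp (fun n => U (𝒯.τ n) x) t := by
  obtain ⟨n, hn, htn⟩ := 𝒯.exists_slab ht
  have hlt := 𝒯.τ_lt n hn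
  obtain ⟨b, c, hbc⟩ := hU.linear n hn x hx
  rw [𝒯.interp_of_mem_slab _ hn htn, slabRamp, ramp_of_mem hlt htn, hbc t htn,
    hbc _ ⟨le_rfl, hlt.le⟩, hbc _ ⟨hlt.le, le_rfl⟩, add_sub_add_left_eq_sub, ← sub_smul, smul_smul,
    div_mul_cancel₀ _ (sub_pos.2 hlt).ne', add_assoc, ← add_smul]
  congr 2
  ring

/-- On a time interval the trial function interpolates linearly between its end values. -/
lemma eqOn_slab {n : ℕ} (hn : n ∈ Finset.Icc 1 𝒯.N) {t : ℝ}
    (ht : t ∈ Icc (𝒯.τ (n - 1)) (𝒯.τ n)) :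
    EqOn (U t) (fun x => U (𝒯.τ (n - 1)) x
      + 𝒯.slabRamp n t • (U (𝒯.τ n) x - U (𝒯.τ (n - 1)) x)) (closure D.Ω) := by
  intro x hx
  rw [hU.eq_interp (𝒯.Icc_slab_subset hn ht) hx, 𝒯.interp_of_mem_slab _ hn ht]

/-- Both end values of a slab are piecewise linear over the common refinement `bar n`, and there
`toPair` is linear. Consequently the curve `t ↦ toPair (U t)` is determined by finitely many
vectors. -/
lemma toPair_eq {t : ℝ} (ht : t ∈ Icc 0 D.T) :
    toPair D.Ω (U t) = 𝒯.interp (fun n => toPair D.Ω (U (𝒯.τ n))) t := by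
  obtain ⟨n, hn, htn⟩ := 𝒯.exists_slab ht
  have hM := 𝒯.bar_tri n hn
  have h0 := bar_of_mem hn (Or.inl rfl) hU
  have h1 := bar_of_mem hn (Or.inr rfl) hU
  have hb := D.domain.bounded
  rw [𝒯.interp_of_mem_slab _ hn htn,
    toPair_congr D.domain.isOpen ((hU.eqOn_slab hn htn).mono subset_closure),
    h0.toPair_add_smul (h1.sub h0) hM hb]
  congr 2
  have e := h1.toPair_add_smul h0 hM hb (-1)
  simp only [neg_smul, one_smul, ← sub_eq_add_neg] at e
  exact e

/-- The exceptional set does not depend on `t`: it suffices that the finitely many nodal fields have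
a one-sided gradient at `x`. -/
lemma bdryStress_eq (hd : 1 ≤ d) : ∀ᵐ x ∂surf d, x ∈ frontier D.Ω → ∀ t ∈ Icc 0 D.T,
    D.bdryStress (U t) x = 𝒯.interp (fun n => D.bdryStress (U (𝒯.τ n)) x) t := by
  have hae : ∀ᵐ x ∂surf d, ∀ n, n ≤ 𝒯.N → x ∈ frontier D.Ω →
      DifferentiableWithinAt ℝ (U (𝒯.τ n)) (closure D.Ω) x ∧
        UniqueDiffWithinAt ℝ (closure D.Ω) x := by
    rw [ae_all_iff]
    intro n
    by_cases hn : n ≤ 𝒯.N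
    · filter_upwards [(hU.node n hn).isPL.ae_differentiableWithinAt hd (𝒯.mesh_tri n hn)]
        with x hx _ using hx
    · exact Eventually.of_forall fun x h => absurd h hn
  filter_upwards [hae] with x hx hxΩ t ht
  obtain ⟨n, hn, htn⟩ := 𝒯.exists_slab ht
  have hn' := Finset.mem_Icc.1 hn
  have h0 := hx (n - 1) (by omega) hxΩ
  have h1 := hx n hn'.2 hxΩ
  rw [𝒯.interp_of_mem_slab _ hn htn,
    Data.bdryStress_congr (frontier_subset_closure hxΩ) (hU.eqOn_slab hn htn),
    Data.bdryStress_add_smul h0.2 h0.1 h1.1]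

lemma coeFn_stressLp (hd : 1 ≤ d) {n : ℕ} (hn : n ≤ 𝒯.N) :
    D.stressLp (U (𝒯.τ n)) =ᵐ[(surf d).restrict D.ΓN] D.bdryStress (U (𝒯.τ n)) :=
  (hU.node n hn).isPL.coeFn_stressLp hd (𝒯.mesh_tri n hn)

end MemTrial

section Comb

variable {E F : Type*} [NormedAddCommGroup E] [NormedSpace ℝ E] [NormedAddCommGroup F]
  [NormedSpace ℝ F]

/-- A linear combination of an initial value and of the increments of a sequence. -/
def comb (𝒯 : Mesh D) (c₀ : ℝ) (c : ℕ → ℝ) (Y : ℕ → E) : E :=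
  c₀ • Y 0 + ∑ m ∈ Finset.Icc 1 𝒯.N, c m • (Y m - Y (m - 1))

lemma interp_eq_comb (Y : ℕ → E) (t : ℝ) :
    𝒯.interp Y t = 𝒯.comb 1 (fun m => 𝒯.slabRamp m t) Y := by
  rw [interp, comb, one_smul]

/-- An `Lp`-valued time integral cannot in general be evaluated at a point of space. For
interpolants such an integral is a finite combination of nodal values, and evaluation commutes with
it off one null set. -/
lemma coeFn_comb {α : Type*} [MeasurableSpace α] {μ : Measure α} (c₀ : ℝ) (c : ℕ → ℝ)
    (Y : ℕ → Lp E 2 μ) : ⇑(𝒯.comb c₀ c Y) =ᵐ[μ] fun x => 𝒯.comb c₀ c fun n => Y n x := by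
  have key : ∀ s : Finset ℕ, ⇑(∑ m ∈ s, c m • (Y m - Y (m - 1)))
      =ᵐ[μ] fun x => ∑ m ∈ s, c m • (Y m x - Y (m - 1) x) := by
    intro s
    induction s using Finset.induction_on with
    | empty =>
      simp only [Finset.sum_empty]
      exact Lp.coeFn_zero _ _ _
    | insert m s hm ih =>
      rw [Finset.sum_insert hm]
      filter_upwards [Lp.coeFn_add (c m • (Y m - Y (m - 1))) (∑ m ∈ s, c m • (Y m - Y (m - 1))),
        Lp.coeFn_smul (c m) (Y m - Y (m - 1)), Lp.coeFn_sub (Y m) (Y (m - 1)), ih]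
        with x h1 h2 h3 h4
      rw [h1, Pi.add_apply, h2, Pi.smul_apply, h3, Pi.sub_apply, h4, Finset.sum_insert hm]
  filter_upwards [key (Finset.Icc 1 𝒯.N), Lp.coeFn_smul c₀ (Y 0), Lp.coeFn_add (c₀ • Y 0)
    (∑ m ∈ Finset.Icc 1 𝒯.N, c m • (Y m - Y (m - 1)))] with x h1 h2 h3
  rw [comb, h3, Pi.add_apply, h2, Pi.smul_apply, h1, comb]

/-- The convolution of an interpolant. -/
lemma integral_smul_interp [CompleteSpace E] (Y : ℕ → E) {κ : ℝ → ℝ} {R : Set ℝ}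
    (hR : Bornology.IsBounded R) (hκ : IntegrableOn κ R) :
    ∫ s in R, κ s • 𝒯.interp Y s
      = 𝒯.comb (∫ s in R, κ s) (fun m => ∫ s in R, κ s * 𝒯.slabRamp m s) Y := by
  have hi : ∀ m, IntegrableOn (fun s => κ s * 𝒯.slabRamp m s) R := by
    intro m
    obtain ⟨C, hC⟩ := hR.isCompact_closure.exists_bound_of_continuousOn
      (𝒯.continuous_slabRamp m).continuousOn
    refine Integrable.mul_bdd (c := C) hκ (𝒯.continuous_slabRamp m).aestronglyMeasurable ?_
    refine ae_restrict_of_ae_restrict_of_subset subset_closure ?_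
    exact (ae_restrict_iff' isClosed_closure.measurableSet).2 (Eventually.of_forall hC)
  simp only [interp, smul_add, Finset.smul_sum, smul_smul]
  rw [integral_add (hκ.smul_const _) (integrable_finsetSum _ fun m _ => (hi m).smul_const _),
    integral_finsetSum _ fun m _ => (hi m).smul_const _, integral_smul_const]
  simp only [integral_smul_const]
  rfl

end Comb

end Mesh

end Trial

/-! ### Extension of the kernel by zero. -/

section Memory

variable {d : ℕ} (D : Data d) {E : Type*} [NormedAddCommGroup E] [NormedSpace ℝ E]

/-- The memory kernel extended by zero. -/
def Data.k (t : ℝ) : ℝ := (Ioi 0).indicator D.ker t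

lemma Data.integrable_k : Integrable D.k := D.ker_integrable.integrable_indicator measurableSet_Ioi

/-- The extended kernel vanishes for `s ≥ t`, so causality is encoded in `k` and all convolutions
run over fixed intervals. Its time-reversed counterpart is `integral_ker_right`. -/
lemma Data.integral_ker_left {a b t : ℝ} (hab : a ≤ b) (hat : a ≤ t) (f : ℝ → E) :
    ∫ s in a..(min b t), D.ker (t - s) • f s = ∫ s in Ioc a b, D.k (t - s) • f s := by
  have e : (fun s => D.k (t - s) • f s) = (Iio t).indicator fun s => D.ker (t - s) • f s := by
    ext s
    by_cases hs : s < t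
    · rw [indicator_of_mem (show s ∈ Iio t from hs), Data.k,
        indicator_of_mem (show t - s ∈ Ioi 0 from sub_pos.2 hs)]
    · rw [indicator_of_notMem (show s ∉ Iio t from hs), Data.k,
        indicator_of_notMem (show t - s ∉ Ioi 0 from fun h => hs (sub_pos.1 h)), zero_smul]
  rw [e, setIntegral_indicator measurableSet_Iio,
    intervalIntegral.integral_of_le (le_min hab hat), ← Ioc_inter_Iic]
  exact setIntegral_congr_set ((ae_eq_refl _).inter Iio_ae_eq_Iic).symm

lemma Data.integral_ker_right {a b t : ℝ} (hab : a ≤ b) (htb : t ≤ b) (f : ℝ → E) :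
    ∫ s in (max a t)..b, D.ker (s - t) • f s = ∫ s in Ioc a b, D.k (s - t) • f s := by
  have e : (fun s => D.k (s - t) • f s) = (Ioi t).indicator fun s => D.ker (s - t) • f s := by
    ext s
    by_cases hs : t < s
    · rw [indicator_of_mem (show s ∈ Ioi t from hs), Data.k,
        indicator_of_mem (show s - t ∈ Ioi 0 from sub_pos.2 hs)]
    · rw [indicator_of_notMem (show s ∉ Ioi t from hs), Data.k,
        indicator_of_notMem (show s - t ∉ Ioi 0 from fun h => hs (sub_pos.1 h)), zero_smul]
  rw [e, setIntegral_indicator measurableSet_Ioi,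
    intervalIntegral.integral_of_le (max_le hab htb), Ioc_inter_Ioi]

lemma Data.integral_ker_zero {t : ℝ} (ht : t ∈ Icc 0 D.T) (f : ℝ → E) :
    ∫ s in (0 : ℝ)..t, D.ker (t - s) • f s = ∫ s in Ioc 0 D.T, D.k (t - s) • f s := by
  have := D.integral_ker_left D.T_pos.le ht.1 f
  rwa [min_eq_right ht.2] at this

lemma Data.integral_ker_T {t : ℝ} (ht : t ∈ Icc 0 D.T) (f : ℝ → E) :
    ∫ s in t..D.T, D.ker (s - t) • f s = ∫ s in Ioc 0 D.T, D.k (s - t) • f s := by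
  have := D.integral_ker_right D.T_pos.le ht.2 f
  rwa [max_eq_right ht.1] at this

end Memory

/-! ### The residual of the Neumann condition. -/

section NeumannResidual

variable {d : ℕ} {D : Data d} {𝒯 : Mesh D} {U : ℝ → Vec d → Vec d} {M : Finset (Set (Vec d))}
  {K : Set (Vec d)} {S : Set (Vec d)} {T : Pair D.Ω →L[ℝ] Lp (Vec d) 2 ((surf d).restrict S)}

/-- The boundary stress of a trial function, as an `L²(Γ_N)`-valued function of time. -/
def Mesh.bdryStressLp (𝒯 : Mesh D) (U : ℝ → Vec d → Vec d) (t : ℝ) :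
    Lp (Vec d) 2 ((surf d).restrict D.ΓN) := 𝒯.interp (fun n => D.stressLp (U (𝒯.τ n))) t

/-- The residual of the Neumann condition in `L²(Γ_N)`. -/
def Mesh.neumannResidual (𝒯 : Mesh D) (U : ℝ → Vec d → Vec d) (t : ℝ) :
    Lp (Vec d) 2 ((surf d).restrict D.ΓN) :=
  𝒯.bdryStressLp U t - (∫ s in Ioc 0 D.T, D.k (t - s) • 𝒯.bdryStressLp U s) - D.gN t

/-- `gd` convolves pointwise in space and uses the cell normal; `neumannResidual` convolves in
`L²(Γ_N)` and uses the normal of the domain. Both convolutions reduce to the same combination of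
nodal stresses, and the two normals agree almost everywhere. -/
lemma Mesh.MemTrial.gd_sub_eq (hd : 1 ≤ d) (hU : 𝒯.MemTrial U) (hM : IsTriangulation D.Ω M)
    {t : ℝ} (ht : t ∈ Icc 0 D.T) :
    ∀ᵐ x ∂(surf d).restrict D.ΓN, ∀ K ∈ M, x ∈ K →
      D.gd U K t x - D.g t x = 𝒯.neumannResidual U t x := by
  have hk : IntegrableOn (fun s => D.k (t - s)) (Ioc 0 D.T) :=
    (D.integrable_k.comp_sub_left t).integrableOn
  have hb : Bornology.IsBounded (Ioc 0 D.T) := Metric.isBounded_Ioc _ _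
  let Y : ℕ → Lp (Vec d) 2 ((surf d).restrict D.ΓN) := fun n => D.stressLp (U (𝒯.τ n))
  have hY : ∀ᵐ x ∂(surf d).restrict D.ΓN, ∀ n ≤ 𝒯.N, Y n x = D.bdryStress (U (𝒯.τ n)) x := by
    rw [ae_all_iff]
    intro n
    by_cases hn : n ≤ 𝒯.N
    · filter_upwards [hU.coeFn_stressLp hd hn] with x hx _ using hx
    · exact Eventually.of_forall fun x h => absurd h hn
  have hcomb : ∀ c₀ c, ∀ᵐ x ∂(surf d).restrict D.ΓN, (𝒯.comb c₀ c Y : Lp (Vec d) 2 _) x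
      = 𝒯.comb c₀ c fun n => D.bdryStress (U (𝒯.τ n)) x := by
    intro c₀ c
    filter_upwards [Mesh.coeFn_comb (𝒯 := 𝒯) c₀ c Y, hY] with x h1 h2
    rw [h1, Mesh.comb, Mesh.comb, h2 0 (Nat.zero_le _)]
    congr 1
    refine Finset.sum_congr rfl fun m hm => ?_
    rw [Finset.mem_Icc] at hm
    rw [h2 m hm.2, h2 (m - 1) (by omega)]
  have hres : 𝒯.neumannResidual U t = 𝒯.comb 1 (fun m => 𝒯.slabRamp m t) Y
      - 𝒯.comb (∫ s in Ioc 0 D.T, D.k (t - s))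
        (fun m => ∫ s in Ioc 0 D.T, D.k (t - s) * 𝒯.slabRamp m s) Y - D.gN t := by
    rw [Mesh.neumannResidual]
    simp only [Mesh.bdryStressLp]
    rw [Mesh.integral_smul_interp Y hb hk, Mesh.interp_eq_comb]
  rw [hres]
  filter_upwards [hcomb 1 fun m => 𝒯.slabRamp m t, hcomb (∫ s in Ioc 0 D.T, D.k (t - s))
      (fun m => ∫ s in Ioc 0 D.T, D.k (t - s) * 𝒯.slabRamp m s),
    Lp.coeFn_sub (𝒯.comb 1 (fun m => 𝒯.slabRamp m t) Y
      - 𝒯.comb (∫ s in Ioc 0 D.T, D.k (t - s))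
        (fun m => ∫ s in Ioc 0 D.T, D.k (t - s) * 𝒯.slabRamp m s) Y) (D.gN t),
    Lp.coeFn_sub (𝒯.comb 1 (fun m => 𝒯.slabRamp m t) Y)
      (𝒯.comb (∫ s in Ioc 0 D.T, D.k (t - s))
        (fun m => ∫ s in Ioc 0 D.T, D.k (t - s) * 𝒯.slabRamp m s) Y),
    ae_restrict_of_ae (hU.bdryStress_eq hd), ae_restrict_of_ae (hM.ae_outwardNormal_eq_normal hd),
    ae_restrict_mem D.measurableSet_ΓN] with x h1 h2 h3 h4 h5 h6 hx K hK hxK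
  have hxΩ := D.ΓN_subset hx
  rw [h3, Pi.sub_apply, h4, Pi.sub_apply, h1, h2, Data.gd, if_pos hx, h6 hxΩ K hK hxK]
  change D.bdryStress (U t) x - (∫ s in (0 : ℝ)..t, D.ker (t - s) • D.bdryStress (U s) x)
    - D.gN t x = _
  congr 2
  · rw [h5 hxΩ t ht, Mesh.interp_eq_comb]
  · rw [D.integral_ker_zero ht, ← Mesh.integral_smul_interp _ hb hk]
    refine setIntegral_congr_fun measurableSet_Ioc fun s hs => ?_
    rw [h5 hxΩ s (Ioc_subset_Icc_self hs)]

lemma Mesh.MemTrial.bdryPair_gd (hd : 1 ≤ d) (hU : 𝒯.MemTrial U) (hM : IsTriangulation D.Ω M)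
    (hT : IsTraceOperator D.domain.bounded S T) (hK : K ∈ M) (hKS : frontier K ⊆ S)
    (h1 : (surf d).restrict (frontier K ∩ D.ΓN) ≤ (surf d).restrict D.ΓN)
    (h2 : (surf d).restrict (frontier K ∩ D.ΓN) ≤ (surf d).restrict S)
    {t : ℝ} (ht : t ∈ Icc 0 D.T) {q : Pair D.Ω} (hq : q ∈ H1closure D.domain.bounded) :
    D.bdryPair K (fun x => D.gd U K t x - D.ΓN.indicator (D.g t) x) q
      = overlapPair h1 h2 (𝒯.neumannResidual U t) (T q) := by
  have e : ∀ x, inner ℝ (D.gd U K t x - D.ΓN.indicator (D.g t) x) (T q x)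
      = D.ΓN.indicator (fun x => inner ℝ (D.gd U K t x - D.g t x) (T q x)) x := by
    intro x
    by_cases hx : x ∈ D.ΓN
    · rw [indicator_of_mem hx, indicator_of_mem hx]
    · rw [indicator_of_notMem hx, indicator_of_notMem hx, Data.gd, if_neg hx, sub_zero,
        inner_zero_left]
  rw [hT.bdryPair_eq hKS _ hq, overlapPair_apply]
  simp_rw [e]
  rw [setIntegral_indicator D.measurableSet_ΓN]
  refine integral_congr_ae ?_
  filter_upwards [h1.absolutelyContinuous.ae_le (hU.gd_sub_eq hd hM ht),
    ae_restrict_mem (isClosed_frontier.measurableSet.inter D.measurableSet_ΓN)] with x hx hx'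
  rw [hx K hK (hM.mem_of_mem_frontier hK hx'.1)]

lemma Mesh.MemTrial.sum_bdryPair_gd (hd : 1 ≤ d) (hU : 𝒯.MemTrial U) (hM : IsTriangulation D.Ω M)
    (hT : IsTraceOperator D.domain.bounded S T) (hMS : ∀ K ∈ M, frontier K ⊆ S)
    (hΓ : (surf d).restrict D.ΓN ≤ (surf d).restrict S)
    {t : ℝ} (ht : t ∈ Icc 0 D.T) {q : Pair D.Ω} (hq : q ∈ H1closure D.domain.bounded) :
    ∑ K ∈ M, D.bdryPair K (fun x => D.gd U K t x - D.ΓN.indicator (D.g t) x) q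
      = overlapPair le_rfl hΓ (𝒯.neumannResidual U t) (T q) := by
  have h1 : ∀ K, (surf d).restrict (frontier K ∩ D.ΓN) ≤ (surf d).restrict D.ΓN := fun K =>
    Measure.restrict_mono_set _ inter_subset_right
  rw [Finset.sum_congr rfl fun K hK => hU.bdryPair_gd hd hM hT hK (hMS K hK) (h1 K)
    ((h1 K).trans hΓ) ht hq]
  simp_rw [overlapPair_apply]
  exact hM.sum_integral_ΓN hd (integrable_inner_of_le le_rfl hΓ _ _)

end NeumannResidual

/-! ### The jump residual as a functional of the test field. -/

section JumpFunctional

variable {d : ℕ} {D : Data d} {𝒯 : Mesh D} {U : ℝ → Vec d → Vec d} {M : Finset (Set (Vec d))}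
  {K : Set (Vec d)} {S : Set (Vec d)} {T : Pair D.Ω →L[ℝ] Lp (Vec d) 2 ((surf d).restrict S)}
  {w w' : Vec d → Vec d}

open Classical in
/-- The functional `q ↦ (r_d, q)_{∂K}`. -/
def Data.jumpL (D : Data d) {S : Set (Vec d)}
    (T : Pair D.Ω →L[ℝ] Lp (Vec d) 2 ((surf d).restrict S)) (M : Finset (Set (Vec d)))
    (w : Vec d → Vec d) (K : Set (Vec d)) : Pair D.Ω →L[ℝ] ℝ :=
  if h : MemLp (D.rd M w K) 2 ((surf d).restrict (frontier K)) ∧ frontier K ⊆ S then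
    (overlapPair le_rfl (Measure.restrict_mono_set (surf d) h.2) (h.1.toLp _)).comp T else 0

lemma IsPL.jumpL_apply (hd : 1 ≤ d) (hM : IsTriangulation D.Ω M) (h : IsPL D.Ω M w) (hK : K ∈ M)
    (hKS : frontier K ⊆ S) (q : Pair D.Ω) :
    D.jumpL T M w K q = ∫ x in frontier K, inner ℝ (D.rd M w K x) (T q x) ∂surf d ∧
      IntegrableOn (fun x => inner ℝ (D.rd M w K x) (T q x)) (frontier K) (surf d) := by
  have hm := h.rd_memLp hd hM hK
  have hex : MemLp (D.rd M w K) 2 ((surf d).restrict (frontier K)) ∧ frontier K ⊆ S := ⟨hm, hKS⟩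
  have hae : (fun x => inner ℝ (hm.toLp _ x) (T q x))
      =ᵐ[(surf d).restrict (frontier K)] fun x => inner ℝ (D.rd M w K x) (T q x) := by
    filter_upwards [hm.coeFn_toLp] with x hx
    rw [hx]
  rw [Data.jumpL, dif_pos hex]
  refine ⟨?_, ?_⟩
  · exact (overlapPair_apply le_rfl _ (hm.toLp _) (T q)).trans (integral_congr_ae hae)
  · exact (integrable_inner_of_le le_rfl (Measure.restrict_mono_set (surf d) hKS) (hm.toLp _)
      (T q)).congr hae

/-- On a slab the residual is spanned by those of the starting value and of the increment. The two
coefficients cover both the residual at one time and its convolution over the slab. -/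
lemma IsTraceOperator.bdryPair_eq_jumpL (hd : 1 ≤ d) (hT : IsTraceOperator D.domain.bounded S T)
    (hM : IsTriangulation D.Ω M) (h : IsPL D.Ω M w) (h' : IsPL D.Ω M w') (hK : K ∈ M)
    (hKS : frontier K ⊆ S) {α β : ℝ} {r : Vec d → Vec d}
    (hr : ∀ x ∈ K, r x = α • D.rd M w K x + β • D.rd M w' K x) {q : Pair D.Ω}
    (hq : q ∈ H1closure D.domain.bounded) :
    D.bdryPair K r q = α * D.jumpL T M w K q + β * D.jumpL T M w' K q := by
  obtain ⟨e1, i1⟩ := h.jumpL_apply hd hM hK hKS (T := T) q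
  obtain ⟨e2, i2⟩ := h'.jumpL_apply hd hM hK hKS (T := T) q
  rw [hT.bdryPair_eq hKS _ hq, e1, e2, ← integral_const_mul, ← integral_const_mul,
    ← integral_add (i1.const_mul _) (i2.const_mul _)]
  refine setIntegral_congr_fun isClosed_frontier.measurableSet fun x hx => ?_
  rw [hr x (hM.mem_of_mem_frontier hK hx), inner_add_left, real_inner_smul_left,
    real_inner_smul_left]

/-- The increment of a trial function over a time interval. -/
def Mesh.increment (𝒯 : Mesh D) (U : ℝ → Vec d → Vec d) (n : ℕ) (x : Vec d) : Vec d :=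
  U (𝒯.τ n) x - U (𝒯.τ (n - 1)) x

/-- The functional `q ↦ (r_d(t), q)_{∂K}` for `t` in the `n`-th time interval. -/
def Mesh.slabJump (𝒯 : Mesh D) {S : Set (Vec d)}
    (T : Pair D.Ω →L[ℝ] Lp (Vec d) 2 ((surf d).restrict S)) (M : Finset (Set (Vec d)))
    (U : ℝ → Vec d → Vec d) (n : ℕ) (K : Set (Vec d)) (t : ℝ) : Pair D.Ω →L[ℝ] ℝ :=
  D.jumpL T M (U (𝒯.τ (n - 1))) K + 𝒯.slabRamp n t • D.jumpL T M (𝒯.increment U n) K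

lemma Mesh.continuous_slabJump (n : ℕ) : Continuous (𝒯.slabJump T M U n K) :=
  continuous_const.add ((𝒯.continuous_slabRamp n).smul continuous_const)

variable {n : ℕ}

lemma Mesh.MemTrial.rd_slab (hU : 𝒯.MemTrial U) (hM : IsTriangulation D.Ω M)
    (hn : n ∈ Finset.Icc 1 𝒯.N) (h₀ : IsPL D.Ω M (U (𝒯.τ (n - 1))))
    (h₁ : IsPL D.Ω M (U (𝒯.τ n))) (hK : K ∈ M) {t : ℝ} (ht : t ∈ Icc (𝒯.τ (n - 1)) (𝒯.τ n))
    {x : Vec d} (hx : x ∈ K) :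
    D.rd M (U t) K x = D.rd M (U (𝒯.τ (n - 1))) K x
      + 𝒯.slabRamp n t • D.rd M (𝒯.increment U n) K x := by
  rw [Data.rd_congr hM (hU.eqOn_slab hn ht) hK hx]
  exact h₀.rd_add_smul hM (h₁.sub h₀) _ hK hx

lemma Mesh.MemTrial.bdryPair_rd (hd : 1 ≤ d) (hT : IsTraceOperator D.domain.bounded S T)
    (hU : 𝒯.MemTrial U) (hM : IsTriangulation D.Ω M)
    (hn : n ∈ Finset.Icc 1 𝒯.N) (h₀ : IsPL D.Ω M (U (𝒯.τ (n - 1))))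
    (h₁ : IsPL D.Ω M (U (𝒯.τ n))) (hK : K ∈ M) (hKS : frontier K ⊆ S) {t : ℝ}
    (ht : t ∈ Icc (𝒯.τ (n - 1)) (𝒯.τ n)) {q : Pair D.Ω} (hq : q ∈ H1closure D.domain.bounded) :
    D.bdryPair K (D.rd M (U t) K) q = 𝒯.slabJump T M U n K t q := by
  rw [hT.bdryPair_eq_jumpL hd hM h₀ (h₁.sub h₀) hK hKS (α := 1) (β := 𝒯.slabRamp n t) _ hq,
    one_mul]
  · rfl
  · intro x hx
    rw [hU.rd_slab hM hn h₀ h₁ hK ht hx, one_smul]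
    rfl

/-- Only the scalar ramp depends on time, so the integral over the slab yields two numbers
multiplying fixed residuals. The order of the time and surface integrals is thus exchanged by
linearity alone. -/
lemma Mesh.MemTrial.bdryPair_conv_rd (hd : 1 ≤ d) (hT : IsTraceOperator D.domain.bounded S T)
    (hU : 𝒯.MemTrial U) (hM : IsTriangulation D.Ω M)
    (hn : n ∈ Finset.Icc 1 𝒯.N) (h₀ : IsPL D.Ω M (U (𝒯.τ (n - 1))))
    (h₁ : IsPL D.Ω M (U (𝒯.τ n))) (hK : K ∈ M) (hKS : frontier K ⊆ S) {κ : ℝ → ℝ}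
    (hκ : IntegrableOn κ (Ioc (𝒯.τ (n - 1)) (𝒯.τ n))) {q : Pair D.Ω}
    (hq : q ∈ H1closure D.domain.bounded) :
    D.bdryPair K (fun x => ∫ s in Ioc (𝒯.τ (n - 1)) (𝒯.τ n), κ s • D.rd M (U s) K x) q
      = ∫ s in Ioc (𝒯.τ (n - 1)) (𝒯.τ n), κ s • 𝒯.slabJump T M U n K s q := by
  have hr : IntegrableOn (fun s => κ s * 𝒯.slabRamp n s) (Ioc (𝒯.τ (n - 1)) (𝒯.τ n)) :=
    (BddMeas.of_continuousOn (𝒯.continuous_slabRamp n).continuousOn).bilin_integrable hκ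
      (ContinuousLinearMap.mul ℝ ℝ)
  rw [hT.bdryPair_eq_jumpL hd hM h₀ (h₁.sub h₀) hK hKS
    (α := ∫ s in Ioc (𝒯.τ (n - 1)) (𝒯.τ n), κ s)
    (β := ∫ s in Ioc (𝒯.τ (n - 1)) (𝒯.τ n), κ s * 𝒯.slabRamp n s) _ hq]
  · rw [← integral_mul_const, ← integral_mul_const, ← integral_add (hκ.mul_const _)
      (hr.mul_const _)]
    refine integral_congr_ae (Eventually.of_forall fun s => ?_)
    simp only [Mesh.slabJump, _root_.add_apply, _root_.smul_apply, smul_eq_mul]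
    change _ = κ s * (_ + _ * D.jumpL T M (fun x => U (𝒯.τ n) x - U (𝒯.τ (n - 1)) x) K q)
    ring
  · intro x hx
    rw [← integral_smul_const, ← integral_smul_const, ← integral_add (hκ.smul_const _)
      (hr.smul_const _)]
    refine setIntegral_congr_fun measurableSet_Ioc fun s hs => ?_
    rw [hU.rd_slab hM hn h₀ h₁ hK (Ioc_subset_Icc_self hs) hx, smul_add, smul_smul]
    rfl

/-- The form `a(U(t), ·)` without the contribution of the boundary stress. -/
def Mesh.jumpForm (𝒯 : Mesh D) {S : Set (Vec d)}
    (T : Pair D.Ω →L[ℝ] Lp (Vec d) 2 ((surf d).restrict S))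
    (hΓ : (surf d).restrict D.ΓN ≤ (surf d).restrict S) (U : ℝ → Vec d → Vec d) (t : ℝ) :
    Pair D.Ω →L[ℝ] ℝ :=
  aFormL D.Ω D.μ₀ D.lam₀ (𝒯.interp (fun n => toPair D.Ω (U (𝒯.τ n))) t)
    - (overlapPair le_rfl hΓ (𝒯.bdryStressLp U t)).comp T

set_option synthInstance.maxHeartbeats 200000 in
lemma Mesh.continuous_jumpForm (hΓ : (surf d).restrict D.ΓN ≤ (surf d).restrict S) :
    Continuous (𝒯.jumpForm T hΓ U) := by
  refine ((aFormL D.Ω D.μ₀ D.lam₀).continuous.comp (𝒯.continuous_interp _)).sub ?_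
  exact ((overlapPair le_rfl hΓ).continuous.comp (𝒯.continuous_interp _)).clm_comp continuous_const

lemma Mesh.MemTrial.coeFn_bdryStressLp (hd : 1 ≤ d) (hU : 𝒯.MemTrial U) {t : ℝ}
    (ht : t ∈ Icc 0 D.T) :
    𝒯.bdryStressLp U t =ᵐ[(surf d).restrict D.ΓN] D.bdryStress (U t) := by
  have hY : ∀ᵐ x ∂(surf d).restrict D.ΓN, ∀ n ≤ 𝒯.N,
      D.stressLp (U (𝒯.τ n)) x = D.bdryStress (U (𝒯.τ n)) x := by
    rw [ae_all_iff]
    intro n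
    by_cases hn : n ≤ 𝒯.N
    · filter_upwards [hU.coeFn_stressLp hd hn] with x hx _ using hx
    · exact Eventually.of_forall fun x h => absurd h hn
  rw [Mesh.bdryStressLp, Mesh.interp_eq_comb]
  filter_upwards [Mesh.coeFn_comb (𝒯 := 𝒯) 1 (fun m => 𝒯.slabRamp m t)
      (fun n => D.stressLp (U (𝒯.τ n))), hY, ae_restrict_of_ae (hU.bdryStress_eq hd),
    ae_restrict_mem D.measurableSet_ΓN] with x h1 h2 h3 hx
  rw [h1, h3 (D.ΓN_subset hx) t ht, Mesh.interp_eq_comb, Mesh.comb, Mesh.comb,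
    h2 0 (Nat.zero_le _)]
  congr 1
  refine Finset.sum_congr rfl fun m hm => ?_
  rw [Finset.mem_Icc] at hm
  rw [h2 m hm.2, h2 (m - 1) (by omega)]

/-- The jump residuals of all cells add up to `jumpForm`. -/
lemma Mesh.MemTrial.sum_slabJump (hd : 1 ≤ d) (hT : IsTraceOperator D.domain.bounded S T)
    (hΓ : (surf d).restrict D.ΓN ≤ (surf d).restrict S)
    (hU : 𝒯.MemTrial U) (hM : IsTriangulation D.Ω M) (hMS : ∀ K ∈ M, frontier K ⊆ S)
    (hn : n ∈ Finset.Icc 1 𝒯.N) (h₀ : IsPL D.Ω M (U (𝒯.τ (n - 1))))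
    (h₁ : IsPL D.Ω M (U (𝒯.τ n))) {t : ℝ} (ht : t ∈ Icc (𝒯.τ (n - 1)) (𝒯.τ n))
    {q : Pair D.Ω} (hq : q ∈ D.V) :
    ∑ K ∈ M, 𝒯.slabJump T M U n K t q = 𝒯.jumpForm T hΓ U t q := by
  have ht' := 𝒯.Icc_slab_subset hn ht
  have hq' := VSpace.mem_H1closure D.domain.bounded hq
  have heq := hU.eqOn_slab hn ht
  have hw : IsPL D.Ω M (U t) := by
    have h := h₀.add ((h₁.sub h₀).const_smul (𝒯.slabRamp n t))
    refine ⟨h.continuousOn.congr heq, fun K hK => ?_⟩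
    obtain ⟨A, hA⟩ := h.affine K hK
    exact ⟨A, (heq.mono (hM.subset hK)).trans hA⟩
  -- Neither `a` nor the boundary stress refers to `M`, so the sum of the jump terms is the same for
  -- every triangulation over which the end values are piecewise linear.
  have key := hw.a_eq hd hM hT hMS hΓ hq
  have hs : D.stressLp (U t) = 𝒯.bdryStressLp U t :=
    Lp.ext ((hw.coeFn_stressLp hd hM).trans (hU.coeFn_bdryStressLp hd ht').symm)
  rw [hs, hU.toPair_eq ht', Finset.sum_congr rfl fun K hK =>
    hU.bdryPair_rd hd hT hM hn h₀ h₁ hK (hMS K hK) ht hq'] at key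
  rw [Mesh.jumpForm, _root_.sub_apply, aFormL_apply, ContinuousLinearMap.comp_apply]
  exact eq_sub_of_add_eq key.symm

end JumpFunctional

/-! ### Differences in `V`, and integrals in closed subspaces. -/

section VSpaceSub

variable {d : ℕ} {Ω ΓD : Set (Vec d)} {p q : Pair Ω}

lemma IsH1.sub (hΩ : Bornology.IsBounded Ω) (hp : IsH1 Ω p) (hq : IsH1 Ω q) :
    IsH1 Ω (p - q) := by
  intro φ hφ hc hs y
  have hfin := isFiniteMeasure_restrict hΩ
  have h1 : ∀ p : Pair Ω, Integrable p.1 (volume.restrict Ω) := fun p =>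
    (Lp.memLp p.1).integrable one_le_two
  have h2 : ∀ p : Pair Ω, Integrable p.2 (volume.restrict Ω) := fun p =>
    (Lp.memLp p.2).integrable one_le_two
  have hd : Continuous fun x => fderiv ℝ φ x y :=
    (hφ.continuous_fderiv (by simp)).clm_apply continuous_const
  have hb : ∀ {f : Vec d → ℝ}, Continuous f → ∃ C, ∀ᵐ x ∂volume.restrict Ω, ‖f x‖ ≤ C := by
    intro f hf
    obtain ⟨C, hC⟩ := hΩ.isCompact_closure.exists_bound_of_continuousOn hf.continuousOn
    refine ⟨C, ae_restrict_of_ae_restrict_of_subset subset_closure ?_⟩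
    exact (ae_restrict_iff' isClosed_closure.measurableSet).2 (Eventually.of_forall hC)
  obtain ⟨C, hC⟩ := hb hd
  obtain ⟨C', hC'⟩ := hb hφ.continuous
  have i1 : ∀ p : Pair Ω, Integrable (fun x => fderiv ℝ φ x y • p.1 x) (volume.restrict Ω) :=
    fun p => (h1 p).bdd_smul C hd.aestronglyMeasurable hC
  have i2 : ∀ p : Pair Ω, Integrable (fun x => φ x • p.2 x y) (volume.restrict Ω) :=
    fun p => ((h2 p).apply_continuousLinearMap y).bdd_smul C'
      hφ.continuous.aestronglyMeasurable hC'
  have e1 : ∫ x in Ω, fderiv ℝ φ x y • (p - q).1 x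
      = (∫ x in Ω, fderiv ℝ φ x y • p.1 x) - ∫ x in Ω, fderiv ℝ φ x y • q.1 x := by
    rw [← integral_sub (i1 p) (i1 q)]
    refine integral_congr_ae ?_
    filter_upwards [Lp.coeFn_sub p.1 q.1] with x hx
    rw [Prod.fst_sub, hx, Pi.sub_apply, smul_sub]
  have e2 : ∫ x in Ω, φ x • (p - q).2 x y
      = (∫ x in Ω, φ x • p.2 x y) - ∫ x in Ω, φ x • q.2 x y := by
    rw [← integral_sub (i2 p) (i2 q)]
    refine integral_congr_ae ?_
    filter_upwards [Lp.coeFn_sub p.2 q.2] with x hx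
    rw [Prod.snd_sub, hx, Pi.sub_apply, _root_.sub_apply, smul_sub]
  rw [e1, e2, hp φ hφ hc hs y, hq φ hφ hc hs y]
  abel

lemma IsTrace.sub_zero (hΩ : Bornology.IsBounded Ω) {S : Set (Vec d)} (hp : IsTrace Ω S p 0)
    (hq : IsTrace Ω S q 0) : IsTrace Ω S (p - q) 0 := by
  obtain ⟨h0, φ, hφ, p1, p2, p3⟩ := hp
  obtain ⟨-, ψ, hψ, q1, q2, q3⟩ := hq
  let Φ : ℕ → smoothFields d := fun m => ⟨φ m, hφ m⟩
  let Ψ : ℕ → smoothFields d := fun m => ⟨ψ m, hψ m⟩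
  have h1 := (tendsto_smoothPair_iff hΩ Φ p).2 ⟨p1, p2⟩
  have h2 := (tendsto_smoothPair_iff hΩ Ψ q).2 ⟨q1, q2⟩
  have h3 := h1.sub h2
  simp only [← map_sub] at h3
  obtain ⟨h4, h5⟩ := (tendsto_smoothPair_iff hΩ (fun m => Φ m - Ψ m) (p - q)).1 h3
  refine ⟨h0, fun m => (Φ m - Ψ m).1, fun m => (Φ m - Ψ m).2, h4, h5, ?_⟩
  simp only [Pi.zero_apply, _root_.sub_zero] at p3 q3 ⊢
  have h6 := p3.add q3
  rw [add_zero] at h6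
  refine tendsto_of_tendsto_of_tendsto_of_le_of_le tendsto_const_nhds h6 (fun _ => zero_le)
    fun m => ?_
  exact eLpNorm_sub_le (hφ m).continuous.aestronglyMeasurable
    (hψ m).continuous.aestronglyMeasurable one_le_two

lemma VSpace.sub (hΩ : Bornology.IsBounded Ω) (hp : p ∈ VSpace Ω ΓD) (hq : q ∈ VSpace Ω ΓD) :
    p - q ∈ VSpace Ω ΓD := ⟨hp.1.sub hΩ hq.1, hp.2.sub_zero hΩ hq.2⟩

/-- Integrals stay in closed subspaces. -/
lemma integral_mem_submodule {α X : Type*} [MeasurableSpace α] [NormedAddCommGroup X]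
    [NormedSpace ℝ X] [CompleteSpace X] {μ : Measure α} [IsFiniteMeasure μ] {f : α → X}
    {P : Submodule ℝ X} (hP : IsClosed (P : Set X)) (hf : ∀ᵐ t ∂μ, f t ∈ P)
    (hfi : Integrable f μ) : ∫ t, f t ∂μ ∈ P := by
  by_cases hμ : μ = 0
  · rw [hμ, integral_zero_measure]; exact P.zero_mem
  · have : NeZero μ := ⟨hμ⟩
    have h1 : ⨍ t, f t ∂μ ∈ (P : Set X) := P.convex.average_mem hP hf hfi
    rw [← measure_smul_average]
    exact P.smul_mem _ h1

end VSpaceSub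

/-! ### Operations on `H¹` in time, sums over slabs, and test functions. -/

section Time

variable {X Y : Type*} [NormedAddCommGroup X] [NormedSpace ℝ X] [NormedAddCommGroup Y]
  [NormedSpace ℝ Y] {T : ℝ} {u v : ℝ → X} {S S' : Set X}

namespace MemH1Time

lemma congr (h : MemH1Time T S u) (hT : 0 ≤ T) (huv : EqOn v u (Icc 0 T)) :
    MemH1Time T S v := by
  obtain ⟨h1, w, hw, h2⟩ := h
  refine ⟨fun t ht => huv ht ▸ h1 t ht, w, hw, fun t ht => ?_⟩
  rw [huv ht, huv ⟨le_rfl, hT⟩, h2 t ht]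

lemma clm [CompleteSpace X] [CompleteSpace Y] (h : MemH1Time T S u) (L : X →L[ℝ] Y) :
    MemH1Time T univ fun t => L (u t) := by
  obtain ⟨-, w, hw, h2⟩ := h
  refine ⟨fun _ _ => mem_univ _, fun t => L (w t), L.comp_memLp' hw, fun t ht => ?_⟩
  have hi : IntervalIntegrable w volume 0 t :=
    (intervalIntegrable_iff_integrableOn_Ioc_of_le ht.1).2
      (IntegrableOn.mono_set (t := Ioc 0 T) (hw.integrable one_le_two)
        (Ioc_subset_Ioc_right ht.2))
  beta_reduce
  rw [h2 t ht, map_add, L.intervalIntegral_comp_comm hi]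

lemma sub (h : MemH1Time T S u) (h' : MemH1Time T S' v) :
    MemH1Time T univ fun t => u t - v t := by
  obtain ⟨-, w, hw, h2⟩ := h
  obtain ⟨-, y, hy, h2'⟩ := h'
  refine ⟨fun _ _ => mem_univ _, fun t => w t - y t, hw.sub hy, fun t ht => ?_⟩
  have hi : ∀ {w : ℝ → X}, MemLp w 2 (volume.restrict (Ioc 0 T)) →
      IntervalIntegrable w volume 0 t := fun hw =>
    (intervalIntegrable_iff_integrableOn_Ioc_of_le ht.1).2
      (IntegrableOn.mono_set (t := Ioc 0 T) (hw.integrable one_le_two)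
        (Ioc_subset_Ioc_right ht.2))
  beta_reduce
  rw [h2 t ht, h2' t ht, intervalIntegral.integral_sub (hi hw) (hi hy)]
  abel

lemma deriv_clm [CompleteSpace X] (hT : 0 ≤ T) (h : MemH1Time T S u) (L : X →L[ℝ] Y) :
    ∀ᵐ t ∂volume.restrict (Ioc 0 T), deriv (fun t => L (u t)) t = L (deriv u t) := by
  filter_upwards [h.ae_differentiableAt hT] with t ht
  exact (L.hasFDerivAt.comp_hasDerivAt t ht.hasDerivAt).deriv

lemma deriv_sub [CompleteSpace X] (hT : 0 ≤ T) (h : MemH1Time T S u) (h' : MemH1Time T S' v) :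
    ∀ᵐ t ∂volume.restrict (Ioc 0 T), deriv (fun t => u t - v t) t = deriv u t - deriv v t := by
  filter_upwards [h.ae_differentiableAt hT, h'.ae_differentiableAt hT] with t ht ht'
  exact deriv_fun_sub ht ht'

end MemH1Time

namespace BddMeas

lemma memLp {X : Type*} [NormedAddCommGroup X] {μ : Measure ℝ} [IsFiniteMeasure μ] {u : ℝ → X}
    {p : ENNReal} (hu : BddMeas μ u) : MemLp u p μ := by
  obtain ⟨h1, C, hC, h2⟩ := hu
  exact MemLp.of_bound h1 C h2

end BddMeas

namespace Mesh

variable {d : ℕ} {D : Data d} (𝒯 : Mesh D)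

lemma Ioc_subset_iUnion_slab :
    Ioc 0 D.T ⊆ ⋃ n : Finset.Icc 1 𝒯.N, Ioc (𝒯.τ ((n : ℕ) - 1)) (𝒯.τ n) := by
  intro t ht
  have hex : ∃ n, 1 ≤ n ∧ t ≤ 𝒯.τ n := ⟨𝒯.N, 𝒯.one_le_N, by rw [𝒯.τ_last]; exact ht.2⟩
  classical
  have hs := Nat.find_spec hex
  refine mem_iUnion.2 ⟨⟨Nat.find hex, Finset.mem_Icc.2 ⟨hs.1, Nat.find_min' hex
    ⟨𝒯.one_le_N, by rw [𝒯.τ_last]; exact ht.2⟩⟩⟩, ?_, hs.2⟩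
  by_cases h1 : Nat.find hex = 1
  · simp only [h1]; rw [Nat.sub_self, 𝒯.τ_zero]; exact ht.1
  · have := Nat.find_min hex (m := Nat.find hex - 1) (by omega)
    rw [not_and] at this
    exact not_le.1 (this (by omega))

lemma bddMeas_of_slabs {X : Type*} [NormedAddCommGroup X] {u : ℝ → X}
    (h : ∀ n ∈ Finset.Icc 1 𝒯.N, BddMeas (volume.restrict (Ioc (𝒯.τ (n - 1)) (𝒯.τ n))) u) :
    BddMeas (volume.restrict (Ioc 0 D.T)) u := by
  have hle := Measure.restrict_mono_set volume 𝒯.Ioc_subset_iUnion_slab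
  refine BddMeas.mono ?_ hle
  choose! h1 C hC h2 using h
  refine ⟨AEStronglyMeasurable.iUnion fun n => h1 n n.2, ∑ n ∈ Finset.Icc 1 𝒯.N, C n,
    Finset.sum_nonneg hC, ?_⟩
  rw [ae_restrict_iUnion_iff]
  intro n
  filter_upwards [h2 n n.2] with t ht
  exact ht.trans (Finset.single_le_sum hC n.2)

lemma Ioc_slab_subset {n : ℕ} (hn : n ∈ Finset.Icc 1 𝒯.N) :
    Ioc (𝒯.τ (n - 1)) (𝒯.τ n) ⊆ Ioc 0 D.T := by
  rw [Finset.mem_Icc] at hn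
  exact Ioc_subset_Ioc (𝒯.τ_mem (by omega)).1 (𝒯.τ_mem hn.2).2

/-- Summation of integrals over the time intervals. -/
lemma sum_sum_integral {ι : Type*} (s : ℕ → Finset ι) {F : ℕ → ι → ℝ → ℝ} {G : ℝ → ℝ}
    (hG : IntegrableOn G (Ioc 0 D.T))
    (hF : ∀ n ∈ Finset.Icc 1 𝒯.N, ∀ i ∈ s n,
      IntegrableOn (F n i) (Ioc (𝒯.τ (n - 1)) (𝒯.τ n)))
    (hsum : ∀ n ∈ Finset.Icc 1 𝒯.N, ∀ᵐ t ∂volume.restrict (Ioc (𝒯.τ (n - 1)) (𝒯.τ n)),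
      ∑ i ∈ s n, F n i t = G t) :
    ∑ n ∈ Finset.Icc 1 𝒯.N, ∑ i ∈ s n, ∫ t in (𝒯.τ (n - 1))..(𝒯.τ n), F n i t
      = ∫ t in Ioc 0 D.T, G t := by
  have h1 := 𝒯.sum_integral_slab hG (Nat.zero_le 𝒯.N) le_rfl
  rw [𝒯.τ_zero, 𝒯.τ_last, zero_add, intervalIntegral.integral_of_le D.T_pos.le] at h1
  rw [← h1]
  refine Finset.sum_congr rfl fun n hn => ?_
  have hle := (𝒯.τ_lt n hn).le
  simp_rw [intervalIntegral.integral_of_le hle]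
  rw [← integral_finsetSum _ (hF n hn)]
  exact integral_congr_ae (hsum n hn)

/-- Test functions are bounded in time. -/
lemma MemTest.bddMeas {W : ℝ → Vec d → Vec d} (hW : 𝒯.MemTest W) {X : Type*}
    [NormedAddCommGroup X] (f : (Vec d → Vec d) → X) :
    BddMeas (volume.restrict (Ioc 0 D.T)) fun t => f (W t) := by
  refine 𝒯.bddMeas_of_slabs fun n hn => ?_
  obtain ⟨χ, -, hχ⟩ := hW n hn
  refine (BddMeas.const (f χ)).congr ?_
  rw [Filter.EventuallyEq, ← Measure.restrict_congr_set Ico_ae_eq_Ioc,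
    ae_restrict_iff' measurableSet_Ico]
  exact Eventually.of_forall fun t ht => by rw [hχ t ht]

/-- `MemTest` does not constrain the value at the final time, hence the half-open interval; one
instant is negligible in the time integrals. -/
lemma MemTest.mem_V {W : ℝ → Vec d → Vec d} (hW : 𝒯.MemTest W) {t : ℝ} (ht : t ∈ Ico 0 D.T) :
    emb D W t ∈ D.V := by
  have hex : ∃ n, 1 ≤ n ∧ t < 𝒯.τ n := ⟨𝒯.N, 𝒯.one_le_N, by rw [𝒯.τ_last]; exact ht.2⟩
  classical
  have hs := Nat.find_spec hex
  have hn : Nat.find hex ∈ Finset.Icc 1 𝒯.N := Finset.mem_Icc.2 ⟨hs.1, Nat.find_min' hex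
    ⟨𝒯.one_le_N, by rw [𝒯.τ_last]; exact ht.2⟩⟩
  have hl : 𝒯.τ (Nat.find hex - 1) ≤ t := by
    by_cases h1 : Nat.find hex = 1
    · rw [h1, Nat.sub_self, 𝒯.τ_zero]; exact ht.1
    · have := Nat.find_min hex (m := Nat.find hex - 1) (by omega)
      rw [not_and] at this
      exact not_lt.1 (this (by omega))
  obtain ⟨χ, h1, h2⟩ := hW _ hn
  rw [emb, h2 t ⟨hl, hs.2⟩]
  exact h1.mem

end Mesh

end Time

/-! ### The forms `B` and `B*`: linearity and duality. -/

section Forms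

lemma integral_combination {α : Type*} [MeasurableSpace α] {μ : Measure α} {f₁ f₂ f₃ f₄ f₅ : α → ℝ}
    (h₁ : Integrable f₁ μ) (h₂ : Integrable f₂ μ) (h₃ : Integrable f₃ μ) (h₄ : Integrable f₄ μ)
    (h₅ : Integrable f₅ μ) : ∫ t, (f₁ t + f₂ t - f₃ t + f₄ t - f₅ t) ∂μ
      = (∫ t, f₁ t ∂μ) + (∫ t, f₂ t ∂μ) - (∫ t, f₃ t ∂μ) + (∫ t, f₄ t ∂μ) - ∫ t, f₅ t ∂μ := by
  have e1 : ∫ t, (f₁ t + f₂ t) ∂μ = _ := integral_add h₁ h₂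
  have e2 : ∫ t, (f₁ t + f₂ t - f₃ t) ∂μ = _ := integral_sub (h₁.add h₂) h₃
  have e3 : ∫ t, (f₁ t + f₂ t - f₃ t + f₄ t) ∂μ = _ := integral_add ((h₁.add h₂).sub h₃) h₄
  have e4 : ∫ t, (f₁ t + f₂ t - f₃ t + f₄ t - f₅ t) ∂μ = _ :=
    integral_sub (((h₁.add h₂).sub h₃).add h₄) h₅
  rw [e4, e3, e2, e1]

lemma integral_combination' {α : Type*} [MeasurableSpace α] {μ : Measure α}
    {f₁ f₂ f₃ f₄ f₅ : α → ℝ}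
    (h₁ : Integrable f₁ μ) (h₂ : Integrable f₂ μ) (h₃ : Integrable f₃ μ) (h₄ : Integrable f₄ μ)
    (h₅ : Integrable f₅ μ) : ∫ t, (- f₁ t + f₂ t - f₃ t - f₄ t - f₅ t) ∂μ
      = -(∫ t, f₁ t ∂μ) + (∫ t, f₂ t ∂μ) - (∫ t, f₃ t ∂μ) - (∫ t, f₄ t ∂μ) - ∫ t, f₅ t ∂μ := by
  have e := integral_combination h₁.neg h₂ h₃ h₄.neg h₅
  simp only [Pi.neg_apply, integral_neg, ← sub_eq_add_neg] at e
  exact e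

lemma BddMeas.inner_integrable {E : Type*} [NormedAddCommGroup E] [InnerProductSpace ℝ E]
    {μ : Measure ℝ} {u v : ℝ → E} (hv : BddMeas μ v) (hu : Integrable u μ) :
    Integrable (fun t => inner ℝ (u t) (v t)) μ := by
  let I : E →L[ℝ] E →L[ℝ] ℝ := innerSL ℝ
  exact hv.bilin_integrable hu I

namespace Data

variable {d : ℕ} (D : Data d)

/-- The form `a` as a continuous bilinear map. -/
abbrev aL : Pair D.Ω →L[ℝ] Pair D.Ω →L[ℝ] ℝ := aFormL D.Ω D.μ₀ D.lam₀

lemma aL_apply (v w : Pair D.Ω) : D.aL v w = D.a v w := aFormL_apply _ _ _ _ _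

variable {E : Type*} [NormedAddCommGroup E] [NormedSpace ℝ E]

/-- The Volterra operator with kernel `𝒦`. -/
def volterra (u : ℝ → E) (t : ℝ) : E := ∫ s in Ioc 0 D.T, D.k (t - s) • u s

/-- The adjoint Volterra operator. -/
def volterraStar (u : ℝ → E) (t : ℝ) : E := ∫ s in Ioc 0 D.T, D.k (s - t) • u s

variable {D}

lemma integrable_k_neg : Integrable fun x => D.k (-x) := D.integrable_k.comp_neg

lemma bddMeas_volterra {u : ℝ → E} (hu : BddMeas (volume.restrict (Ioc 0 D.T)) u) {R : Set ℝ} :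
    BddMeas (volume.restrict R) (D.volterra u) := hu.conv D.integrable_k

lemma integrable_smul_reverse {u : ℝ → E} {R : Set ℝ} (hu : BddMeas (volume.restrict R) u) (t : ℝ) :
    IntegrableOn (fun s => D.k (s - t) • u s) R := by
  have := hu.kernel_integrable D.integrable_k_neg t
  simpa only [neg_sub] using this

lemma bddMeas_reverse {u : ℝ → E} {R S : Set ℝ} (hu : BddMeas (volume.restrict R) u) :
    BddMeas (volume.restrict S) fun t => ∫ s in R, D.k (s - t) • u s := by
  have := hu.conv (R := S) D.integrable_k_neg
  simpa only [neg_sub] using this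

lemma map_volterra [CompleteSpace E] {F : Type*} [NormedAddCommGroup F] [NormedSpace ℝ F]
    [CompleteSpace F] {u : ℝ → E} (hu : BddMeas (volume.restrict (Ioc 0 D.T)) u) (L : E →L[ℝ] F)
    (t : ℝ) : L (D.volterra u t) = D.volterra (fun s => L (u s)) t := by
  rw [volterra, ← L.integral_comp_comm (hu.kernel_integrable D.integrable_k t)]
  simp only [map_smul]
  rfl

lemma map_reverse [CompleteSpace E] {F : Type*} [NormedAddCommGroup F] [NormedSpace ℝ F]
    [CompleteSpace F] {u : ℝ → E} {R : Set ℝ} (hu : BddMeas (volume.restrict R) u) (L : E →L[ℝ] F)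
    (t : ℝ) : L (∫ s in R, D.k (s - t) • u s) = ∫ s in R, D.k (s - t) • L (u s) := by
  rw [← L.integral_comp_comm (integrable_smul_reverse hu t)]
  simp only [map_smul]

lemma volterra_sub {u v : ℝ → E} (hu : BddMeas (volume.restrict (Ioc 0 D.T)) u)
    (hv : BddMeas (volume.restrict (Ioc 0 D.T)) v) (t : ℝ) :
    D.volterra (fun s => u s - v s) t = D.volterra u t - D.volterra v t := by
  simp only [volterra, smul_sub]
  exact integral_sub (hu.kernel_integrable D.integrable_k t)
    (hv.kernel_integrable D.integrable_k t)

variable (D) in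
/-- The integrand of `B`. -/
def density (u₁ : ℝ → Pair D.Ω) (u₂ : ℝ → HSpace D.Ω) (v₁ : ℝ → HSpace D.Ω)
    (v₂ : ℝ → Pair D.Ω) (t : ℝ) : ℝ :=
  inner ℝ (deriv u₂ t) (v₂ t).1 + D.aL (u₁ t) (v₂ t) - D.aL (D.volterra u₁ t) (v₂ t)
    + inner ℝ (deriv u₁ t).1 (v₁ t) - inner ℝ (u₂ t) (v₁ t)

variable {u₁ u₁' : ℝ → Pair D.Ω} {u₂ u₂' : ℝ → HSpace D.Ω} {v₁ v₁' : ℝ → HSpace D.Ω}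
  {v₂ v₂' : ℝ → Pair D.Ω} {S S' : Set (Pair D.Ω)} {R R' : Set (HSpace D.Ω)}

/-- Continuity of `a` in its first argument allows the memory integral to be taken inside, as a
Volterra operator acting on `u₁`. -/
lemma B_eq (hu₁ : MemH1Time D.T S u₁) : D.B u₁ u₂ v₁ v₂
      = (∫ t in Ioc 0 D.T, D.density u₁ u₂ v₁ v₂ t) + inner ℝ (u₁ 0).1 (v₁ 0)
        + inner ℝ (u₂ 0) (v₂ 0).1 := by
  have hb := hu₁.bddMeas D.T_pos.le
  rw [B, intervalIntegral.integral_of_le D.T_pos.le]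
  congr 2
  refine setIntegral_congr_fun measurableSet_Ioc fun t ht => ?_
  have e := D.integral_ker_zero (Ioc_subset_Icc_self ht) fun s => D.a (u₁ s) (v₂ t)
  have e2 := map_volterra hb (D.aL.flip (v₂ t)) t
  simp only [smul_eq_mul] at e
  beta_reduce
  rw [e]
  simp only [density, aL_apply]
  congr 3
  rw [← aL_apply, ← ContinuousLinearMap.flip_apply, e2, volterra]
  simp only [ContinuousLinearMap.flip_apply, aL_apply, smul_eq_mul]

lemma integrable_density (hu₁ : MemH1Time D.T S u₁) (hu₂ : MemH1Time D.T R u₂)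
    (hv₁ : BddMeas (volume.restrict (Ioc 0 D.T)) v₁)
    (hv₂ : BddMeas (volume.restrict (Ioc 0 D.T)) v₂) :
    IntegrableOn (D.density u₁ u₂ v₁ v₂) (Ioc 0 D.T) := by
  have hT := D.T_pos.le
  have hb := hu₁.bddMeas hT
  have h21 : BddMeas (volume.restrict (Ioc 0 D.T)) fun t => (v₂ t).1 :=
    hv₂.clm (ContinuousLinearMap.fst ℝ _ _)
  have hd : Integrable (fun t => (deriv u₁ t).1) (volume.restrict (Ioc 0 D.T)) :=
    (ContinuousLinearMap.fst ℝ (HSpace D.Ω) (GSpace D.Ω)).integrable_comp (hu₁.integrable_deriv hT)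
  exact ((((h21.inner_integrable (hu₂.integrable_deriv hT)).add
    (hb.bilin hv₂ D.aL).integrable).sub ((bddMeas_volterra hb).bilin hv₂ D.aL).integrable).add
    (hv₁.inner_integrable hd)).sub (hv₁.inner_integrable (hu₂.bddMeas hT).integrable)

lemma B_sub_left (hu₁ : MemH1Time D.T S u₁) (hu₂ : MemH1Time D.T R u₂)
    (hu₁' : MemH1Time D.T S' u₁') (hu₂' : MemH1Time D.T R' u₂')
    (hv₁ : BddMeas (volume.restrict (Ioc 0 D.T)) v₁)
    (hv₂ : BddMeas (volume.restrict (Ioc 0 D.T)) v₂) :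
    D.B (fun t => u₁ t - u₁' t) (fun t => u₂ t - u₂' t) v₁ v₂
      = D.B u₁ u₂ v₁ v₂ - D.B u₁' u₂' v₁ v₂ := by
  have hT := D.T_pos.le
  rw [B_eq hu₁, B_eq hu₁', B_eq (hu₁.sub hu₁')]
  have e : ∫ t in Ioc 0 D.T, D.density (fun t => u₁ t - u₁' t) (fun t => u₂ t - u₂' t) v₁ v₂ t
      = (∫ t in Ioc 0 D.T, D.density u₁ u₂ v₁ v₂ t)
        - ∫ t in Ioc 0 D.T, D.density u₁' u₂' v₁ v₂ t := by
    rw [← integral_sub (integrable_density hu₁ hu₂ hv₁ hv₂)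
      (integrable_density hu₁' hu₂' hv₁ hv₂)]
    refine integral_congr_ae ?_
    filter_upwards [hu₁.deriv_sub hT hu₁', hu₂.deriv_sub hT hu₂'] with t h1 h2
    simp only [density, h1, h2, volterra_sub (hu₁.bddMeas hT) (hu₁'.bddMeas hT), inner_sub_left,
      map_sub, _root_.sub_apply, Prod.fst_sub]
    ring
  rw [e]
  simp only [Prod.fst_sub, inner_sub_left]
  ring

lemma B_sub_right (hu₁ : MemH1Time D.T S u₁) (hu₂ : MemH1Time D.T R u₂)
    (hv₁ : BddMeas (volume.restrict (Ioc 0 D.T)) v₁)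
    (hv₂ : BddMeas (volume.restrict (Ioc 0 D.T)) v₂)
    (hv₁' : BddMeas (volume.restrict (Ioc 0 D.T)) v₁')
    (hv₂' : BddMeas (volume.restrict (Ioc 0 D.T)) v₂') :
    D.B u₁ u₂ (fun t => v₁ t - v₁' t) (fun t => v₂ t - v₂' t)
      = D.B u₁ u₂ v₁ v₂ - D.B u₁ u₂ v₁' v₂' := by
  rw [B_eq hu₁, B_eq hu₁, B_eq hu₁]
  have e : ∫ t in Ioc 0 D.T, D.density u₁ u₂ (fun t => v₁ t - v₁' t) (fun t => v₂ t - v₂' t) t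
      = (∫ t in Ioc 0 D.T, D.density u₁ u₂ v₁ v₂ t)
        - ∫ t in Ioc 0 D.T, D.density u₁ u₂ v₁' v₂' t := by
    rw [← integral_sub (integrable_density hu₁ hu₂ hv₁ hv₂)
      (integrable_density hu₁ hu₂ hv₁' hv₂')]
    refine integral_congr_ae (Eventually.of_forall fun t => ?_)
    simp only [density, inner_sub_right, map_sub, Prod.fst_sub]
    ring
  rw [e]
  simp only [Prod.fst_sub, inner_sub_right]
  ring

set_option maxHeartbeats 1600000 in
/-- The forms `B` and `B*` agree on smooth arguments. -/
lemma BStar_eq_B {z₁ : ℝ → HSpace D.Ω} {z₂ : ℝ → Pair D.Ω} (hu₁ : MemH1Time D.T S u₁)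
    (hu₂ : MemH1Time D.T R u₂) (hz₁ : MemH1Time D.T R' z₁) (hz₂ : MemH1Time D.T S' z₂) :
    D.BStar u₁ u₂ z₁ z₂ = D.B u₁ u₂ z₁ z₂ := by
  have hT := D.T_pos.le
  let fst : Pair D.Ω →L[ℝ] HSpace D.Ω := ContinuousLinearMap.fst ℝ _ _
  have bu₁ := hu₁.bddMeas hT
  have bz₂ := hz₂.bddMeas hT
  have bz₁ := hz₁.bddMeas hT
  have bu₂ := hu₂.bddMeas hT
  -- `p1` and `p2` move the time derivatives from `z` to `u` and exchange the terms at `T` in `B*`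
  -- for the terms at `0` in `B`. `p3` moves the memory operator to the other argument.
  have p1 := MemH1Time.integral_inner_deriv hT (hu₁.clm fst) hz₁
  have p2 := MemH1Time.integral_inner_deriv hT hu₂ (hz₂.clm fst)
  have p3 := BddMeas.conv_adjoint D.integrable_k bu₁ bz₂ measure_Ioc_lt_top.ne D.aL
  have e1 : D.BStar u₁ u₂ z₁ z₂ = (∫ t in Ioc 0 D.T, (- inner ℝ (u₁ t).1 (deriv z₁ t)
      + D.aL (u₁ t) (z₂ t) - D.aL (u₁ t) (D.volterraStar z₂ t) - inner ℝ (u₂ t) (deriv z₂ t).1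
      - inner ℝ (u₂ t) (z₁ t)))
      + inner ℝ (u₁ D.T).1 (z₁ D.T) + inner ℝ (u₂ D.T) (z₂ D.T).1 := by
    rw [BStar, intervalIntegral.integral_of_le hT]
    congr 2
    refine setIntegral_congr_fun measurableSet_Ioc fun t ht => ?_
    have e := D.integral_ker_T (Ioc_subset_Icc_self ht) fun s => D.a (u₁ t) (z₂ s)
    simp only [smul_eq_mul] at e
    beta_reduce
    rw [e, aL_apply]
    congr 3
    rw [volterraStar, map_reverse bz₂]
    simp only [aL_apply, smul_eq_mul]
  have hst : BddMeas (volume.restrict (Ioc 0 D.T)) (D.volterraStar z₂) := bddMeas_reverse bz₂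
  have fst_int : ∀ {f : ℝ → Pair D.Ω}, IntegrableOn f (Ioc 0 D.T) →
      IntegrableOn (fun t => (f t).1) (Ioc 0 D.T) := fun hf => fst.integrable_comp hf
  have i1 : IntegrableOn (fun t => inner ℝ (u₁ t).1 (deriv z₁ t)) (Ioc 0 D.T) := by
    have := (bu₁.clm fst).inner_integrable (hz₁.integrable_deriv hT)
    refine this.congr (Eventually.of_forall fun t => real_inner_comm _ _)
  have i2 : IntegrableOn (fun t => inner ℝ (u₂ t) (deriv z₂ t).1) (Ioc 0 D.T) := by
    have := bu₂.inner_integrable (fst_int (hz₂.integrable_deriv hT))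
    refine this.congr (Eventually.of_forall fun t => real_inner_comm _ _)
  have i3 : IntegrableOn (fun t => inner ℝ (deriv u₁ t).1 (z₁ t)) (Ioc 0 D.T) :=
    bz₁.inner_integrable (fst_int (hu₁.integrable_deriv hT))
  have i4 : IntegrableOn (fun t => inner ℝ (deriv u₂ t) (z₂ t).1) (Ioc 0 D.T) :=
    (bz₂.clm fst).inner_integrable (hu₂.integrable_deriv hT)
  have i5 : IntegrableOn (fun t => D.aL (u₁ t) (z₂ t)) (Ioc 0 D.T) :=
    (bu₁.bilin bz₂ D.aL).integrable
  have i6 : IntegrableOn (fun t => D.aL (u₁ t) (D.volterraStar z₂ t)) (Ioc 0 D.T) :=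
    (bu₁.bilin hst D.aL).integrable
  have i7 : IntegrableOn (fun t => inner ℝ (u₂ t) (z₁ t)) (Ioc 0 D.T) :=
    bz₁.inner_integrable bu₂.integrable
  have i8 : IntegrableOn (fun t => D.aL (D.volterra u₁ t) (z₂ t)) (Ioc 0 D.T) :=
    ((bddMeas_volterra bu₁).bilin bz₂ D.aL).integrable
  have q1 : ∫ t in Ioc 0 D.T, (inner ℝ (deriv u₁ t).1 (z₁ t) + inner ℝ (u₁ t).1 (deriv z₁ t))
      = inner ℝ (u₁ D.T).1 (z₁ D.T) - inner ℝ (u₁ 0).1 (z₁ 0) := by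
    rw [intervalIntegral.integral_of_le hT] at p1
    refine Eq.trans (integral_congr_ae ?_) p1
    filter_upwards [hu₁.deriv_clm hT fst] with t ht
    rw [ht]; rfl
  have q2 : ∫ t in Ioc 0 D.T, (inner ℝ (deriv u₂ t) (z₂ t).1 + inner ℝ (u₂ t) (deriv z₂ t).1)
      = inner ℝ (u₂ D.T) (z₂ D.T).1 - inner ℝ (u₂ 0) (z₂ 0).1 := by
    rw [intervalIntegral.integral_of_le hT] at p2
    refine Eq.trans (integral_congr_ae ?_) p2
    filter_upwards [hz₂.deriv_clm hT fst] with t ht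
    rw [ht]; rfl
  rw [integral_add i3 i1] at q1
  rw [integral_add i4 i2] at q2
  change ∫ t in Ioc 0 D.T, D.aL (D.volterra u₁ t) (z₂ t)
    = ∫ t in Ioc 0 D.T, D.aL (u₁ t) (D.volterraStar z₂ t) at p3
  have d1 : ∫ t in Ioc 0 D.T, D.density u₁ u₂ z₁ z₂ t
      = (∫ t in Ioc 0 D.T, inner ℝ (deriv u₂ t) (z₂ t).1)
        + (∫ t in Ioc 0 D.T, D.aL (u₁ t) (z₂ t))
        - (∫ t in Ioc 0 D.T, D.aL (D.volterra u₁ t) (z₂ t))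
        + (∫ t in Ioc 0 D.T, inner ℝ (deriv u₁ t).1 (z₁ t))
        - ∫ t in Ioc 0 D.T, inner ℝ (u₂ t) (z₁ t) := by
    have e := integral_combination i4 i5 i8 i3 i7
    simp only [density]
    exact e
  have d2 : ∫ t in Ioc 0 D.T, (- inner ℝ (u₁ t).1 (deriv z₁ t)
      + D.aL (u₁ t) (z₂ t) - D.aL (u₁ t) (D.volterraStar z₂ t) - inner ℝ (u₂ t) (deriv z₂ t).1
      - inner ℝ (u₂ t) (z₁ t))
      = - (∫ t in Ioc 0 D.T, inner ℝ (u₁ t).1 (deriv z₁ t))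
        + (∫ t in Ioc 0 D.T, D.aL (u₁ t) (z₂ t))
        - (∫ t in Ioc 0 D.T, D.aL (u₁ t) (D.volterraStar z₂ t))
        - (∫ t in Ioc 0 D.T, inner ℝ (u₂ t) (deriv z₂ t).1)
        - ∫ t in Ioc 0 D.T, inner ℝ (u₂ t) (z₁ t) := by
    have e := integral_combination' i1 i5 i6 i2 i7
    exact e
  rw [e1, B_eq hu₁, d1, d2, p3]
  linarith

end Data

end Forms

/-! ### Assembling the cell residuals `Θ1` and `Θ2`. -/

section CellSums

variable {d : ℕ} {D : Data d} {M : Finset (Set (Vec d))} {K : Set (Vec d)}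

lemma Data.cellPair_eq (hK : volume.restrict K ≤ volume.restrict D.Ω) (v w : HSpace D.Ω) :
    D.cellPair K v w = overlapPair hK hK v w := (overlapPair_apply hK hK v w).symm

lemma IsTriangulation.sum_cellPair (hM : IsTriangulation D.Ω M) (v w : HSpace D.Ω) :
    ∑ K ∈ M, D.cellPair K v w = inner ℝ v w := by
  rw [L2.inner_def, hM.integral_eq_sum D.domain.isOpen D.domain.one_sided
    (integrable_inner_of_le le_rfl le_rfl v w)]
  rfl

lemma IsTriangulation.integrable_cellPair (hM : IsTriangulation D.Ω M) (hK : K ∈ M) {μ : Measure ℝ}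
    {v w : ℝ → HSpace D.Ω} (hv : Integrable v μ) (hw : BddMeas μ w) :
    Integrable (fun t => D.cellPair K (v t) (w t)) μ := by
  simp only [Data.cellPair_eq (hM.restrict_cell_le D.domain.one_sided hK)]
  exact hw.bilin_integrable hv _

/-- Summation of cell contributions over a space-time mesh. -/
lemma Mesh.sum_sum_integral_cellPair (𝒯 : Mesh D) {v w : ℝ → HSpace D.Ω}
    (hv : IntegrableOn v (Ioc 0 D.T)) (hw : BddMeas (volume.restrict (Ioc 0 D.T)) w) :
    ∑ n ∈ Finset.Icc 1 𝒯.N, ∑ K ∈ 𝒯.bar n,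
        ∫ t in (𝒯.τ (n - 1))..(𝒯.τ n), D.cellPair K (v t) (w t)
      = ∫ t in Ioc 0 D.T, inner ℝ (v t) (w t) := by
  refine 𝒯.sum_sum_integral 𝒯.bar (hw.inner_integrable hv) (fun n hn K hK => ?_) fun n hn => ?_
  · exact IntegrableOn.mono_set ((𝒯.bar_tri n hn).integrable_cellPair hK hv hw)
      (𝒯.Ioc_slab_subset hn)
  · exact Eventually.of_forall fun t => (𝒯.bar_tri n hn).sum_cellPair _ _

end CellSums

/-! ### Assembling the boundary residuals and the memory terms. -/

section BoundarySums

variable {d : ℕ} {D : Data d} {𝒯 : Mesh D} {U : ℝ → Vec d → Vec d} {M : Finset (Set (Vec d))}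
  {S : Set (Vec d)} {T : Pair D.Ω →L[ℝ] Lp (Vec d) 2 ((surf d).restrict S)} {e : ℝ → Pair D.Ω}

/-- The form `(γ, q) ↦ (γ, q)_{Γ_N}`. -/
def Data.neumannForm (D : Data d) {S : Set (Vec d)}
    (T : Pair D.Ω →L[ℝ] Lp (Vec d) 2 ((surf d).restrict S))
    (hΓ : (surf d).restrict D.ΓN ≤ (surf d).restrict S) :
    Lp (Vec d) 2 ((surf d).restrict D.ΓN) →L[ℝ] Pair D.Ω →L[ℝ] ℝ :=
  (overlapPair le_rfl hΓ).bilinearComp (ContinuousLinearMap.id ℝ _) T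

lemma Data.neumannForm_apply (hΓ : (surf d).restrict D.ΓN ≤ (surf d).restrict S)
    (γ : Lp (Vec d) 2 ((surf d).restrict D.ΓN)) (q : Pair D.Ω) :
    D.neumannForm T hΓ γ q = overlapPair le_rfl hΓ γ (T q) := rfl

lemma Data.mem_H1closure {q : Pair D.Ω} (hq : q ∈ D.V) : q ∈ H1closure D.domain.bounded :=
  VSpace.mem_H1closure D.domain.bounded hq

lemma Mesh.integrable_neumannResidual :
    IntegrableOn (𝒯.neumannResidual U) (Ioc 0 D.T) := by
  have hb : BddMeas (volume.restrict (Ioc 0 D.T)) (𝒯.bdryStressLp U) :=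
    BddMeas.of_continuousOn (𝒯.continuous_interp _).continuousOn
  exact (hb.integrable.sub (Data.bddMeas_volterra hb).integrable).sub
    (D.memLp_gN.integrable one_le_two)

lemma Mesh.bddMeas_jumpForm (hΓ : (surf d).restrict D.ΓN ≤ (surf d).restrict S) {a b : ℝ} :
    BddMeas (volume.restrict (Ioc a b)) (𝒯.jumpForm T hΓ U) :=
  BddMeas.of_continuousOn (𝒯.continuous_jumpForm hΓ).continuousOn

lemma Mesh.bddMeas_slabJump {n : ℕ} {K : Set (Vec d)} {a b : ℝ} :
    BddMeas (volume.restrict (Ioc a b)) (𝒯.slabJump T M U n K) :=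
  BddMeas.of_continuousOn (𝒯.continuous_slabJump n).continuousOn

lemma BddMeas.apply {X : Type*} [NormedAddCommGroup X] [NormedSpace ℝ X] {μ : Measure ℝ}
    {L : ℝ → X →L[ℝ] ℝ} {u : ℝ → X} (hL : BddMeas μ L) (hu : BddMeas μ u) :
    BddMeas μ fun t => L t (u t) := hL.bilin hu (ContinuousLinearMap.id ℝ _)

variable (hd : 1 ≤ d) (hT : IsTraceOperator D.domain.bounded S T)
  (hΓ : (surf d).restrict D.ΓN ≤ (surf d).restrict S)
  (hMS : ∀ n ∈ Finset.Icc 1 𝒯.N, ∀ K ∈ 𝒯.bar n, frontier K ⊆ S) (hU : 𝒯.MemTrial U)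
  (he : BddMeas (volume.restrict (Ioc 0 D.T)) e)
  (heV : ∀ᵐ t ∂volume.restrict (Ioc 0 D.T), e t ∈ D.V)

include hd hT hΓ hMS hU he heV

/-- Only `∂K ∩ Γ_N` contributes, and these pieces tile `Γ_N` up to null sets, so the terms of a slab
add up to one pairing on `Γ_N` that is independent of the mesh. -/
lemma Mesh.sum_Θ3 :
    ∑ n ∈ Finset.Icc 1 𝒯.N, ∑ K ∈ 𝒯.bar n, 𝒯.Θ3 U e n K
      = ∫ t in Ioc 0 D.T, D.neumannForm T hΓ (𝒯.neumannResidual U t) (e t) := by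
  have hi := 𝒯.integrable_neumannResidual (U := U)
  refine 𝒯.sum_sum_integral 𝒯.bar (he.bilin_integrable hi _) (fun n hn K hK => ?_) fun n hn => ?_
  · have h1 : (surf d).restrict (frontier K ∩ D.ΓN) ≤ (surf d).restrict D.ΓN :=
      Measure.restrict_mono_set _ inter_subset_right
    have h2 : (surf d).restrict (frontier K ∩ D.ΓN) ≤ (surf d).restrict S :=
      Measure.restrict_mono_set _ (inter_subset_left.trans (hMS n hn K hK))
    have hle := Measure.restrict_mono_set volume (𝒯.Ioc_slab_subset hn)
    have h3 := (he.clm T).bilin_integrable hi (overlapPair h1 h2)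
    refine (h3.mono_measure hle).congr ?_
    filter_upwards [ae_mono hle heV, ae_restrict_mem measurableSet_Ioc] with t ht ht'
    exact (hU.bdryPair_gd hd (𝒯.bar_tri n hn) hT hK (hMS n hn K hK) h1 h2
      (Ioc_subset_Icc_self (𝒯.Ioc_slab_subset hn ht')) (Data.mem_H1closure ht)).symm
  · have hle := Measure.restrict_mono_set volume (𝒯.Ioc_slab_subset hn)
    filter_upwards [ae_mono hle heV, ae_restrict_mem measurableSet_Ioc] with t ht ht'
    exact hU.sum_bdryPair_gd hd (𝒯.bar_tri n hn) hT (hMS n hn) hΓ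
      (Ioc_subset_Icc_self (𝒯.Ioc_slab_subset hn ht')) (Data.mem_H1closure ht)

lemma Mesh.sum_Θ4 :
    ∑ n ∈ Finset.Icc 1 𝒯.N, ∑ K ∈ 𝒯.bar n, 𝒯.Θ4 U e n K
      = ∫ t in Ioc 0 D.T, 𝒯.jumpForm T hΓ U t (e t) := by
  refine 𝒯.sum_sum_integral 𝒯.bar ((𝒯.bddMeas_jumpForm hΓ).apply he).integrable
    (fun n hn K hK => ?_) fun n hn => ?_
  · have hle := Measure.restrict_mono_set volume (𝒯.Ioc_slab_subset hn)
    refine ((𝒯.bddMeas_slabJump (T := T) (M := 𝒯.bar n) (U := U) (n := n) (K := K)).apply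
      (he.mono hle)).integrable.congr ?_
    filter_upwards [ae_mono hle heV, ae_restrict_mem measurableSet_Ioc] with t ht ht'
    exact (hU.bdryPair_rd hd hT (𝒯.bar_tri n hn) hn (bar_of_mem hn (Or.inl rfl) hU)
      (bar_of_mem hn (Or.inr rfl) hU) hK (hMS n hn K hK) (Ioc_subset_Icc_self ht')
      (Data.mem_H1closure ht)).symm
  · have hle := Measure.restrict_mono_set volume (𝒯.Ioc_slab_subset hn)
    filter_upwards [ae_mono hle heV, ae_restrict_mem measurableSet_Ioc] with t ht ht'
    rw [← hU.sum_slabJump hd hT hΓ (𝒯.bar_tri n hn) (hMS n hn) hn (bar_of_mem hn (Or.inl rfl) hU)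
      (bar_of_mem hn (Or.inr rfl) hU) (Ioc_subset_Icc_self ht') ht]
    exact Finset.sum_congr rfl fun K hK =>
      hU.bdryPair_rd hd hT (𝒯.bar_tri n hn) hn (bar_of_mem hn (Or.inl rfl) hU)
        (bar_of_mem hn (Or.inr rfl) hU) hK (hMS n hn K hK) (Ioc_subset_Icc_self ht')
        (Data.mem_H1closure ht)

-- Evaluating a boundary pairing at a convolved weight requires only membership in the closure of
-- the smooth fields, which as a closed subspace is stable under integration.
omit hd hT hΓ hMS hU in
lemma reverse_mem_H1closure {R : Set ℝ} (hR : R ⊆ Ioc 0 D.T) (t : ℝ) :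
    ∫ s in R, D.k (s - t) • e s ∈ H1closure D.domain.bounded := by
  have hle := Measure.restrict_mono_set volume hR
  have hfin : IsFiniteMeasure (volume.restrict R) := isFiniteMeasure_of_le _ hle
  refine integral_mem_submodule (Submodule.isClosed_topologicalClosure _) ?_
    (Data.integrable_smul_reverse (he.mono hle) t)
  filter_upwards [ae_mono hle heV] with s hs
  exact Submodule.smul_mem _ _ (Data.mem_H1closure hs)

-- `sum_slabJump` needs a test field in `V`, while the convolved weight is only known to lie in
-- `H1closure`. The functionals are therefore pulled inside the time integral and summed at the
-- values `e s`.
omit hMS in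
lemma Mesh.sum_slabJump_reverse (hM : IsTriangulation D.Ω M) (hMS : ∀ K ∈ M, frontier K ⊆ S) {n : ℕ}
    (hn : n ∈ Finset.Icc 1 𝒯.N) (h₀ : IsPL D.Ω M (U (𝒯.τ (n - 1)))) (h₁ : IsPL D.Ω M (U (𝒯.τ n)))
    {t : ℝ} (ht : t ∈ Icc (𝒯.τ (n - 1)) (𝒯.τ n)) {R : Set ℝ} (hR : R ⊆ Ioc 0 D.T) :
    ∑ K ∈ M, 𝒯.slabJump T M U n K t (∫ s in R, D.k (s - t) • e s)
      = 𝒯.jumpForm T hΓ U t (∫ s in R, D.k (s - t) • e s) := by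
  have hle := Measure.restrict_mono_set volume hR
  rw [← _root_.sum_apply, Data.map_reverse (he.mono hle), Data.map_reverse (he.mono hle)]
  refine integral_congr_ae ?_
  filter_upwards [ae_mono hle heV] with s hs
  rw [_root_.sum_apply, hU.sum_slabJump hd hT hΓ hM hMS hn h₀ h₁ ht hs]

/-- Adjointness of the Volterra operator transfers the kernel from the residual to the weight. -/
lemma Mesh.sum_Θ5Cell :
    ∑ n ∈ Finset.Icc 1 𝒯.N, ∑ K ∈ 𝒯.bar n, 𝒯.Θ5Cell U e n K
      = - ∫ t in Ioc 0 D.T, D.volterra (𝒯.jumpForm T hΓ U) t (e t) := by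
  have hst : BddMeas (volume.restrict (Ioc 0 D.T)) (D.volterraStar e) := Data.bddMeas_reverse he
  have hadj : ∫ t in Ioc 0 D.T, D.volterra (𝒯.jumpForm T hΓ U) t (e t)
      = ∫ t in Ioc 0 D.T, 𝒯.jumpForm T hΓ U t (D.volterraStar e t) :=
    BddMeas.conv_adjoint D.integrable_k (𝒯.bddMeas_jumpForm hΓ) he measure_Ioc_lt_top.ne
      (ContinuousLinearMap.id ℝ _)
  have key : ∀ n ∈ Finset.Icc 1 𝒯.N, ∀ K ∈ 𝒯.bar n, ∀ t ∈ Ioc (𝒯.τ (n - 1)) (𝒯.τ n),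
      D.bdryPair K (D.rd (𝒯.bar n) (U t) K) (∫ s in t..D.T, D.ker (s - t) • e s)
        = 𝒯.slabJump T (𝒯.bar n) U n K t (D.volterraStar e t) := by
    intro n hn K hK t ht
    rw [D.integral_ker_T (Ioc_subset_Icc_self (𝒯.Ioc_slab_subset hn ht)),
      hU.bdryPair_rd hd hT (𝒯.bar_tri n hn) hn (bar_of_mem hn (Or.inl rfl) hU)
        (bar_of_mem hn (Or.inr rfl) hU) hK (hMS n hn K hK) (Ioc_subset_Icc_self ht)
        (reverse_mem_H1closure he heV subset_rfl t)]
    rfl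
  rw [hadj]
  simp only [Θ5Cell, Finset.sum_neg_distrib]
  congr 1
  refine 𝒯.sum_sum_integral 𝒯.bar ((𝒯.bddMeas_jumpForm hΓ).apply hst).integrable
    (fun n hn K hK => ?_) fun n hn => ?_
  · have hle := Measure.restrict_mono_set volume (𝒯.Ioc_slab_subset hn)
    refine ((𝒯.bddMeas_slabJump (T := T) (M := 𝒯.bar n) (U := U) (n := n) (K := K)).apply
      (hst.mono hle)).integrable.congr ?_
    filter_upwards [ae_restrict_mem measurableSet_Ioc] with t ht
    exact (key n hn K hK t ht).symm
  · filter_upwards [ae_restrict_mem measurableSet_Ioc] with t ht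
    rw [Finset.sum_congr rfl fun K hK => key n hn K hK t ht]
    exact sum_slabJump_reverse hd hT hΓ hU he heV (𝒯.bar_tri n hn) (hMS n hn) hn
      (bar_of_mem hn (Or.inl rfl) hU) (bar_of_mem hn (Or.inr rfl) hU) (Ioc_subset_Icc_self ht)
      subset_rfl

/-- The cells used for the pair `n`, `j` only have to make `U` piecewise linear during slab `n`.
Both `bar n` and any refinement of it do so, and the sum over cells is `jumpForm` in either case.
Summing over `j` then reassembles the whole convolved weight. -/
lemma Mesh.sum_Θ5Dual (M : ℕ → ℕ → Finset (Set (Vec d)))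
    (hM : ∀ n ∈ Finset.Icc 1 𝒯.N, ∀ j ∈ Finset.Icc n 𝒯.N,
      M n j = 𝒯.bar n ∨ M n j = 𝒯.bar j ∧ Refines (𝒯.bar j) (𝒯.bar n)) :
    ∑ n ∈ Finset.Icc 1 𝒯.N, ∑ j ∈ Finset.Icc n 𝒯.N, ∑ K ∈ M n j, 𝒯.Θ5Dual (M n j) U e n j K
      = - ∫ t in Ioc 0 D.T, D.volterra (𝒯.jumpForm T hΓ U) t (e t) := by
  have hst : BddMeas (volume.restrict (Ioc 0 D.T)) (D.volterraStar e) := Data.bddMeas_reverse he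
  have hadj : ∫ t in Ioc 0 D.T, D.volterra (𝒯.jumpForm T hΓ U) t (e t)
      = ∫ t in Ioc 0 D.T, 𝒯.jumpForm T hΓ U t (D.volterraStar e t) :=
    BddMeas.conv_adjoint D.integrable_k (𝒯.bddMeas_jumpForm hΓ) he measure_Ioc_lt_top.ne
      (ContinuousLinearMap.id ℝ _)
  have hj1 : ∀ n ∈ Finset.Icc 1 𝒯.N, ∀ j ∈ Finset.Icc n 𝒯.N, j ∈ Finset.Icc 1 𝒯.N := by
    intro n hn j hj
    rw [Finset.mem_Icc] at hn hj ⊢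
    omega
  have hmesh : ∀ n ∈ Finset.Icc 1 𝒯.N, ∀ j ∈ Finset.Icc n 𝒯.N, IsTriangulation D.Ω (M n j) ∧
      (∀ K ∈ M n j, frontier K ⊆ S) ∧ IsPL D.Ω (M n j) (U (𝒯.τ (n - 1))) ∧
        IsPL D.Ω (M n j) (U (𝒯.τ n)) := by
    intro n hn j hj
    have hj' := hj1 n hn j hj
    rcases hM n hn j hj with h | ⟨h, hr⟩ <;> rw [h]
    · exact ⟨𝒯.bar_tri n hn, hMS n hn, bar_of_mem hn (Or.inl rfl) hU,
        bar_of_mem hn (Or.inr rfl) hU⟩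
    · exact ⟨𝒯.bar_tri j hj', hMS j hj', (bar_of_mem hn (Or.inl rfl) hU).refine hr,
        (bar_of_mem hn (Or.inr rfl) hU).refine hr⟩
  have key : ∀ n ∈ Finset.Icc 1 𝒯.N, ∀ j ∈ Finset.Icc n 𝒯.N, ∀ K ∈ M n j,
      ∀ t ∈ Ioc (𝒯.τ (n - 1)) (𝒯.τ n),
      D.bdryPair K (D.rd (M n j) (U t) K)
          (∫ s in (max (𝒯.τ (j - 1)) t)..(𝒯.τ j), D.ker (s - t) • e s)
        = 𝒯.slabJump T (M n j) U n K t
          (∫ s in Ioc (𝒯.τ (j - 1)) (𝒯.τ j), D.k (s - t) • e s) := by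
    intro n hn j hj K hK t ht
    obtain ⟨m1, m2, m3, m4⟩ := hmesh n hn j hj
    have hjn := Finset.mem_Icc.1 hj
    have hj' := hj1 n hn j hj
    rw [D.integral_ker_right (𝒯.τ_lt j hj').le (ht.2.trans (𝒯.τ_mono hjn.1 hjn.2)),
      hU.bdryPair_rd hd hT m1 hn m3 m4 hK (m2 K hK) (Ioc_subset_Icc_self ht)
        (reverse_mem_H1closure he heV (𝒯.Ioc_slab_subset hj') t)]
  rw [hadj]
  simp only [Θ5Dual, Finset.sum_neg_distrib]
  congr 1
  have hsig : ∀ n, ∑ j ∈ Finset.Icc n 𝒯.N, ∑ K ∈ M n j, ∫ t in (𝒯.τ (n - 1))..(𝒯.τ n),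
      D.bdryPair K (D.rd (M n j) (U t) K)
        (∫ s in (max (𝒯.τ (j - 1)) t)..(𝒯.τ j), D.ker (s - t) • e s)
      = ∑ p ∈ (Finset.Icc n 𝒯.N).sigma (M n), ∫ t in (𝒯.τ (n - 1))..(𝒯.τ n),
        D.bdryPair p.2 (D.rd (M n p.1) (U t) p.2)
          (∫ s in (max (𝒯.τ (p.1 - 1)) t)..(𝒯.τ p.1), D.ker (s - t) • e s) := fun n => by
    rw [Finset.sum_sigma]
  simp only [hsig]
  refine 𝒯.sum_sum_integral (fun n => (Finset.Icc n 𝒯.N).sigma (M n))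
    (F := fun n p t => D.bdryPair p.2 (D.rd (M n p.1) (U t) p.2)
      (∫ s in (max (𝒯.τ (p.1 - 1)) t)..(𝒯.τ p.1), D.ker (s - t) • e s))
    ((𝒯.bddMeas_jumpForm hΓ).apply hst).integrable (fun n hn p hp => ?_) fun n hn => ?_
  · obtain ⟨j, K⟩ := p
    obtain ⟨hj, hK⟩ := Finset.mem_sigma.1 hp
    have hle := Measure.restrict_mono_set volume (𝒯.Ioc_slab_subset (hj1 n hn j hj))
    refine ((𝒯.bddMeas_slabJump (T := T) (M := M n j) (U := U) (n := n) (K := K)).apply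
      (Data.bddMeas_reverse (D := D) (he.mono hle))).integrable.congr ?_
    filter_upwards [ae_restrict_mem measurableSet_Ioc] with t ht
    exact (key n hn j hj K hK t ht).symm
  · filter_upwards [ae_restrict_mem measurableSet_Ioc] with t ht
    have hn' := Finset.mem_Icc.1 hn
    have e1 : ∀ j ∈ Finset.Icc n 𝒯.N, ∑ K ∈ M n j, D.bdryPair K (D.rd (M n j) (U t) K)
          (∫ s in (max (𝒯.τ (j - 1)) t)..(𝒯.τ j), D.ker (s - t) • e s)
        = 𝒯.jumpForm T hΓ U t (∫ s in (𝒯.τ (j - 1))..(𝒯.τ j), D.k (s - t) • e s) := by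
      intro j hj
      obtain ⟨m1, m2, m3, m4⟩ := hmesh n hn j hj
      have hj' := hj1 n hn j hj
      rw [Finset.sum_congr rfl fun K hK => key n hn j hj K hK t ht,
        intervalIntegral.integral_of_le (𝒯.τ_lt j hj').le]
      exact sum_slabJump_reverse hd hT hΓ hU he heV m1 m2 hn m3 m4 (Ioc_subset_Icc_self ht)
        (𝒯.Ioc_slab_subset hj')
    have e2 := 𝒯.sum_integral_slab (Data.integrable_smul_reverse (D := D) he t)
      (show n - 1 ≤ 𝒯.N by omega) le_rfl
    rw [show n - 1 + 1 = n by omega, 𝒯.τ_last] at e2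
    have hmem := 𝒯.τ_mem (show n - 1 ≤ 𝒯.N by omega)
    rw [Finset.sum_sigma, Finset.sum_congr rfl e1, ← map_sum, e2, Data.volterraStar,
      intervalIntegral.integral_of_le hmem.2]
    congr 1
    -- The slabs `j ≥ n` cover only times after `τ (n - 1)`; at earlier times `s < t`, and the
    -- extended kernel vanishes.
    refine (setIntegral_eq_of_subset_of_forall_sdiff_eq_zero measurableSet_Ioc
      (Ioc_subset_Ioc_left hmem.1) fun s hs => ?_).symm
    have hs' : s - t ∉ Ioi (0 : ℝ) := by
      intro h
      exact hs.2 ⟨by have := ht.1; have := mem_Ioi.1 h; linarith, hs.1.2⟩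
    rw [Data.k, indicator_of_notMem hs', zero_smul]

/-- Here the kernel stays on the residual and no adjoint is taken. For `t` in slab `n` the slabs `j
≤ n` exhaust the history, since the extended kernel vanishes at later times. -/
lemma Mesh.sum_Θ5Res :
    ∑ n ∈ Finset.Icc 1 𝒯.N, ∑ j ∈ Finset.Icc 1 n, ∑ K ∈ 𝒯.bar j, 𝒯.Θ5Res U e n j K
      = - ∫ t in Ioc 0 D.T, D.volterra (𝒯.jumpForm T hΓ U) t (e t) := by
  have hΨ := 𝒯.bddMeas_jumpForm (T := T) (U := U) hΓ (a := 0) (b := D.T)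
  have hj1 : ∀ n ∈ Finset.Icc 1 𝒯.N, ∀ j ∈ Finset.Icc 1 n, j ∈ Finset.Icc 1 𝒯.N := by
    intro n hn j hj
    rw [Finset.mem_Icc] at hn hj ⊢
    omega
  have hκ : ∀ (t : ℝ) (R : Set ℝ), IntegrableOn (fun s => D.k (t - s)) R := fun t R =>
    (D.integrable_k.comp_sub_left t).integrableOn
  have key : ∀ n ∈ Finset.Icc 1 𝒯.N, ∀ j ∈ Finset.Icc 1 n, ∀ K ∈ 𝒯.bar j,
      ∀ t ∈ Ioc (𝒯.τ (n - 1)) (𝒯.τ n), e t ∈ D.V →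
      D.bdryPair K (fun x => ∫ s in (𝒯.τ (j - 1))..(min (𝒯.τ j) t),
          D.ker (t - s) • D.rd (𝒯.bar j) (U s) K x) (e t)
        = ∫ s in Ioc (𝒯.τ (j - 1)) (𝒯.τ j), D.k (t - s) • 𝒯.slabJump T (𝒯.bar j) U j K s (e t) := by
    intro n hn j hj K hK t ht hq
    have hj' := hj1 n hn j hj
    have hjn := Finset.mem_Icc.1 hj
    have hn' := Finset.mem_Icc.1 hn
    have hlt : 𝒯.τ (j - 1) ≤ t :=
      (𝒯.τ_mono (show j - 1 ≤ n - 1 by omega) (by omega)).trans ht.1.le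
    simp only [D.integral_ker_left (𝒯.τ_lt j hj').le hlt]
    exact hU.bdryPair_conv_rd hd hT (𝒯.bar_tri j hj') hj' (bar_of_mem hj' (Or.inl rfl) hU)
      (bar_of_mem hj' (Or.inr rfl) hU) hK (hMS j hj' K hK) (hκ t _) (Data.mem_H1closure hq)
  simp only [Θ5Res, Finset.sum_neg_distrib]
  congr 1
  have hsig : ∀ n, ∑ j ∈ Finset.Icc 1 n, ∑ K ∈ 𝒯.bar j, ∫ t in (𝒯.τ (n - 1))..(𝒯.τ n),
      D.bdryPair K (fun x => ∫ s in (𝒯.τ (j - 1))..(min (𝒯.τ j) t),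
          D.ker (t - s) • D.rd (𝒯.bar j) (U s) K x) (e t)
      = ∑ p ∈ (Finset.Icc 1 n).sigma 𝒯.bar, ∫ t in (𝒯.τ (n - 1))..(𝒯.τ n),
        D.bdryPair p.2 (fun x => ∫ s in (𝒯.τ (p.1 - 1))..(min (𝒯.τ p.1) t),
          D.ker (t - s) • D.rd (𝒯.bar p.1) (U s) p.2 x) (e t) := fun n => by
    rw [Finset.sum_sigma]
  simp only [hsig]
  refine 𝒯.sum_sum_integral (fun n => (Finset.Icc 1 n).sigma 𝒯.bar)
    (F := fun n p t => D.bdryPair p.2 (fun x => ∫ s in (𝒯.τ (p.1 - 1))..(min (𝒯.τ p.1) t),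
          D.ker (t - s) • D.rd (𝒯.bar p.1) (U s) p.2 x) (e t))
    ((Data.bddMeas_volterra hΨ).apply he).integrable (fun n hn p hp => ?_) fun n hn => ?_
  · obtain ⟨j, K⟩ := p
    obtain ⟨hj, hK⟩ := Finset.mem_sigma.1 hp
    have hle := Measure.restrict_mono_set volume (𝒯.Ioc_slab_subset hn)
    have hJ := 𝒯.bddMeas_slabJump (T := T) (M := 𝒯.bar j) (U := U) (n := j) (K := K)
      (a := 𝒯.τ (j - 1)) (b := 𝒯.τ j)
    refine ((hJ.conv D.integrable_k).apply (he.mono hle)).integrable.congr ?_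
    filter_upwards [ae_mono hle heV, ae_restrict_mem measurableSet_Ioc] with t hq ht
    rw [key n hn j hj K hK t ht hq, ContinuousLinearMap.integral_apply
      (hJ.kernel_integrable D.integrable_k t)]
    rfl
  · have hle := Measure.restrict_mono_set volume (𝒯.Ioc_slab_subset hn)
    filter_upwards [ae_mono hle heV, ae_restrict_mem measurableSet_Ioc] with t hq ht
    have hn' := Finset.mem_Icc.1 hn
    have hi := hΨ.kernel_integrable D.integrable_k t
    have hi' : IntegrableOn (fun s => D.k (t - s) • 𝒯.jumpForm T hΓ U s (e t)) (Ioc 0 D.T) :=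
      hi.apply_continuousLinearMap (e t)
    have e1 : ∀ j ∈ Finset.Icc 1 n, ∑ K ∈ 𝒯.bar j, D.bdryPair K
          (fun x => ∫ s in (𝒯.τ (j - 1))..(min (𝒯.τ j) t),
            D.ker (t - s) • D.rd (𝒯.bar j) (U s) K x) (e t)
        = ∫ s in (𝒯.τ (j - 1))..(𝒯.τ j), D.k (t - s) • 𝒯.jumpForm T hΓ U s (e t) := by
      intro j hj
      have hj' := hj1 n hn j hj
      rw [Finset.sum_congr rfl fun K hK => key n hn j hj K hK t ht hq,
        intervalIntegral.integral_of_le (𝒯.τ_lt j hj').le, ← integral_finsetSum]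
      · refine setIntegral_congr_fun measurableSet_Ioc fun s hs => ?_
        beta_reduce
        rw [← Finset.smul_sum, hU.sum_slabJump hd hT hΓ (𝒯.bar_tri j hj') (hMS j hj') hj'
          (bar_of_mem hj' (Or.inl rfl) hU) (bar_of_mem hj' (Or.inr rfl) hU)
          (Ioc_subset_Icc_self hs) hq]
      · intro K _
        exact (𝒯.bddMeas_slabJump.kernel_integrable D.integrable_k t).apply_continuousLinearMap
          (e t)
    have e2 := 𝒯.sum_integral_slab hi' (Nat.zero_le n) hn'.2
    rw [zero_add, 𝒯.τ_zero] at e2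
    have hmem := 𝒯.τ_mem hn'.2
    rw [Finset.sum_sigma, Finset.sum_congr rfl e1, e2, Data.volterra,
      ContinuousLinearMap.integral_apply hi, intervalIntegral.integral_of_le hmem.1]
    refine (setIntegral_eq_of_subset_of_forall_sdiff_eq_zero measurableSet_Ioc
      (Ioc_subset_Ioc_right hmem.2) fun s hs => ?_).symm
    have hs' : t - s ∉ Ioi (0 : ℝ) := by
      intro h
      exact hs.2 ⟨hs.1.1, by have := ht.2; have := mem_Ioi.1 h; linarith⟩
    rw [Data.k, indicator_of_notMem hs', zero_smul]

end BoundarySums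

/-! ### The residual identity and the error representation. -/

section Representation

variable {d : ℕ} {D : Data d} {𝒯 : Mesh D} {U U₁ U₂ : ℝ → Vec d → Vec d}
  {S : Set (Vec d)} {T : Pair D.Ω →L[ℝ] Lp (Vec d) 2 ((surf d).restrict S)}
  {v₁ w₁ : ℝ → HSpace D.Ω} {v₂ w₂ : ℝ → Pair D.Ω}

namespace Mesh.MemTrial

lemma memH1Time_emb (hU : 𝒯.MemTrial U) : MemH1Time D.T univ (emb D U) :=
  (𝒯.memH1Time_interp _).congr D.T_pos.le fun _ ht => hU.toPair_eq ht

lemma memH1Time_embH (hU : 𝒯.MemTrial U) : MemH1Time D.T univ (embH D U) :=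
  hU.memH1Time_emb.clm (ContinuousLinearMap.fst ℝ _ _)

lemma emb_mem (hU : 𝒯.MemTrial U) {t : ℝ} (ht : t ∈ Icc 0 D.T) : emb D U t ∈ D.V := by
  obtain ⟨n, hn, h1, h2⟩ := 𝒯.exists_slab ht
  have hn' := Finset.mem_Icc.1 hn
  rcases h1.eq_or_lt with rfl | h1
  · exact (hU.node (n - 1) (by omega)).mem
  rcases h2.eq_or_lt with rfl | h2
  · exact (hU.node n hn'.2).mem
  exact (hU.slab n hn t ⟨h1, h2⟩).mem

end Mesh.MemTrial

namespace Data

lemma L_eq (hT : IsTraceOperator D.domain.bounded S T)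
    (hΓ : (surf d).restrict D.ΓN ≤ (surf d).restrict S) (hΓS : D.ΓN ⊆ S)
    (hv : ∀ᵐ t ∂volume.restrict (Ioc 0 D.T), v₂ t ∈ D.V) :
    D.L v₁ v₂ = (∫ t in Ioc 0 D.T, (inner ℝ (D.f t) (v₂ t).1 + D.neumannForm T hΓ (D.gN t) (v₂ t)))
      + inner ℝ D.u₀ (v₁ 0) + inner ℝ D.v₀ (v₂ 0).1 := by
  rw [L, intervalIntegral.integral_of_le D.T_pos.le]
  congr 2
  refine integral_congr_ae ?_
  filter_upwards [hv] with t ht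
  rw [hT.gPair_eq hΓS hΓ t (mem_H1closure ht), neumannForm_apply]

lemma integrable_load (hΓ : (surf d).restrict D.ΓN ≤ (surf d).restrict S)
    (hv₂ : BddMeas (volume.restrict (Ioc 0 D.T)) v₂) :
    IntegrableOn (fun t => inner ℝ (D.f t) (v₂ t).1 + D.neumannForm T hΓ (D.gN t) (v₂ t))
      (Ioc 0 D.T) :=
  ((hv₂.clm (ContinuousLinearMap.fst ℝ _ _)).inner_integrable
    (D.f_mem.integrable one_le_two)).add
      (hv₂.bilin_integrable (D.memLp_gN.integrable one_le_two) _)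

lemma L_sub (hT : IsTraceOperator D.domain.bounded S T)
    (hΓ : (surf d).restrict D.ΓN ≤ (surf d).restrict S) (hΓS : D.ΓN ⊆ S)
    (hv₂ : BddMeas (volume.restrict (Ioc 0 D.T)) v₂)
    (hw₂ : BddMeas (volume.restrict (Ioc 0 D.T)) w₂)
    (hv : ∀ᵐ t ∂volume.restrict (Ioc 0 D.T), v₂ t ∈ D.V)
    (hw : ∀ᵐ t ∂volume.restrict (Ioc 0 D.T), w₂ t ∈ D.V) :
    D.L (fun t => v₁ t - w₁ t) (fun t => v₂ t - w₂ t) = D.L v₁ v₂ - D.L w₁ w₂ := by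
  have hvw : ∀ᵐ t ∂volume.restrict (Ioc 0 D.T), v₂ t - w₂ t ∈ D.V := by
    filter_upwards [hv, hw] with t h1 h2
    exact VSpace.sub D.domain.bounded h1 h2
  rw [L_eq hT hΓ hΓS hv, L_eq hT hΓ hΓS hw, L_eq hT hΓ hΓS hvw]
  have e : ∫ t in Ioc 0 D.T, (inner ℝ (D.f t) (v₂ t - w₂ t).1
        + D.neumannForm T hΓ (D.gN t) (v₂ t - w₂ t))
      = (∫ t in Ioc 0 D.T, (inner ℝ (D.f t) (v₂ t).1 + D.neumannForm T hΓ (D.gN t) (v₂ t)))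
        - ∫ t in Ioc 0 D.T, (inner ℝ (D.f t) (w₂ t).1 + D.neumannForm T hΓ (D.gN t) (w₂ t)) := by
    rw [← integral_sub (integrable_load hΓ hv₂) (integrable_load hΓ hw₂)]
    refine integral_congr_ae (Eventually.of_forall fun t => ?_)
    simp only [inner_sub_right, map_sub, Prod.fst_sub]
    ring
  rw [e]
  simp only [Prod.fst_sub, inner_sub_right]
  ring

end Data

/-- As an identity of functionals it can be convolved in time before any test field is inserted. -/
lemma Mesh.MemTrial.aL_emb (hU : 𝒯.MemTrial U)
    (hΓ : (surf d).restrict D.ΓN ≤ (surf d).restrict S) {t : ℝ} (ht : t ∈ Icc 0 D.T) :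
    D.aL (emb D U t) = 𝒯.jumpForm T hΓ U t + D.neumannForm T hΓ (𝒯.bdryStressLp U t) := by
  rw [emb, hU.toPair_eq ht, jumpForm]
  refine ContinuousLinearMap.ext fun q => ?_
  simp only [_root_.add_apply, _root_.sub_apply, Data.neumannForm_apply,
    ContinuousLinearMap.comp_apply, sub_add_cancel]

lemma Data.map_volterra_add {E F G : Type*} [NormedAddCommGroup E] [NormedSpace ℝ E]
    [CompleteSpace E] [NormedAddCommGroup F] [NormedSpace ℝ F] [CompleteSpace F]
    [NormedAddCommGroup G] [NormedSpace ℝ G] [CompleteSpace G] {u : ℝ → E} {w : ℝ → G} {ψ : ℝ → F}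
    (hu : BddMeas (volume.restrict (Ioc 0 D.T)) u) (hw : BddMeas (volume.restrict (Ioc 0 D.T)) w)
    (hψ : BddMeas (volume.restrict (Ioc 0 D.T)) ψ) (A : E →L[ℝ] F) (B : G →L[ℝ] F)
    (h : ∀ s ∈ Ioc 0 D.T, A (u s) = ψ s + B (w s)) (t : ℝ) :
    A (D.volterra u t) = D.volterra ψ t + B (D.volterra w t) := by
  rw [map_volterra hu, map_volterra hw, volterra, volterra, volterra,
    ← integral_add (hψ.kernel_integrable D.integrable_k t)
      ((hw.clm B).kernel_integrable D.integrable_k t)]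
  refine setIntegral_congr_fun measurableSet_Ioc fun s hs => ?_
  rw [h s hs, smul_add]

lemma Mesh.MemTrial.aL_volterra (hU : 𝒯.MemTrial U)
    (hΓ : (surf d).restrict D.ΓN ≤ (surf d).restrict S) (t : ℝ) :
    D.aL (D.volterra (emb D U) t) = D.volterra (𝒯.jumpForm T hΓ U) t
      + D.neumannForm T hΓ (D.volterra (𝒯.bdryStressLp U) t) := by
  have hb : BddMeas (volume.restrict (Ioc 0 D.T)) (𝒯.bdryStressLp U) :=
    BddMeas.of_continuousOn (𝒯.continuous_interp _).continuousOn
  have h1 := hU.memH1Time_emb.bddMeas D.T_pos.le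
  have h2 := 𝒯.bddMeas_jumpForm (T := T) (U := U) hΓ (a := 0) (b := D.T)
  have h3 : ∀ s ∈ Ioc 0 D.T, _ := fun s hs =>
    hU.aL_emb (T := T) hΓ (Ioc_subset_Icc_self hs)
  exact Data.map_volterra_add h1 hb h2 D.aL (D.neumannForm T hΓ) h3 t

/-- The integrated residual of a trial function. -/
lemma Mesh.residual_eq (hU₁ : 𝒯.MemTrial U₁) (hU₂ : 𝒯.MemTrial U₂)
    (hT : IsTraceOperator D.domain.bounded S T)
    (hΓ : (surf d).restrict D.ΓN ≤ (surf d).restrict S) (hΓS : D.ΓN ⊆ S)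
    (hv₁ : BddMeas (volume.restrict (Ioc 0 D.T)) v₁)
    (hv₂ : BddMeas (volume.restrict (Ioc 0 D.T)) v₂)
    (hv : ∀ᵐ t ∂volume.restrict (Ioc 0 D.T), v₂ t ∈ D.V) :
    D.B (emb D U₁) (embH D U₂) v₁ v₂ - D.L v₁ v₂
      = inner ℝ (embH D U₁ 0 - D.u₀) (v₁ 0) + inner ℝ (embH D U₂ 0 - D.v₀) (v₂ 0).1
        + ((∫ t in Ioc 0 D.T, inner ℝ (deriv (embH D U₁) t - embH D U₂ t) (v₁ t))
        + (∫ t in Ioc 0 D.T, inner ℝ (deriv (embH D U₂) t - D.f t) (v₂ t).1)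
        + (∫ t in Ioc 0 D.T, D.neumannForm T hΓ (𝒯.neumannResidual U₁ t) (v₂ t))
        + ∫ t in Ioc 0 D.T, 𝒯.jumpForm T hΓ U₁ t (v₂ t))
        + - ∫ t in Ioc 0 D.T, D.volterra (𝒯.jumpForm T hΓ U₁) t (v₂ t) := by
  have h0 := D.T_pos.le
  have h1 := hU₁.memH1Time_emb
  have h2 := hU₂.memH1Time_embH
  let fst : Pair D.Ω →L[ℝ] HSpace D.Ω := ContinuousLinearMap.fst ℝ _ _
  have i1 : IntegrableOn (fun t => inner ℝ (deriv (embH D U₁) t - embH D U₂ t) (v₁ t))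
      (Ioc 0 D.T) :=
    hv₁.inner_integrable ((hU₁.memH1Time_embH.integrable_deriv h0).sub (h2.bddMeas h0).integrable)
  have i2 : IntegrableOn (fun t => inner ℝ (deriv (embH D U₂) t - D.f t) (v₂ t).1) (Ioc 0 D.T) :=
    (hv₂.clm fst).inner_integrable
      ((h2.integrable_deriv h0).sub (D.f_mem.integrable one_le_two))
  have i3 : IntegrableOn (fun t => D.neumannForm T hΓ (𝒯.neumannResidual U₁ t) (v₂ t))
      (Ioc 0 D.T) := hv₂.bilin_integrable 𝒯.integrable_neumannResidual _
  have hΨ := 𝒯.bddMeas_jumpForm (T := T) (U := U₁) hΓ (a := 0) (b := D.T)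
  have i4 : IntegrableOn (fun t => 𝒯.jumpForm T hΓ U₁ t (v₂ t)) (Ioc 0 D.T) :=
    (hΨ.apply hv₂).integrable
  have i5 : IntegrableOn (fun t => D.volterra (𝒯.jumpForm T hΓ U₁) t (v₂ t)) (Ioc 0 D.T) :=
    ((Data.bddMeas_volterra hΨ).apply hv₂).integrable
  have hvol := hU₁.aL_volterra (T := T) hΓ
  -- Once `a` and its Volterra image are split into jump and boundary parts, the boundary parts and
  -- `g` combine to the Neumann residual.
  have key : (∫ t in Ioc 0 D.T, D.density (emb D U₁) (embH D U₂) v₁ v₂ t)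
      - (∫ t in Ioc 0 D.T, (inner ℝ (D.f t) (v₂ t).1 + D.neumannForm T hΓ (D.gN t) (v₂ t)))
      = ∫ t in Ioc 0 D.T, (inner ℝ (deriv (embH D U₁) t - embH D U₂ t) (v₁ t)
        + inner ℝ (deriv (embH D U₂) t - D.f t) (v₂ t).1
        - D.volterra (𝒯.jumpForm T hΓ U₁) t (v₂ t)
        + D.neumannForm T hΓ (𝒯.neumannResidual U₁ t) (v₂ t)
        - -(𝒯.jumpForm T hΓ U₁ t (v₂ t))) := by
    rw [← integral_sub (Data.integrable_density h1 h2 hv₁ hv₂) (Data.integrable_load hΓ hv₂)]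
    refine integral_congr_ae ?_
    filter_upwards [h1.deriv_clm h0 fst, ae_restrict_mem measurableSet_Ioc] with t h3 ht
    have h4 : deriv (embH D U₁) t = (deriv (emb D U₁) t).1 := h3
    have h5 : 𝒯.neumannResidual U₁ t = 𝒯.bdryStressLp U₁ t - D.volterra (𝒯.bdryStressLp U₁) t
        - D.gN t := rfl
    simp only [Data.density, hvol, hU₁.aL_emb (T := T) hΓ (Ioc_subset_Icc_self ht), h4, h5,
      inner_sub_left, map_sub, _root_.add_apply, _root_.sub_apply]
    ring
  have e := integral_combination i1 i2 i5 i3 i4.neg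
  simp only [Pi.neg_apply, integral_neg] at e
  rw [Data.B_eq h1, Data.L_eq hT hΓ hΓS hv]
  have h6 : (emb D U₁ 0).1 = embH D U₁ 0 := rfl
  rw [h6, inner_sub_left (embH D U₁ 0), inner_sub_left (embH D U₂ 0)]
  linarith [key.trans e]

/-- The goal functional of the error is the residual tested with the error of an approximation of
the dual solution. -/
lemma Mesh.LStar_error (hT : IsTraceOperator D.domain.bounded S T)
    (hΓ : (surf d).restrict D.ΓN ≤ (surf d).restrict S) (hΓS : D.ΓN ⊆ S)
    {u₁ : ℝ → Pair D.Ω} {u₂ : ℝ → HSpace D.Ω} (hu : D.IsWeakSolution u₁ u₂)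
    (hU : 𝒯.IsCG U₁ U₂) {z₁ : ℝ → HSpace D.Ω} {z₂ : ℝ → Pair D.Ω} (hz : D.IsDualSolution z₁ z₂)
    {zh₁ zh₂ : ℝ → Vec d → Vec d} (hzh₁ : 𝒯.MemTest zh₁) (hzh₂ : 𝒯.MemTest zh₂) :
    D.LStar (fun t => emb D U₁ t - u₁ t) (fun t => embH D U₂ t - u₂ t)
      = D.B (emb D U₁) (embH D U₂) (fun t => z₁ t - embH D zh₁ t) (fun t => z₂ t - emb D zh₂ t)
        - D.L (fun t => z₁ t - embH D zh₁ t) (fun t => z₂ t - emb D zh₂ t) := by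
  have h0 := D.T_pos.le
  obtain ⟨⟨hu₁, hu₂⟩, hB⟩ := hu
  obtain ⟨hU₁, hU₂, hCG⟩ := hU
  obtain ⟨⟨hz₁, hz₂⟩, hBs⟩ := hz
  have k1 := hU₁.memH1Time_emb
  have k2 := hU₂.memH1Time_embH
  have b1 := hz₁.bddMeas h0
  have b2 := hz₂.bddMeas h0
  have c1 : BddMeas (volume.restrict (Ioc 0 D.T)) (embH D zh₁) :=
    Mesh.MemTest.bddMeas 𝒯 hzh₁ fun w => (toPair D.Ω w).1
  have c2 : BddMeas (volume.restrict (Ioc 0 D.T)) (emb D zh₂) :=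
    Mesh.MemTest.bddMeas 𝒯 hzh₂ fun w => toPair D.Ω w
  have hzV : ∀ᵐ t ∂volume.restrict (Ioc 0 D.T), z₂ t ∈ D.V := by
    filter_upwards [ae_restrict_mem measurableSet_Ioc] with t ht
    exact hz₂.1 t (Ioc_subset_Icc_self ht)
  have hzhV : ∀ᵐ t ∂volume.restrict (Ioc 0 D.T), emb D zh₂ t ∈ D.V := by
    rw [← Measure.restrict_congr_set Ico_ae_eq_Ioc]
    filter_upwards [ae_restrict_mem measurableSet_Ico] with t ht
    exact Mesh.MemTest.mem_V 𝒯 hzh₂ ht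
  have hright : ∀ {X : Type _} [NormedAddCommGroup X] {v : ℝ → X}, ContinuousOn v (Icc 0 D.T) →
      ∀ t ∈ Ico 0 D.T, ContinuousWithinAt v (Ici t) t := fun hv t ht =>
    (hv t (Ico_subset_Icc_self ht)).mono_of_mem_nhdsWithin
      (mem_of_superset (Icc_mem_nhdsGE ht.2) (Icc_subset_Icc_left ht.1))
  have hleft : ∀ {X : Type _} [NormedAddCommGroup X] {v : ℝ → X}, ContinuousOn v (Icc 0 D.T) →
      ∀ t ∈ Ioc 0 D.T, ContinuousWithinAt v (Iic t) t := fun hv t ht =>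
    (hv t (Ioc_subset_Icc_self ht)).mono_of_mem_nhdsWithin
      (mem_of_superset (Icc_mem_nhdsLE ht.1) (Icc_subset_Icc_right ht.2))
  have hzMem : D.MemV z₁ z₂ := ⟨b1.memLp, b2.memLp, fun t ht => hz₂.1 t (Ico_subset_Icc_self ht),
    hright (hz₁.continuousOn h0), hright (hz₂.continuousOn h0)⟩
  have hs1 := k1.sub hu₁
  have hs2 := k2.sub hu₂
  have hEMem : D.MemVStar (fun t => emb D U₁ t - u₁ t) (fun t => embH D U₂ t - u₂ t) :=
    ⟨(hs1.bddMeas h0).memLp, (hs2.bddMeas h0).memLp,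
      fun t ht => VSpace.sub D.domain.bounded (hU₁.emb_mem (Ioc_subset_Icc_self ht))
        (hu₁.1 t (Ioc_subset_Icc_self ht)),
      hleft (hs1.continuousOn h0), hleft (hs2.continuousOn h0)⟩
  -- The chain is `L*(e) = B*(e, z) = B(e, z) = B(U, z) - L(z)`, from which the vanishing quantity
  -- `B(U, z_hk) - L(z_hk)` is subtracted.
  rw [← hBs _ _ hEMem, Data.BStar_eq_B hs1 hs2 hz₁ hz₂, Data.B_sub_left k1 k2 hu₁ hu₂ b1 b2,
    hB _ _ hzMem, Data.B_sub_right k1 k2 b1 b2 c1 c2, hCG _ _ hzh₁ hzh₂,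
    Data.L_sub hT hΓ hΓS b2 c2 hzV hzhV]
  ring

/-- The skeleton of all triangulations of a space-time mesh. -/
def Mesh.skeleton (𝒯 : Mesh D) : Set (Vec d) :=
  ⋃ n ∈ Finset.Icc 1 𝒯.N, ⋃ K ∈ 𝒯.bar n, frontier K

lemma Mesh.frontier_subset_skeleton {n : ℕ} (hn : n ∈ Finset.Icc 1 𝒯.N) {K : Set (Vec d)}
    (hK : K ∈ 𝒯.bar n) : frontier K ⊆ 𝒯.skeleton :=
  (subset_iUnion₂ (s := fun K (_ : K ∈ 𝒯.bar n) => frontier K) K hK).trans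
    (subset_iUnion₂ (s := fun n (_ : n ∈ Finset.Icc 1 𝒯.N) => ⋃ K ∈ 𝒯.bar n, frontier K) n hn)

lemma Mesh.exists_isTraceOperator (hd : 1 ≤ d) (𝒯 : Mesh D) :
    ∃ T : Pair D.Ω →L[ℝ] Lp (Vec d) 2 ((surf d).restrict 𝒯.skeleton),
      IsTraceOperator D.domain.bounded 𝒯.skeleton T := by
  have hS : TraceIneq D.Ω 𝒯.skeleton := by
    refine TraceIneq.biUnion _ fun n hn => TraceIneq.biUnion _ fun K hK => ?_
    have hM := 𝒯.bar_tri n hn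
    exact (hM.simplex K hK).traceIneq hd (hM.interior_subset D.domain.one_sided hK)
  obtain ⟨T, hT⟩ := exists_trace_operator D.domain.bounded hS
  refine ⟨T, fun φ => ?_⟩
  rw [hT φ]
  exact MemLp.coeFn_toLp _

/-- `Q` is the memory part of the residual. The representations share all other terms and differ
only in how `Q` is distributed over cells and slabs. -/
theorem error_representation (hd : 1 ≤ d) (𝒯 : Mesh D)
    {u₁ : ℝ → Pair D.Ω} {u₂ : ℝ → HSpace D.Ω} (hu : D.IsWeakSolution u₁ u₂)
    (hU : 𝒯.IsCG U₁ U₂) {z₁ : ℝ → HSpace D.Ω} {z₂ : ℝ → Pair D.Ω} (hz : D.IsDualSolution z₁ z₂)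
    {zh₁ zh₂ : ℝ → Vec d → Vec d} (hzh₁ : 𝒯.MemTest zh₁) (hzh₂ : 𝒯.MemTest zh₂)
    {e₁ : ℝ → HSpace D.Ω} (he₁ : e₁ = fun t => z₁ t - embH D zh₁ t)
    {e₂ : ℝ → Pair D.Ω} (he₂ : e₂ = fun t => z₂ t - emb D zh₂ t) :
    ∃ Q : ℝ, D.LStar (fun t => emb D U₁ t - u₁ t) (fun t => embH D U₂ t - u₂ t)
        = ∑ K ∈ 𝒯.mesh 0, D.Θ0 U₁ U₂ e₁ e₂ K
          + ∑ n ∈ Finset.Icc 1 𝒯.N, ∑ K ∈ 𝒯.bar n, 𝒯.Θ1to4 U₁ U₂ e₁ e₂ n K + Q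
      ∧ ∑ n ∈ Finset.Icc 1 𝒯.N, ∑ j ∈ Finset.Icc 1 n, ∑ K ∈ 𝒯.bar j, 𝒯.Θ5Res U₁ e₂ n j K = Q
      ∧ ∑ n ∈ Finset.Icc 1 𝒯.N, ∑ K ∈ 𝒯.bar n, 𝒯.Θ5Cell U₁ e₂ n K = Q
      ∧ ∀ M : ℕ → ℕ → Finset (Set (Vec d)), (∀ n ∈ Finset.Icc 1 𝒯.N, ∀ j ∈ Finset.Icc n 𝒯.N,
          M n j = 𝒯.bar n ∨ M n j = 𝒯.bar j ∧ Refines (𝒯.bar j) (𝒯.bar n)) →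
        ∑ n ∈ Finset.Icc 1 𝒯.N, ∑ j ∈ Finset.Icc n 𝒯.N, ∑ K ∈ M n j,
          𝒯.Θ5Dual (M n j) U₁ e₂ n j K = Q := by
  have h0 := D.T_pos.le
  obtain ⟨T, hT⟩ := 𝒯.exists_isTraceOperator hd
  have hMS : ∀ n ∈ Finset.Icc 1 𝒯.N, ∀ K ∈ 𝒯.bar n, frontier K ⊆ 𝒯.skeleton :=
    fun n hn K hK => 𝒯.frontier_subset_skeleton hn hK
  -- Since `0 < T` there is a first slab, and the cell boundaries of its triangulation already cover
  -- the boundary of the domain.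
  have h1 : 1 ∈ Finset.Icc 1 𝒯.N := Finset.mem_Icc.2 ⟨le_rfl, 𝒯.one_le_N⟩
  have hΓS : D.ΓN ⊆ 𝒯.skeleton :=
    D.ΓN_subset.trans ((𝒯.bar_tri 1 h1).frontier_subset_of_cells (hMS 1 h1))
  have hΓ := Measure.restrict_mono_set (surf d) hΓS
  have herr := Mesh.LStar_error hT hΓ hΓS hu hU hz hzh₁ hzh₂
  obtain ⟨hU₁, hU₂, -⟩ := hU
  obtain ⟨⟨hz₁, hz₂⟩, -⟩ := hz
  have b1 : BddMeas (volume.restrict (Ioc 0 D.T)) e₁ := by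
    rw [he₁]
    exact (hz₁.bddMeas h0).sub (Mesh.MemTest.bddMeas 𝒯 hzh₁ fun w => (toPair D.Ω w).1)
  have b2 : BddMeas (volume.restrict (Ioc 0 D.T)) e₂ := by
    rw [he₂]
    exact (hz₂.bddMeas h0).sub (Mesh.MemTest.bddMeas 𝒯 hzh₂ fun w => toPair D.Ω w)
  have heV : ∀ᵐ t ∂volume.restrict (Ioc 0 D.T), e₂ t ∈ D.V := by
    rw [← Measure.restrict_congr_set Ico_ae_eq_Ioc]
    filter_upwards [ae_restrict_mem measurableSet_Ico] with t ht
    rw [he₂]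
    exact VSpace.sub D.domain.bounded (hz₂.1 t (Ico_subset_Icc_self ht))
      (Mesh.MemTest.mem_V 𝒯 hzh₂ ht)
  rw [← he₁, ← he₂, Mesh.residual_eq hU₁ hU₂ hT hΓ hΓS b1 b2 heV] at herr
  refine ⟨_, herr.trans ?_, Mesh.sum_Θ5Res hd hT hΓ hMS hU₁ b2 heV,
    Mesh.sum_Θ5Cell hd hT hΓ hMS hU₁ b2 heV, Mesh.sum_Θ5Dual hd hT hΓ hMS hU₁ b2 heV⟩
  have s0 : ∑ K ∈ 𝒯.mesh 0, D.Θ0 U₁ U₂ e₁ e₂ K = inner ℝ (embH D U₁ 0 - D.u₀) (e₁ 0)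
      + inner ℝ (embH D U₂ 0 - D.v₀) (e₂ 0).1 := by
    have hM := 𝒯.mesh_tri 0 (Nat.zero_le _)
    simp only [Data.Θ0, Finset.sum_add_distrib, hM.sum_cellPair]
  have k2 := hU₂.memH1Time_embH
  have s1 : ∑ n ∈ Finset.Icc 1 𝒯.N, ∑ K ∈ 𝒯.bar n, 𝒯.Θ1 U₁ U₂ e₁ n K
      = ∫ t in Ioc 0 D.T, inner ℝ (deriv (embH D U₁) t - embH D U₂ t) (e₁ t) :=
    𝒯.sum_sum_integral_cellPair
      ((hU₁.memH1Time_embH.integrable_deriv h0).sub (k2.bddMeas h0).integrable) b1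
  have s2 : ∑ n ∈ Finset.Icc 1 𝒯.N, ∑ K ∈ 𝒯.bar n, 𝒯.Θ2 U₂ e₂ n K
      = ∫ t in Ioc 0 D.T, inner ℝ (deriv (embH D U₂) t - D.f t) (e₂ t).1 :=
    𝒯.sum_sum_integral_cellPair
      ((k2.integrable_deriv h0).sub (D.f_mem.integrable one_le_two))
      (b2.clm (ContinuousLinearMap.fst ℝ _ _))
  simp only [Mesh.Θ1to4, Finset.sum_add_distrib]
  rw [s0, s1, s2, Mesh.sum_Θ3 hd hT hΓ hMS hU₁ b2 heV, Mesh.sum_Θ4 hd hT hΓ hMS hU₁ b2 heV]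

end Representation

end Visco

end

theorem theorem1 {d : ℕ} (hd : d = 2 ∨ d = 3) (D : Visco.Data d) (𝒯 : Visco.Mesh D)
    -- the weak solution `u`, the Galerkin approximation `U`, the dual solution `z`
    (u₁ : ℝ → Visco.Pair D.Ω) (u₂ : ℝ → Visco.HSpace D.Ω) (hu : D.IsWeakSolution u₁ u₂)
    (U₁ U₂ : ℝ → Visco.Vec d → Visco.Vec d) (hU : 𝒯.IsCG U₁ U₂)
    (z₁ : ℝ → Visco.HSpace D.Ω) (z₂ : ℝ → Visco.Pair D.Ω) (hz : D.IsDualSolution z₁ z₂)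
    -- an approximation of `z` in the test space
    (zh₁ zh₂ : ℝ → Visco.Vec d → Visco.Vec d) (hzh₁ : 𝒯.MemTest zh₁) (hzh₂ : 𝒯.MemTest zh₂)
    -- the error of that approximation
    (e₁ : ℝ → Visco.HSpace D.Ω) (he₁ : e₁ = fun t => z₁ t - Visco.embH D zh₁ t)
    (e₂ : ℝ → Visco.Pair D.Ω) (he₂ : e₂ = fun t => z₂ t - Visco.emb D zh₂ t) :
    -- first representation
    D.LStar (fun t => Visco.emb D U₁ t - u₁ t) (fun t => Visco.embH D U₂ t - u₂ t)
        = ∑ K ∈ 𝒯.mesh 0, D.Θ0 U₁ U₂ e₁ e₂ K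
          + ∑ n ∈ Finset.Icc 1 𝒯.N, ∑ K ∈ 𝒯.bar n, 𝒯.Θ1to4 U₁ U₂ e₁ e₂ n K
          + ∑ n ∈ Finset.Icc 1 𝒯.N, ∑ j ∈ Finset.Icc 1 n, ∑ K ∈ 𝒯.bar j,
              𝒯.Θ5Res U₁ e₂ n j K
    -- second representation
    ∧ D.LStar (fun t => Visco.emb D U₁ t - u₁ t) (fun t => Visco.embH D U₂ t - u₂ t)
        = ∑ K ∈ 𝒯.mesh 0, D.Θ0 U₁ U₂ e₁ e₂ K
          + ∑ n ∈ Finset.Icc 1 𝒯.N, ∑ K ∈ 𝒯.bar n,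
              (𝒯.Θ1to4 U₁ U₂ e₁ e₂ n K + 𝒯.Θ5Cell U₁ e₂ n K)
    -- third representation, over the cells on which the residual lives
    ∧ D.LStar (fun t => Visco.emb D U₁ t - u₁ t) (fun t => Visco.embH D U₂ t - u₂ t)
        = ∑ K ∈ 𝒯.mesh 0, D.Θ0 U₁ U₂ e₁ e₂ K
          + ∑ n ∈ Finset.Icc 1 𝒯.N, ∑ K ∈ 𝒯.bar n, 𝒯.Θ1to4 U₁ U₂ e₁ e₂ n K
          + ∑ n ∈ Finset.Icc 1 𝒯.N, ∑ j ∈ Finset.Icc n 𝒯.N, ∑ K ∈ 𝒯.bar n,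
              𝒯.Θ5Dual (𝒯.bar n) U₁ e₂ n j K
    -- third representation over the cells of the later slabs, if those are refinements
    ∧ ((∀ n ∈ Finset.Icc 1 𝒯.N, ∀ j ∈ Finset.Icc n 𝒯.N, Visco.Refines (𝒯.bar j) (𝒯.bar n)) →
      D.LStar (fun t => Visco.emb D U₁ t - u₁ t) (fun t => Visco.embH D U₂ t - u₂ t)
        = ∑ K ∈ 𝒯.mesh 0, D.Θ0 U₁ U₂ e₁ e₂ K
          + ∑ n ∈ Finset.Icc 1 𝒯.N, ∑ K ∈ 𝒯.bar n, 𝒯.Θ1to4 U₁ U₂ e₁ e₂ n K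
          + ∑ n ∈ Finset.Icc 1 𝒯.N, ∑ j ∈ Finset.Icc n 𝒯.N, ∑ K ∈ 𝒯.bar j,
              𝒯.Θ5Dual (𝒯.bar j) U₁ e₂ n j K) := by
  obtain ⟨Q, h, h₁, h₂, h₃⟩ := Visco.error_representation (by omega) 𝒯 hu hU hz hzh₁ hzh₂ he₁ he₂
  refine ⟨by rw [h, h₁], ?_, ?_, fun hr => ?_⟩
  · simp only [Finset.sum_add_distrib, h₂]
    rw [h, add_assoc]
  -- The two forms of the third representation are two choices of triangulation for the pair `n`,
  -- `j`.
  · rw [h, h₃ (fun n _ => 𝒯.bar n) fun _ _ _ _ => Or.inl rfl]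
  · rw [h, h₃ (fun _ j => 𝒯.bar j) fun n hn j hj => Or.inr ⟨rfl, hr n hn j hj⟩]
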